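/- **Setting.** Let $\Gamma_1,\dots,\Gamma_7$ be purely imaginary antisymmetric $8\times 8$ matrices with $\Gamma_m\Gamma_n+\Gamma_n\Gamma_m=2\delta_{mn}\mathbb 1$ and $\Gamma_1\Gamma_2\cdots\Gamma_7=i\,\mathbb 1$; an explicit example (the standard choice) is $\Gamma_1=-\sigma_2\otimes\sigma_2\otimes\sigma_2$, $\Gamma_2=\mathbb 1\otimes\sigma_1\otimes\sigma_2$, $\Gamma_3=\mathbb 1\otimes\sigma_3\otimes\sigma_2$, $\Gamma_4=-\sigma_1\otimes\sigma_2\otimes\mathbb 1$, $\Gamma_5=\sigma_3\otimes\sigma_2\otimes\mathbb 1$, $\Gamma_6=\sigma_2\otimes\mathbb 1\otimes\sigma_1$, $\Gamma_7=\sigma_2\otimes\mathbb 1\otimes\sigma_3$, with $\sigma_j$ the Pauli matrices. Let $f_{mnk}$ be the totally antisymmetric octonion structure constants with $f_{165}=f_{134}=f_{127}=f_{235}=f_{246}=f_{367}=f_{475}=1$, the other components not obtained from these by permutation being $0$. The unit sphere $S^7\subset\mathbb R^8$, oriented as the boundary of the unit ball ($\varepsilon_{12\cdots 8}=1$), is parametrized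 by the ball $\|\alpha\|\le\pi$ in $\mathbb R^7$ through $x_m=\alpha_m\sin\|\alpha\|/\|\alpha\|$ ($m\le 7$), $x_8=\cos\|\alpha\|$. Put $$g_8=\exp\{i\alpha_m\Gamma_m\},\qquad g_7=\exp\{-\tfrac12\alpha_m f_{mnk}\Gamma_n\Gamma_k\}.$$ For a smooth map $g:S^7\to SO(8)$ and $A=i\,g^{-1}dg$ put $$q(g)=-\frac1{2^7\cdot3\cdot35\,\pi^4}\int_{S^7}\mathrm{Tr}\{(g^{-1}dg)^7\},\qquad \tilde q(g)=-\frac{i}{3\cdot2^{11}\cdot35\,\pi^4}\,\varepsilon^{abcdefgh}\int_{S^7}A^{ab}\wedge(A\wedge A)^{cd}\wedge(A\wedge A)^{ef}\wedge(A\wedge A)^{gh}.$$ For a gauge field $A=A_M\,dx_M$ on $\mathbb R^8$ with purely imaginary antisymmetric $A_M$ and $F=dA-iA\wedge A$ put $$q(A)=\frac1{384\pi^4}\int_{\mathbb R^8}\mathrm{Tr}\{F\wedge F\wedge F\wedge F\},\qquad \tilde q(A)=\frac1{3\cdot2^{11}\pi^4}\,\varepsilon^{a_1\cdots a_8}\int_{\mathbb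 R^8}F^{a_1a_2}\wedge F^{a_3a_4}\wedge F^{a_5a_6}\wedge F^{a_7a_8}.$$ Say that $A$ is *associated* with $g$ (extended to $\mathbb R^8\setminus\{0\}$ as a function of $x/\|x\|$) if $A$ is smooth, $A_M-i\,g^{-1}\partial_Mg=o(\|x\|^{-1})$ and $F_{MN}=o(\|x\|^{-2})$ as $\|x\|\to\infty$, and the integrands of $q(A)$ and $\tilde q(A)$ are integrable. **Statement.** The standard matrices satisfy the stated relations. For every choice of $\Gamma_m$ as above, the two formulas give well-defined maps $g_8,g_7$ on $S^7$, and there is a sign $s=\pm1$ depending only on $\Gamma$ such that the following holds. If $\Gamma_m=R\,\Gamma^{\rm st}_mR^T$ for all $m$, with $\Gamma^{\rm st}$ the standard choice and $R\in O(8)$, then $s=\det R$; in particular $s=1$ for the standard choice. 1. For all integers $n,m$, each of the maps $g=g_8^n g_7^m$ and $g=g_7^m g_8^n$ is a smooth map $S^7\to SO(8)$ with $$q(g)=n+m,\qquad \tilde q(g)=s\,(n-3m).$$ 2. In particular $(q,\,s\tilde q)$ equals $(1,1)$ for $g_8$, $(1,-3)$ for $g_7$, $(2,-2)$ for $g_7g_8$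 and $(0,-4)$ for $g_7g_8^{-1}$. 3. For each $g$ as in 1 there is a gauge field associated with $g$, and every gauge field $A$ associated with $g$ (in particular every instanton associated with $g$) has the charges $q(A)=n+m$, $\tilde q(A)=s\,(n-3m)$. 4. The two integer charges are independent: if $a,b\in\mathbb C$ satisfy $a\,q(A)+b\,\tilde q(A)=0$ for all gauge fields $A$ associated with some $g_8^ng_7^m$, $n,m\in\mathbb Z$, then $a=b=0$. -/

import Mathlib

open MeasureTheory Filter Topology Complex
open scoped ContDiff

noncomputable section

/-- Complex `8 × 8` matrices. -/
abbrev Mat8 := Matrix (Fin 8) (Fin 8) ℂ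

/-- Euclidean `ℝ⁸`; the coordinates `x₁, …, x₈` are `x 0, …, x 7`. -/
abbrev E8 := EuclideanSpace ℝ (Fin 8)

/-- Euclidean `ℝ⁷`, the space of the parameters `α₁, …, α₇`. -/
abbrev E7 := EuclideanSpace ℝ (Fin 7)

/-! ### Gamma matrices -/

/-- Seven purely imaginary antisymmetric `8 × 8` matrices with
`Γₘ Γₙ + Γₙ Γₘ = 2 δₘₙ` and `Γ₁ Γ₂ Γ₃ Γ₄ Γ₅ Γ₆ Γ₇ = i`. -/
structure IsGammaSystem (Γ : Fin 7 → Mat8) : Prop where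
  imaginary : ∀ m a b, (Γ m a b).re = 0
  antisymm : ∀ m, (Γ m).transpose = -Γ m
  clifford : ∀ m n, Γ m * Γ n + Γ n * Γ m = if m = n then 2 else 0
  product : Γ 0 * Γ 1 * Γ 2 * Γ 3 * Γ 4 * Γ 5 * Γ 6 = Complex.I • (1 : Mat8)

/-- Pauli matrices. -/
def pauli1 : Matrix (Fin 2) (Fin 2) ℂ := !![0, 1; 1, 0]

def pauli2 : Matrix (Fin 2) (Fin 2) ℂ := !![0, -Complex.I; Complex.I, 0]

def pauli3 : Matrix (Fin 2) (Fin 2) ℂ := !![1, 0; 0, -1]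

/-- The basis of `ℂ² ⊗ ℂ² ⊗ ℂ²` in the usual (lexicographic) order. -/
def tensorBasis : Fin 8 → Fin 2 × Fin 2 × Fin 2 :=
  ![(0, 0, 0), (0, 0, 1), (0, 1, 0), (0, 1, 1), (1, 0, 0), (1, 0, 1), (1, 1, 0), (1, 1, 1)]

/-- The Kronecker product `a ⊗ b ⊗ c` as an `8 × 8` matrix. -/
def tensor3 (a b c : Matrix (Fin 2) (Fin 2) ℂ) : Mat8 :=
  (Matrix.kronecker a (Matrix.kronecker b c)).submatrix tensorBasis tensorBasis

/-- The standard explicit gamma matrices. -/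
def gammaStd : Fin 7 → Mat8 :=
  ![-tensor3 pauli2 pauli2 pauli2,
    tensor3 1 pauli1 pauli2,
    tensor3 1 pauli3 pauli2,
    -tensor3 pauli1 pauli2 1,
    tensor3 pauli3 pauli2 1,
    tensor3 pauli2 1 pauli1,
    tensor3 pauli2 1 pauli3]

/-- The oriented lines `165, 134, 127, 235, 246, 367, 475` of the Fano plane, with all
labels lowered by one. -/
def fanoLine : Fin 7 → Fin 3 → Fin 7 :=
  ![![0, 5, 4], ![0, 2, 3], ![0, 1, 6], ![1, 2, 4], ![1, 3, 5], ![2, 5, 6], ![3, 6, 4]]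

/-- The structure constants `f_{mnk}` of the octonions: totally antisymmetric, equal to `1`
on each oriented line, and `0` on all triples that are not an ordering of a line. -/
def octF (m n k : Fin 7) : ℤ :=
  ∑ l : Fin 7, ∑ σ : Equiv.Perm (Fin 3),
    if ![m, n, k] = fanoLine l ∘ σ then (Equiv.Perm.sign σ : ℤ) else 0

/-! ### The maps -/

/-- `exp {i αₘ Γₘ}`. -/
def exp8 (Γ : Fin 7 → Mat8) (α : E7) : Mat8 :=
  NormedSpace.exp (∑ m, (Complex.I * (α m : ℂ)) • Γ m)

/-- `exp {-½ αₘ f_{mnk} Γₙ Γₖ}`. -/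
def exp7 (Γ : Fin 7 → Mat8) (α : E7) : Mat8 :=
  NormedSpace.exp (-((1 / 2 : ℂ) • ∑ m, ∑ n, ∑ k, ((α m : ℂ) * (octF m n k : ℂ)) • (Γ n * Γ k)))

/-- The parametrization of the unit sphere `S⁷` by the ball `‖α‖ ≤ π`:
`xₘ = αₘ sin ‖α‖ / ‖α‖`, `x₈ = cos ‖α‖`. The boundary of the ball goes to the south pole. -/
def ballToSphere (α : E7) : E8 :=
  WithLp.toLp 2 (Fin.snoc (fun m : Fin 7 => Real.sinc ‖α‖ * α m) (Real.cos ‖α‖))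

/-- The first seven coordinates `(x₁, …, x₇)`. -/
def horiz (x : E8) : E7 := WithLp.toLp 2 fun m : Fin 7 => x m.castSucc

open Classical in
/-- The inverse of `ballToSphere`, extended to `ℝ⁸ ∖ {0}` as a function of `x / ‖x‖`:
`α = arccos (x₈ / r) · (x₁, …, x₇) / ‖(x₁, …, x₇)‖`. On the axis, where the direction
is not determined, the first basis vector is taken as the direction. -/
def sphereToBall (x : E8) : E7 :=
  Real.arccos (x 7 / ‖x‖) •
    (if horiz x = 0 then EuclideanSpace.single 0 1 else (‖horiz x‖)⁻¹ • horiz x)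

/-- The map `g₈ = exp {i αₘ Γₘ}` as a function on `S⁷` (extended by homogeneity). -/
def g8 (Γ : Fin 7 → Mat8) (x : E8) : Mat8 := exp8 Γ (sphereToBall x)

/-- The map `g₇ = exp {-½ αₘ f_{mnk} Γₙ Γₖ}` as a function on `S⁷`
(extended by homogeneity). -/
def g7 (Γ : Fin 7 → Mat8) (x : E8) : Mat8 := exp7 Γ (sphereToBall x)

/-- The composite map `g₈ⁿ g₇ᵐ`. -/
def comp87 (Γ : Fin 7 → Mat8) (n m : ℤ) : E8 → Mat8 := fun x => g8 Γ x ^ n * g7 Γ x ^ m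

/-- The composite map `g₇ᵐ g₈ⁿ`. -/
def comp78 (Γ : Fin 7 → Mat8) (n m : ℤ) : E8 → Mat8 := fun x => g7 Γ x ^ m * g8 Γ x ^ n

/-- `g` is a smooth map `S⁷ → SO(8)`, written as a function on `ℝ⁸ ∖ {0}` of `x / ‖x‖`. -/
structure IsSphereMapToSO8 (g : E8 → Mat8) : Prop where
  homogeneous : ∀ (c : ℝ) (x : E8), 0 < c → g (c • x) = g x
  smooth : ∀ a b, ContDiffOn ℝ ∞ (fun x => g x a b) {0}ᶜ
  mem_SO : ∀ x, x ≠ 0 → ∃ R ∈ Matrix.specialOrthogonalGroup (Fin 8) ℝ,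
    g x = R.map (fun t : ℝ => (t : ℂ))

/-! ### Charges of maps -/

/-- The partial derivative `∂_M g` of a matrix-valued function. -/
def pd (M : Fin 8) (g : E8 → Mat8) (x : E8) : Mat8 :=
  Matrix.of fun a b => fderiv ℝ (fun y => g y a b) x (EuclideanSpace.single M 1)

/-- The components `g⁻¹ ∂_M g` of the form `g⁻¹ dg`. -/
def mc (g : E8 → Mat8) (M : Fin 8) (x : E8) : Mat8 := (g x)⁻¹ * pd M g x

/-- The components `A_M = i g⁻¹ ∂_M g` of the pure gauge `A = i g⁻¹ dg`. -/
def pureGauge (g : E8 → Mat8) (M : Fin 8) (x : E8) : Mat8 := Complex.I • mc g M x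

/-- The integral over `S⁷`, oriented as the boundary of the unit ball, of the 7-form
`∑_M w_{M₁ … M₇} dx_{M₁} ∧ … ∧ dx_{M₇}`, that is
`∫ ε_{M₀ M₁ … M₇} x_{M₀} w_{M₁ … M₇} dV` with `ε_{1 2 … 8} = 1`. -/
def sphereIntegral (w : (Fin 7 → Fin 8) → E8 → ℂ) : ℂ :=
  ∫ x : Metric.sphere (0 : E8) 1,
    (∑ σ : Equiv.Perm (Fin 8), ((Equiv.Perm.sign σ : ℤ) : ℂ) * (((x : E8) (σ 0) : ℝ) : ℂ) *
      w (fun i => σ i.succ) x) ∂(volume : Measure E8).toSphere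

/-- `q = - 1 / (2⁷ · 3 · 35 π⁴) ∫_{S⁷} Tr {(g⁻¹ dg)⁷}`. -/
def chargeQ (g : E8 → Mat8) : ℂ :=
  -(1 / (2 ^ 7 * 3 * 35 * (Real.pi : ℂ) ^ 4)) *
    sphereIntegral fun M x => Matrix.trace
      (mc g (M 0) x * mc g (M 1) x * mc g (M 2) x * mc g (M 3) x *
        mc g (M 4) x * mc g (M 5) x * mc g (M 6) x)

/-- `q̃ = - i / (3 · 2¹¹ · 35 π⁴) ε^{abcdefgh}
∫_{S⁷} A^{ab} ∧ (A ∧ A)^{cd} ∧ (A ∧ A)^{ef} ∧ (A ∧ A)^{gh}` with `A = i g⁻¹ dg`. -/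
def chargeQt (g : E8 → Mat8) : ℂ :=
  -(Complex.I / (3 * 2 ^ 11 * 35 * (Real.pi : ℂ) ^ 4)) *
    ∑ τ : Equiv.Perm (Fin 8), ((Equiv.Perm.sign τ : ℤ) : ℂ) *
      sphereIntegral fun M x =>
        pureGauge g (M 0) x (τ 0) (τ 1) *
        (pureGauge g (M 1) x * pureGauge g (M 2) x) (τ 2) (τ 3) *
        (pureGauge g (M 3) x * pureGauge g (M 4) x) (τ 4) (τ 5) *
        (pureGauge g (M 5) x * pureGauge g (M 6) x) (τ 6) (τ 7)

/-! ### Charges of gauge fields -/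

/-- `F_{MN} = ∂_M A_N - ∂_N A_M - i [A_M, A_N]`. -/
def fieldStrength (A : Fin 8 → E8 → Mat8) (M N : Fin 8) (x : E8) : Mat8 :=
  pd M (A N) x - pd N (A M) x - Complex.I • (A M x * A N x - A N x * A M x)

/-- The density of `Tr {F ∧ F ∧ F ∧ F}`, where `F = ½ F_{MN} dx_M ∧ dx_N`. -/
def densityQ (A : Fin 8 → E8 → Mat8) (x : E8) : ℂ :=
  (1 / 16) * ∑ σ : Equiv.Perm (Fin 8), ((Equiv.Perm.sign σ : ℤ) : ℂ) *
    Matrix.trace (fieldStrength A (σ 0) (σ 1) x * fieldStrength A (σ 2) (σ 3) x *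
      fieldStrength A (σ 4) (σ 5) x * fieldStrength A (σ 6) (σ 7) x)

/-- The density of `ε^{abcdefgh} F^{ab} ∧ F^{cd} ∧ F^{ef} ∧ F^{gh}`. -/
def densityQt (A : Fin 8 → E8 → Mat8) (x : E8) : ℂ :=
  (1 / 16) * ∑ τ : Equiv.Perm (Fin 8), ∑ σ : Equiv.Perm (Fin 8),
    ((Equiv.Perm.sign τ : ℤ) : ℂ) * ((Equiv.Perm.sign σ : ℤ) : ℂ) *
    (fieldStrength A (σ 0) (σ 1) x (τ 0) (τ 1) * fieldStrength A (σ 2) (σ 3) x (τ 2) (τ 3) *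
      fieldStrength A (σ 4) (σ 5) x (τ 4) (τ 5) * fieldStrength A (σ 6) (σ 7) x (τ 6) (τ 7))

/-- `q = 1 / (384 π⁴) ∫_{ℝ⁸} Tr {F ∧ F ∧ F ∧ F}`. -/
def fieldQ (A : Fin 8 → E8 → Mat8) : ℂ :=
  1 / (384 * (Real.pi : ℂ) ^ 4) * ∫ x : E8, densityQ A x

/-- `q̃ = 1 / (3 · 2¹¹ π⁴) ε^{abcdefgh} ∫_{ℝ⁸} F^{ab} ∧ F^{cd} ∧ F^{ef} ∧ F^{gh}`. -/
def fieldQt (A : Fin 8 → E8 → Mat8) : ℂ :=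
  1 / (3 * 2 ^ 11 * (Real.pi : ℂ) ^ 4) * ∫ x : E8, densityQt A x

/-- `A` is a smooth `so(8)` gauge field on `ℝ⁸` (so its components are purely imaginary
antisymmetric matrices) which approaches the pure gauge `i g⁻¹ dg` at infinity, with a field
strength that decays so fast that the charge integrals converge. -/
structure IsAssociatedField (A : Fin 8 → E8 → Mat8) (g : E8 → Mat8) : Prop where
  smooth : ∀ M a b, ContDiff ℝ ∞ (fun x => A M x a b)
  imaginary : ∀ M x a b, (A M x a b).re = 0
  antisymm : ∀ M x, (A M x).transpose = -A M x
  asymptotic : ∀ M a b, Tendsto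
    (fun x : E8 => (‖x‖ : ℂ) * (A M x a b - pureGauge g M x a b))
    (Bornology.cobounded E8) (𝓝 0)
  decay : ∀ M N a b, Tendsto
    (fun x : E8 => (‖x‖ : ℂ) ^ 2 * fieldStrength A M N x a b)
    (Bornology.cobounded E8) (𝓝 0)
  integrableQ : Integrable (densityQ A)
  integrableQt : Integrable (densityQt A)

end

/-! Both charges are instances of one construction. Let `P` be a symmetric four-linear form on
matrices that is invariant under so(8) and is multiplied by `χ O` under conjugation by an orthogonal
`O` (`InvPoly`). The symmetrized trace has `χ = 1`, the polarized Pfaffian has `χ = det`. Up to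
normalization the charge of a map is `mapCharge P g`, the integral of P(θ ∧ θ² ∧ θ² ∧ θ²) over the
sphere with θ = g⁻¹dg, and the charge of a field is the integral of P(F ∧ F ∧ F ∧ F).

Fields and maps are linked by the Chern–Simons form: P(F⁴) is its exterior derivative
(`InvPoly.transgression`), and for a field asymptotic to i g⁻¹dg with decaying F only its term cubic
in a ∧ a survives in the flux through the sphere at infinity. Hence the charge of the field is -1/35
times the charge of the map (`integral_fieldForm`).

The charge is a homomorphism (`mapCharge_mul`). For given g and h there is a field that interpolates
between 0 and the pure gauge of h in an inner shell, and between the pure gauges of h and of gh in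
an outer shell. By gauge invariance the outer shell contributes the charge of g. Conjugation by a
constant O multiplies the charge by `χ O` (`mapCharge_conj`).

The values then follow from two facts about the standard matrices. First, with C = diag(-1, …, -1,
1), octonion algebra gives g₇ = g₈⁻¹ · C g₈² C (`exp7_gammaStd`), so that g₇ has 2 χ(C) - 1 times
the charge of g₈. This is 1 for the trace and, since det C = -1, it is -3 for the Pfaffian. Second,
g₈ is the restriction to the sphere of the linear map x ↦ x₈ + i xₘ Γₘ, so that its integrand
reduces to a quadratic polynomial in x; second moments of the sphere and the Clifford relations
leave a single value of `P` (`mapCharge_g8`), which is evaluated for the trace and the Pfaffian.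

Finally, every system of gamma matrices is conjugate to the standard one by an orthogonal R
(`IsGammaSystem.exists_rotation`). The sign is s = det R; it depends on Γ alone because the Pfaffian
charge of g₈ is not zero. -/

/-! ### Alternating sums -/

/-- The alternating sum `∑ ε_{M₀ … M₇} w_{M₀ … M₇}`. -/
noncomputable def altSum (w : (Fin 8 → Fin 8) → ℂ) : ℂ :=
  ∑ σ : Equiv.Perm (Fin 8), ((Equiv.Perm.sign σ : ℤ) : ℂ) * w σ

/-- Reindexing by right multiplication with `ρ`. Every exchange of form factors below is this lemma
for an explicit `ρ`: a pair of indices moves past a pair without sign, two single indices with a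
sign. -/
theorem altSum_comp (ρ : Equiv.Perm (Fin 8)) (w : (Fin 8 → Fin 8) → ℂ) :
    altSum (fun m => w (m ∘ ρ)) = ((Equiv.Perm.sign ρ : ℤ) : ℂ) * altSum w := by
  unfold altSum
  rw [Finset.mul_sum, ← Equiv.sum_comp (Equiv.mulRight ρ)
    (fun σ : Equiv.Perm (Fin 8) => ((Equiv.Perm.sign ρ : ℤ) : ℂ) *
      (((Equiv.Perm.sign σ : ℤ) : ℂ) * w σ))]
  refine Finset.sum_congr rfl fun σ _ => ?_
  have h : ((Equiv.Perm.sign ρ : ℤ) : ℂ) * ((Equiv.Perm.sign ρ : ℤ) : ℂ) = 1 := by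
    rw [← Int.cast_mul, ← Units.val_mul, Int.units_mul_self]; simp
  simp only [Equiv.coe_mulRight, Equiv.Perm.sign_mul, Units.val_mul, Int.cast_mul,
    Equiv.Perm.coe_mul]
  linear_combination (-((Equiv.Perm.sign σ : ℤ) : ℂ) * w (σ ∘ ρ)) * h

theorem altSum_add (v w : (Fin 8 → Fin 8) → ℂ) :
    altSum (fun m => v m + w m) = altSum v + altSum w := by
  simp only [altSum, mul_add, Finset.sum_add_distrib]

theorem altSum_sub (v w : (Fin 8 → Fin 8) → ℂ) :
    altSum (fun m => v m - w m) = altSum v - altSum w := by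
  simp only [altSum, mul_sub, Finset.sum_sub_distrib]

theorem altSum_neg (w : (Fin 8 → Fin 8) → ℂ) :
    altSum (fun m => -w m) = -altSum w := by
  simp only [altSum, mul_neg, Finset.sum_neg_distrib]

theorem altSum_mul_left (c : ℂ) (w : (Fin 8 → Fin 8) → ℂ) :
    altSum (fun m => c * w m) = c * altSum w := by
  simp only [altSum, Finset.mul_sum, mul_left_comm]

theorem altSum_congr {v w : (Fin 8 → Fin 8) → ℂ}
    (h : ∀ σ : Equiv.Perm (Fin 8), v σ = w σ) : altSum v = altSum w := by
  simp only [altSum, h]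

/-- If `w` is invariant under an odd permutation of its arguments, its alternating sum is `0`. -/
theorem altSum_eq_zero (ρ : Equiv.Perm (Fin 8)) (hρ : Equiv.Perm.sign ρ = -1)
    {w : (Fin 8 → Fin 8) → ℂ} (h : ∀ m, w (m ∘ ρ) = w m) : altSum w = 0 := by
  have := altSum_comp ρ w
  simp only [h, hρ] at this
  push_cast at this
  linear_combination this / 2

/-- Change of basis in an alternating sum. -/
theorem altSum_sum_prod (M : Mat8) (T : (Fin 8 → Fin 8) → ℂ) :
    altSum (fun m => ∑ j : Fin 8 → Fin 8, (∏ i, M (m i) (j i)) * T j) = M.det * altSum T := by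
  have key : ∀ j : Fin 8 → Fin 8,
      ∑ σ : Equiv.Perm (Fin 8), ((Equiv.Perm.sign σ : ℤ) : ℂ) * ∏ i, M (σ i) (j i) =
        (M.submatrix id j).det := by
    intro j; rw [Matrix.det_apply']; rfl
  unfold altSum
  simp only [Finset.mul_sum]
  rw [Finset.sum_comm]
  have : ∀ j : Fin 8 → Fin 8, ∑ σ : Equiv.Perm (Fin 8),
      ((Equiv.Perm.sign σ : ℤ) : ℂ) * ((∏ i, M (σ i) (j i)) * T j) =
        (M.submatrix id j).det * T j := by
    intro j; rw [← key, Finset.sum_mul]; simp only [mul_assoc]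
  simp only [this]
  symm
  -- Only injective index tuples survive: a repeated index gives the determinant two equal columns,
  -- while a permutation `σ` of the columns gives `sign σ * det M`.
  refine Finset.sum_of_injOn (fun σ : Equiv.Perm (Fin 8) => (σ : Fin 8 → Fin 8))
    (fun a _ b _ h => Equiv.coe_fn_injective h) (by simp) ?_ ?_
  · intro j _ hj
    have hni : ¬ Function.Injective j := by
      intro hinj
      exact hj ⟨Equiv.ofBijective j (Finite.injective_iff_bijective.mp hinj), by simp, by ext; simp⟩
    rw [Function.Injective] at hni
    push Not at hni
    obtain ⟨a, b, hab, hne⟩ := hni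
    rw [Matrix.det_zero_of_column_eq hne (by intro i; simp [hab]), zero_mul]
  · intro σ _
    rw [Matrix.det_permute']
    ring

/-! ### Invariant polynomials of degree four -/

/-- A symmetric four-linear form on `8 × 8` matrices, invariant under the adjoint action of
antisymmetric matrices, and invariant up to a factor `χ O` under conjugation by orthogonal `O`. -/
structure InvPoly where
  toFun : Mat8 → Mat8 → Mat8 → Mat8 → ℂ
  χ : Mat8 → ℂ
  add' : ∀ X X' Y Z W, toFun (X + X') Y Z W = toFun X Y Z W + toFun X' Y Z W
  smul' : ∀ (c : ℂ) X Y Z W, toFun (c • X) Y Z W = c * toFun X Y Z W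
  swap01 : ∀ X Y Z W, toFun X Y Z W = toFun Y X Z W
  swap12 : ∀ X Y Z W, toFun X Y Z W = toFun X Z Y W
  swap23 : ∀ X Y Z W, toFun X Y Z W = toFun X Y W Z
  cont : Continuous fun p : Mat8 × Mat8 × Mat8 × Mat8 => toFun p.1 p.2.1 p.2.2.1 p.2.2.2
  -- Only `A` is antisymmetric here; the identity will be applied to arguments such as `a M * a N`,
  -- which are not.
  lie : ∀ A X Y Z W, A.transpose = -A →
    toFun (A * X - X * A) Y Z W + toFun X (A * Y - Y * A) Z W + toFun X Y (A * Z - Z * A) W +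
      toFun X Y Z (A * W - W * A) = 0
  conj' : ∀ O X Y Z W, O * O.transpose = 1 →
    toFun (O * X * O.transpose) (O * Y * O.transpose) (O * Z * O.transpose)
      (O * W * O.transpose) = χ O * toFun X Y Z W
  χ_one : ∀ O : Mat8, O.det = 1 → χ O = 1

namespace InvPoly

instance : CoeFun InvPoly fun _ => Mat8 → Mat8 → Mat8 → Mat8 → ℂ := ⟨toFun⟩

variable (P : InvPoly)

theorem add0 (X X' Y Z W) : P (X + X') Y Z W = P X Y Z W + P X' Y Z W := P.add' ..
theorem add1 (X Y Y' Z W) : P X (Y + Y') Z W = P X Y Z W + P X Y' Z W := by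
  rw [P.swap01, P.add0, P.swap01 Y, P.swap01 Y']
theorem smul0 (c : ℂ) (X Y Z W) : P (c • X) Y Z W = c * P X Y Z W := P.smul' ..
theorem smul1 (c : ℂ) (X Y Z W) : P X (c • Y) Z W = c * P X Y Z W := by
  rw [P.swap01, P.smul0, P.swap01 Y]
theorem smul2 (c : ℂ) (X Y Z W) : P X Y (c • Z) W = c * P X Y Z W := by
  rw [P.swap12, P.smul1, P.swap12 _ Z]
theorem smul3 (c : ℂ) (X Y Z W) : P X Y Z (c • W) = c * P X Y Z W := by
  rw [P.swap23, P.smul2, P.swap23 _ _ W]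
theorem neg0 (X Y Z W) : P (-X) Y Z W = -P X Y Z W := by
  simpa using P.smul0 (-1) X Y Z W
theorem neg1 (X Y Z W) : P X (-Y) Z W = -P X Y Z W := by
  simpa using P.smul1 (-1) X Y Z W
theorem sub0 (X X' Y Z W) : P (X - X') Y Z W = P X Y Z W - P X' Y Z W := by
  rw [sub_eq_add_neg, P.add0, P.neg0, sub_eq_add_neg]
theorem sub1 (X Y Y' Z W) : P X (Y - Y') Z W = P X Y Z W - P X Y' Z W := by
  rw [sub_eq_add_neg, P.add1, P.neg1, sub_eq_add_neg]
theorem zero0 (Y Z W) : P 0 Y Z W = 0 := by simpa using P.smul0 0 0 Y Z W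

end InvPoly

/-- The symmetrized trace `Tr (X Y Z W)`. -/
noncomputable def tracePoly : InvPoly where
  toFun X Y Z W := (1 / 6) * ((X * Y * Z * W).trace + (X * Y * W * Z).trace +
    (X * Z * Y * W).trace + (X * Z * W * Y).trace + (X * W * Y * Z).trace + (X * W * Z * Y).trace)
  χ _ := 1
  add' X X' Y Z W := by simp only [add_mul, Matrix.trace_add]; ring
  smul' c X Y Z W := by simp only [smul_mul_assoc, Matrix.trace_smul, smul_eq_mul]; ring
  swap01 X Y Z W := by
    have h : ∀ A B C D : Mat8, (A * B * C * D).trace = (B * C * D * A).trace := fun A B C D => by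
      rw [mul_assoc, mul_assoc, Matrix.trace_mul_comm, ← mul_assoc]
    linear_combination (1 / 6) * (h X Y Z W + h X Y W Z + h X Z Y W + h Z Y W X - h Y X Z W +
      h X W Y Z + h W Y Z X - h Y X W Z)
  swap12 X Y Z W := by ring
  swap23 X Y Z W := by ring
  cont := by fun_prop
  lie A X Y Z W _ := by
    -- The four commutators telescope to the commutator of `A` with the whole product, which is
    -- traceless.
    have h : ∀ B C D E : Mat8, ((A * B - B * A) * C * D * E).trace +
        (B * (A * C - C * A) * D * E).trace + (B * C * (A * D - D * A) * E).trace +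
        (B * C * D * (A * E - E * A)).trace = 0 := fun B C D E => by
      have : (A * B - B * A) * C * D * E + B * (A * C - C * A) * D * E +
        B * C * (A * D - D * A) * E + B * C * D * (A * E - E * A) =
          A * (B * C * D * E) - B * C * D * E * A := by noncomm_ring
      rw [← Matrix.trace_add, ← Matrix.trace_add, ← Matrix.trace_add, this, Matrix.trace_sub,
        Matrix.trace_mul_comm, sub_self]
    linear_combination (1 / 6) * (h X Y Z W + h X Y W Z + h X Z Y W + h X Z W Y + h X W Y Z +
      h X W Z Y)
  conj' O X Y Z W hO := by
    have hO' : O.transpose * O = 1 := mul_eq_one_comm.mp hO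
    have h : ∀ B C D E : Mat8, (O * B * O.transpose * (O * C * O.transpose) *
        (O * D * O.transpose) * (O * E * O.transpose)).trace = (B * C * D * E).trace :=
      fun B C D E => by
      have h2 : ∀ U V : Mat8, O * U * O.transpose * (O * V * O.transpose) =
          O * (U * V) * O.transpose := fun U V => by
        calc _ = O * U * (O.transpose * O) * V * O.transpose := by noncomm_ring
          _ = _ := by rw [hO']; noncomm_ring
      rw [h2, h2, h2, Matrix.trace_mul_comm, ← mul_assoc, hO', one_mul]
    simp only [h, one_mul]
  χ_one _ _ := rfl

/-- The polarized Pfaffian `ε^{abcdefgh} X^{ab} Y^{cd} Z^{ef} W^{gh}`. -/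
noncomputable def pfPoly (X Y Z W : Mat8) : ℂ :=
  altSum fun t => X (t 0) (t 1) * Y (t 2) (t 3) * Z (t 4) (t 5) * W (t 6) (t 7)

/-- Every entry of a conjugated matrix carries two entries of `M`, so the eight indices of ε are
contracted with eight copies of `M`, which is `det M` times ε. `M` need not be orthogonal; this
freedom is used in `pfPoly_lie`. -/
theorem pfPoly_conj (M X Y Z W : Mat8) :
    pfPoly (M * X * M.transpose) (M * Y * M.transpose) (M * Z * M.transpose)
      (M * W * M.transpose) = M.det * pfPoly X Y Z W := by
  have h : ∀ (X : Mat8) a b, (M * X * M.transpose) a b =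
      ∑ c, ∑ d, M a c * M b d * X c d := fun X a b => by
    simp only [Matrix.mul_apply, Matrix.transpose_apply, Finset.sum_mul]
    rw [Finset.sum_comm]
    refine Finset.sum_congr rfl fun c _ => Finset.sum_congr rfl fun d _ => by ring
  unfold pfPoly
  rw [← altSum_sum_prod]
  refine altSum_congr fun σ => ?_
  have e : ∀ f : (Fin 8 → Fin 8) → ℂ, ∑ j, f j =
      ∑ a, ∑ b, ∑ c, ∑ d, ∑ e, ∑ g, ∑ h, ∑ k, f ![a, b, c, d, e, g, h, k] := by
    intro f
    have : ∀ (n : ℕ) (f : (Fin (n + 1) → Fin 8) → ℂ),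
        ∑ j, f j = ∑ a, ∑ j : Fin n → Fin 8, f (Matrix.vecCons a j) := fun n f => by
      rw [← Equiv.sum_comp (Fin.consEquiv fun _ => Fin 8), Fintype.sum_prod_type]
      rfl
    simp only [this, Finset.univ_unique, Finset.sum_singleton]
    rfl
  have e4 : ∀ F₁ F₂ F₃ F₄ : Fin 8 → Fin 8 → ℂ,
      ∑ a, ∑ b, ∑ c, ∑ d, ∑ e, ∑ g, ∑ h, ∑ k, F₁ a b * F₂ c d * F₃ e g * F₄ h k =
      (∑ a, ∑ b, F₁ a b) * (∑ a, ∑ b, F₂ a b) * (∑ a, ∑ b, F₃ a b) * ∑ a, ∑ b, F₄ a b := by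
    intro F₁ F₂ F₃ F₄
    simp only [← Finset.mul_sum, ← Finset.sum_mul]
  rw [e]
  simp only [h, ← e4]
  simp only [Fin.prod_univ_eight]
  refine Finset.sum_congr rfl fun a _ => Finset.sum_congr rfl fun b _ =>
    Finset.sum_congr rfl fun c _ => Finset.sum_congr rfl fun d _ =>
    Finset.sum_congr rfl fun e _ => Finset.sum_congr rfl fun g _ =>
    Finset.sum_congr rfl fun h _ => Finset.sum_congr rfl fun k _ => ?_
  change _ = M (σ 0) a * M (σ 1) b * M (σ 2) c * M (σ 3) d * M (σ 4) e * M (σ 5) g * M (σ 6) h *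
    M (σ 7) k * (X a b * Y c d * Z e g * W h k)
  ring

/-- This is the derivative of `pfPoly_conj` at t = 0 along M = 1 + tA. For antisymmetric A the
conjugate of B is B + t[A, B] - t² ABA, and the derivative of det (1 + tA) is tr A = 0. -/
theorem pfPoly_lie (A X Y Z W : Mat8) (hA : A.transpose = -A) :
    pfPoly (A * X - X * A) Y Z W + pfPoly X (A * Y - Y * A) Z W + pfPoly X Y (A * Z - Z * A) W +
      pfPoly X Y Z (A * W - W * A) = 0 := by
  have hd : ∀ (B : Mat8) (a b : Fin 8), HasDerivAt
      (fun t : ℂ => ((1 + t • A) * B * (1 + t • A).transpose) a b) ((A * B - B * A) a b) 0 := by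
    intro B a b
    have : ∀ t : ℂ, ((1 + t • A) * B * (1 + t • A).transpose) a b =
        B a b + t * (A * B - B * A) a b + t ^ 2 * (-(A * B * A)) a b := by
      intro t
      have : (1 + t • A) * B * (1 + t • A).transpose =
          B + t • (A * B - B * A) + t ^ 2 • (-(A * B * A)) := by
        rw [Matrix.transpose_add, Matrix.transpose_smul, hA, Matrix.transpose_one]
        simp only [add_mul, mul_add, one_mul, mul_one, smul_mul_assoc, mul_smul_comm, mul_neg,
          smul_neg, smul_sub, sq, mul_assoc]
        module
      rw [this]; simp
    simp only [this]
    have h1 := (((hasDerivAt_id (0 : ℂ)).mul_const ((A * B - B * A) a b)).const_add (B a b)).add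
      ((hasDerivAt_pow 2 (0 : ℂ)).mul_const ((-(A * B * A)) a b))
    refine h1.congr_deriv ?_
    simp
  have h1 : HasDerivAt (fun t : ℂ => pfPoly ((1 + t • A) * X * (1 + t • A).transpose)
      ((1 + t • A) * Y * (1 + t • A).transpose) ((1 + t • A) * Z * (1 + t • A).transpose)
      ((1 + t • A) * W * (1 + t • A).transpose))
      (pfPoly (A * X - X * A) Y Z W + pfPoly X (A * Y - Y * A) Z W +
      pfPoly X Y (A * Z - Z * A) W + pfPoly X Y Z (A * W - W * A)) 0 := by
    unfold pfPoly
    simp only [← altSum_add]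
    unfold altSum
    refine HasDerivAt.fun_sum fun σ _ => HasDerivAt.const_mul _ ?_
    refine ((((hd X _ _).mul (hd Y _ _)).mul (hd Z _ _)).mul (hd W _ _)).congr_deriv ?_
    simp
    ring
  simp only [pfPoly_conj] at h1
  have h2 : HasDerivAt (fun t : ℂ => (1 + t • A).det * pfPoly X Y Z W) 0 0 := by
    have ht : A.trace = 0 := by
      have := Matrix.trace_transpose A
      rw [hA, Matrix.trace_neg] at this
      linear_combination -this / 2
    obtain ⟨p, hp⟩ : ∃ p : Polynomial ℂ, ∀ t : ℂ,
        (1 + t • A).det = 1 + 0 * t + p.eval t * t ^ 2 :=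
      ⟨_, fun t => by rw [Matrix.det_one_add_smul, ht]⟩
    simp only [hp]
    have h3 := (((p.hasDerivAt (0 : ℂ)).mul (hasDerivAt_pow 2 (0 : ℂ))).const_add
      (1 : ℂ)).mul_const (pfPoly X Y Z W)
    refine (h3.congr_of_eventuallyEq (Filter.Eventually.of_forall fun t => ?_)).congr_deriv ?_
    · simp
    · simp
  exact h1.unique h2

/-- The polarized Pfaffian as an invariant polynomial. -/
noncomputable def pfInvPoly : InvPoly where
  toFun := pfPoly
  χ := Matrix.det
  add' X X' Y Z W := by
    simp only [pfPoly, ← altSum_add, Matrix.add_apply, add_mul]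
  smul' c X Y Z W := by
    simp only [pfPoly, ← altSum_mul_left, Matrix.smul_apply, smul_eq_mul, mul_assoc]
  swap01 X Y Z W := by
    have := altSum_comp (Equiv.swap 0 2 * Equiv.swap 1 3) fun t =>
      Y (t 0) (t 1) * X (t 2) (t 3) * Z (t 4) (t 5) * W (t 6) (t 7)
    rw [show Equiv.Perm.sign (Equiv.swap (0 : Fin 8) 2 * Equiv.swap 1 3) = 1 by decide] at this
    simp only [Units.val_one, Int.cast_one, one_mul] at this
    rw [pfPoly, pfPoly, ← this]
    refine altSum_congr fun σ => ?_
    change _ = Y (σ 2) (σ 3) * X (σ 0) (σ 1) * Z (σ 4) (σ 5) * W (σ 6) (σ 7)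
    ring
  swap12 X Y Z W := by
    have := altSum_comp (Equiv.swap 2 4 * Equiv.swap 3 5) fun t =>
      X (t 0) (t 1) * Z (t 2) (t 3) * Y (t 4) (t 5) * W (t 6) (t 7)
    rw [show Equiv.Perm.sign (Equiv.swap (2 : Fin 8) 4 * Equiv.swap 3 5) = 1 by decide] at this
    simp only [Units.val_one, Int.cast_one, one_mul] at this
    rw [pfPoly, pfPoly, ← this]
    refine altSum_congr fun σ => ?_
    change _ = X (σ 0) (σ 1) * Z (σ 4) (σ 5) * Y (σ 2) (σ 3) * W (σ 6) (σ 7)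
    ring
  swap23 X Y Z W := by
    have := altSum_comp (Equiv.swap 4 6 * Equiv.swap 5 7) fun t =>
      X (t 0) (t 1) * Y (t 2) (t 3) * W (t 4) (t 5) * Z (t 6) (t 7)
    rw [show Equiv.Perm.sign (Equiv.swap (4 : Fin 8) 6 * Equiv.swap 5 7) = 1 by decide] at this
    simp only [Units.val_one, Int.cast_one, one_mul] at this
    rw [pfPoly, pfPoly, ← this]
    refine altSum_congr fun σ => ?_
    change _ = X (σ 0) (σ 1) * Y (σ 2) (σ 3) * W (σ 6) (σ 7) * Z (σ 4) (σ 5)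
    ring
  cont := by unfold pfPoly altSum; fun_prop
  lie := pfPoly_lie
  conj' O X Y Z W _ := pfPoly_conj O X Y Z W
  χ_one _ h := h


/-! ### The transgression identity for the Chern–Simons form at a point -/

namespace InvPoly

variable (P : InvPoly)

/-- `P (X ∧ Y ∧ Z ∧ W)` for matrix-valued two-tensors. -/
noncomputable def wedge (X Y Z W : Fin 8 → Fin 8 → Mat8) : ℂ :=
  altSum fun m => P (X (m 0) (m 1)) (Y (m 2) (m 3)) (Z (m 4) (m 5)) (W (m 6) (m 7))

theorem wedge_swap01 (X Y Z W) : P.wedge X Y Z W = P.wedge Y X Z W := by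
  have := altSum_comp (Equiv.swap 0 2 * Equiv.swap 1 3) fun m =>
    P (Y (m 0) (m 1)) (X (m 2) (m 3)) (Z (m 4) (m 5)) (W (m 6) (m 7))
  rw [show Equiv.Perm.sign (Equiv.swap (0 : Fin 8) 2 * Equiv.swap 1 3) = 1 by decide] at this
  simp only [Units.val_one, Int.cast_one, one_mul] at this
  rw [wedge, wedge, ← this]
  exact altSum_congr fun σ => P.swap01 ..

theorem wedge_swap12 (X Y Z W) : P.wedge X Y Z W = P.wedge X Z Y W := by
  have := altSum_comp (Equiv.swap 2 4 * Equiv.swap 3 5) fun m =>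
    P (X (m 0) (m 1)) (Z (m 2) (m 3)) (Y (m 4) (m 5)) (W (m 6) (m 7))
  rw [show Equiv.Perm.sign (Equiv.swap (2 : Fin 8) 4 * Equiv.swap 3 5) = 1 by decide] at this
  simp only [Units.val_one, Int.cast_one, one_mul] at this
  rw [wedge, wedge, ← this]
  exact altSum_congr fun σ => P.swap12 ..

theorem wedge_swap23 (X Y Z W) : P.wedge X Y Z W = P.wedge X Y W Z := by
  have := altSum_comp (Equiv.swap 4 6 * Equiv.swap 5 7) fun m =>
    P (X (m 0) (m 1)) (Y (m 2) (m 3)) (W (m 4) (m 5)) (Z (m 6) (m 7))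
  rw [show Equiv.Perm.sign (Equiv.swap (4 : Fin 8) 6 * Equiv.swap 5 7) = 1 by decide] at this
  simp only [Units.val_one, Int.cast_one, one_mul] at this
  rw [wedge, wedge, ← this]
  exact altSum_congr fun σ => P.swap23 ..

/-- Only the antisymmetric part of a two-tensor matters. -/
theorem wedge_flip (X Y Z W) : P.wedge (fun M N => X N M) Y Z W = -P.wedge X Y Z W := by
  have := altSum_comp (Equiv.swap 0 1) fun m =>
    P (X (m 0) (m 1)) (Y (m 2) (m 3)) (Z (m 4) (m 5)) (W (m 6) (m 7))
  rw [show Equiv.Perm.sign (Equiv.swap (0 : Fin 8) 1) = -1 by decide] at this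
  simp only [Units.val_one, Int.cast_one, one_mul, Units.val_neg, Int.cast_neg, neg_mul] at this
  exact this

theorem wedge_add (X X' Y Z W) : P.wedge (fun M N => X M N + X' M N) Y Z W =
    P.wedge X Y Z W + P.wedge X' Y Z W := by
  simp only [wedge, P.add0, altSum_add]

theorem wedge_smul (c : ℂ) (X Y Z W) : P.wedge (fun M N => c • X M N) Y Z W =
    c * P.wedge X Y Z W := by
  simp only [wedge, P.smul0, altSum_mul_left]

/-- `P (a ∧ T ∧ Y ∧ Z)` for a three-tensor `T`, with the first index of `T` in front. -/
noncomputable def wedge3 (a : Fin 8 → Mat8) (T : Fin 8 → Fin 8 → Fin 8 → Mat8)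
    (Y Z : Fin 8 → Fin 8 → Mat8) : ℂ :=
  altSum fun m => P (a (m 1)) (T (m 0) (m 2) (m 3)) (Y (m 4) (m 5)) (Z (m 6) (m 7))

theorem wedge3_add (a) (T T' : Fin 8 → Fin 8 → Fin 8 → Mat8) (Y Z) :
    P.wedge3 a (fun K M N => T K M N + T' K M N) Y Z = P.wedge3 a T Y Z + P.wedge3 a T' Y Z := by
  simp only [wedge3, P.add1, altSum_add]

theorem wedge3_smul (a) (c : ℂ) (T : Fin 8 → Fin 8 → Fin 8 → Mat8) (Y Z) :
    P.wedge3 a (fun K M N => c • T K M N) Y Z = c * P.wedge3 a T Y Z := by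
  simp only [wedge3, P.smul1, altSum_mul_left]

theorem wedge3_swap_right (a) (T : Fin 8 → Fin 8 → Fin 8 → Mat8) (Y Z) :
    P.wedge3 a T Y Z = P.wedge3 a T Z Y := by
  have := altSum_comp (Equiv.swap 4 6 * Equiv.swap 5 7) fun m =>
    P (a (m 1)) (T (m 0) (m 2) (m 3)) (Z (m 4) (m 5)) (Y (m 6) (m 7))
  rw [show Equiv.Perm.sign (Equiv.swap (4 : Fin 8) 6 * Equiv.swap 5 7) = 1 by decide] at this
  simp only [Units.val_one, Int.cast_one, one_mul] at this
  rw [wedge3, wedge3, ← this]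
  exact altSum_congr fun σ => P.swap23 ..

/-- Transposing the last two indices of the three-tensor. -/
theorem wedge3_flip (a) (T : Fin 8 → Fin 8 → Fin 8 → Mat8) (Y Z) :
    P.wedge3 a (fun K M N => T K N M) Y Z = -P.wedge3 a T Y Z := by
  have := altSum_comp (Equiv.swap 2 3) fun m =>
    P (a (m 1)) (T (m 0) (m 2) (m 3)) (Y (m 4) (m 5)) (Z (m 6) (m 7))
  rw [show Equiv.Perm.sign (Equiv.swap (2 : Fin 8) 3) = -1 by decide] at this
  simp only [Units.val_one, Int.cast_one, one_mul, Units.val_neg, Int.cast_neg, neg_mul] at this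
  exact this

/-- Transposing the first two indices of the three-tensor. -/
theorem wedge3_flip' (a) (T : Fin 8 → Fin 8 → Fin 8 → Mat8) (Y Z) :
    P.wedge3 a (fun K M N => T M K N) Y Z = -P.wedge3 a T Y Z := by
  have := altSum_comp (Equiv.swap 0 2) fun m =>
    P (a (m 1)) (T (m 0) (m 2) (m 3)) (Y (m 4) (m 5)) (Z (m 6) (m 7))
  rw [show Equiv.Perm.sign (Equiv.swap (0 : Fin 8) 2) = -1 by decide] at this
  simp only [Units.val_one, Int.cast_one, one_mul, Units.val_neg, Int.cast_neg, neg_mul] at this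
  exact this

/-- The three-tensor `[a, X]`. -/
def brk (a : Fin 8 → Mat8) (X : Fin 8 → Fin 8 → Mat8) (K M N : Fin 8) : Mat8 :=
  a K * X M N - X M N * a K

/-- The two-tensor `a ∧ a`. -/
def sqr (a : Fin 8 → Mat8) (M N : Fin 8) : Mat8 := a M * a N

/-- Two-forms commute, and moving a pair of indices past another pair is an even permutation; hence
the three-tensor can be brought to the second argument from any later one. -/
theorem wedge3_second (a) (T : Fin 8 → Fin 8 → Fin 8 → Mat8) (Y Z) :
    altSum (fun m => P (a (m 1)) (Y (m 2) (m 3)) (T (m 0) (m 4) (m 5)) (Z (m 6) (m 7))) =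
      P.wedge3 a T Y Z := by
  have := altSum_comp (Equiv.swap 2 4 * Equiv.swap 3 5) fun m =>
    P (a (m 1)) (T (m 0) (m 2) (m 3)) (Y (m 4) (m 5)) (Z (m 6) (m 7))
  rw [show Equiv.Perm.sign (Equiv.swap (2 : Fin 8) 4 * Equiv.swap 3 5) = 1 by decide] at this
  simp only [Units.val_one, Int.cast_one, one_mul] at this
  rw [wedge3, ← this]
  exact altSum_congr fun σ => P.swap12 ..

theorem wedge3_third (a) (T : Fin 8 → Fin 8 → Fin 8 → Mat8) (Y Z) :
    altSum (fun m => P (a (m 1)) (Y (m 2) (m 3)) (Z (m 4) (m 5)) (T (m 0) (m 6) (m 7))) =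
      P.wedge3 a T Y Z := by
  rw [wedge3_swap_right]
  have := altSum_comp (Equiv.swap 4 6 * Equiv.swap 5 7) fun m =>
    P (a (m 1)) (Y (m 2) (m 3)) (T (m 0) (m 4) (m 5)) (Z (m 6) (m 7))
  rw [show Equiv.Perm.sign (Equiv.swap (4 : Fin 8) 6 * Equiv.swap 5 7) = 1 by decide] at this
  simp only [Units.val_one, Int.cast_one, one_mul] at this
  rw [← wedge3_swap_right, ← wedge3_second, ← this]
  exact altSum_congr fun σ => P.swap23 ..

/-- Invariance of `P` in terms of forms. -/
theorem wedge3_brk (a : Fin 8 → Mat8) (ha : ∀ M, (a M).transpose = -a M)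
    (X Y Z : Fin 8 → Fin 8 → Mat8) :
    P.wedge3 a (brk a X) Y Z + P.wedge3 a (brk a Y) X Z + P.wedge3 a (brk a Z) X Y =
      -2 * P.wedge (sqr a) X Y Z := by
  -- The term of `lie` in which the commutator acts on `a` itself: the antisymmetrized [a, a] is
  -- twice `a ∧ a`.
  have h : altSum (fun m => P (a (m 0) * a (m 1) - a (m 1) * a (m 0)) (X (m 2) (m 3))
      (Y (m 4) (m 5)) (Z (m 6) (m 7))) = 2 * P.wedge (sqr a) X Y Z := by
    simp only [P.sub0, altSum_sub]
    have h1 := P.wedge_flip (sqr a) X Y Z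
    simp only [wedge, sqr] at h1 ⊢
    rw [h1]; ring
  rw [← P.wedge3_second a (brk a Y) X Z, ← P.wedge3_third a (brk a Z) X Y, neg_mul, ← h, wedge3,
    ← altSum_add, ← altSum_add, ← altSum_neg]
  refine altSum_congr fun σ => ?_
  have := P.lie (a (σ 0)) (a (σ 1)) (X (σ 2) (σ 3)) (Y (σ 4) (σ 5)) (Z (σ 6) (σ 7)) (ha _)
  simp only [brk]
  linear_combination this

/-- Rotating the indices of the three-tensor. -/
theorem wedge3_rotate (a) (T : Fin 8 → Fin 8 → Fin 8 → Mat8) (Y Z) :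
    P.wedge3 a (fun K M N => T M N K) Y Z = P.wedge3 a T Y Z := by
  have h1 := P.wedge3_flip' a (fun K M N => T K N M) Y Z
  rw [h1, wedge3_flip, neg_neg]

/-- As forms, a commutes with a ∧ a: the two terms of the bracket differ by a cyclic rotation of
three indices, which is even. -/
theorem wedge3_brk_sqr (a : Fin 8 → Mat8) (Y Z) : P.wedge3 a (brk a (sqr a)) Y Z = 0 := by
  have h1 := P.wedge3_rotate a (fun K M N => a K * a M * a N) Y Z
  have h2 := P.wedge3_add a (brk a (sqr a)) (fun K M N => a M * a N * a K) Y Z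
  have h3 : (fun K M N => brk a (sqr a) K M N + a M * a N * a K) =
      fun K M N => a K * a M * a N := by
    funext K M N; simp only [brk, sqr]; noncomm_ring
  rw [h3, h1] at h2
  linear_combination -h2

/-- The Chern–Simons form of `a` with field strength `X` (`F = ½ F_{MN} dx_M dx_N` given by
`X_{MN} = ½ F_{MN}`). -/
noncomputable def cs (a : Fin 8 → Mat8) (X : Fin 8 → Fin 8 → Mat8) (m : Fin 7 → Fin 8) : ℂ :=
  -- The coefficients come from 4 ∫₀¹ P(a, F_t, F_t, F_t) dt along the path ta, where F_t = tF + (t²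
  -- - t) a ∧ a.
  P (a (m 0)) (X (m 1) (m 2)) (X (m 3) (m 4)) (X (m 5) (m 6)) -
  3 / 5 * P (a (m 0)) (X (m 1) (m 2)) (X (m 3) (m 4)) (sqr a (m 5) (m 6)) +
  1 / 5 * P (a (m 0)) (X (m 1) (m 2)) (sqr a (m 3) (m 4)) (sqr a (m 5) (m 6)) -
  1 / 35 * P (a (m 0)) (sqr a (m 1) (m 2)) (sqr a (m 3) (m 4)) (sqr a (m 5) (m 6))

/-- The product rule for `∂_K P (a ∧ X ∧ Y ∧ Z)`. -/
noncomputable def dP (a : Fin 8 → Mat8) (d : Fin 8 → Fin 8 → Mat8)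
    (X : Fin 8 → Fin 8 → Mat8) (X' : Fin 8 → Fin 8 → Fin 8 → Mat8)
    (Y : Fin 8 → Fin 8 → Mat8) (Y' : Fin 8 → Fin 8 → Fin 8 → Mat8)
    (Z : Fin 8 → Fin 8 → Mat8) (Z' : Fin 8 → Fin 8 → Fin 8 → Mat8)
    (K : Fin 8) (m : Fin 7 → Fin 8) : ℂ :=
  P (d K (m 0)) (X (m 1) (m 2)) (Y (m 3) (m 4)) (Z (m 5) (m 6)) +
  P (a (m 0)) (X' K (m 1) (m 2)) (Y (m 3) (m 4)) (Z (m 5) (m 6)) +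
  P (a (m 0)) (X (m 1) (m 2)) (Y' K (m 3) (m 4)) (Z (m 5) (m 6)) +
  P (a (m 0)) (X (m 1) (m 2)) (Y (m 3) (m 4)) (Z' K (m 5) (m 6))

theorem altSum_dP (a d X X' Y Y' Z Z') :
    altSum (fun m => P.dP a d X X' Y Y' Z Z' (m 0) (fun i => m i.succ)) =
      P.wedge d X Y Z + P.wedge3 a X' Y Z + P.wedge3 a Y' X Z + P.wedge3 a Z' X Y := by
  rw [← P.wedge3_second a Y' X Z, ← P.wedge3_third a Z' X Y, wedge, wedge3,
    ← altSum_add, ← altSum_add, ← altSum_add]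
  rfl

/-- The derivative of `a ∧ a`. -/
def dsqr (a : Fin 8 → Mat8) (d : Fin 8 → Fin 8 → Mat8) (K M N : Fin 8) : Mat8 :=
  d K M * a N + a M * d K N

/-- The transgression identity: `d CS = P (F ∧ F ∧ F ∧ F)`.  Here `a`, `d`, `e` are the values of
a connection form and of its first and second derivatives at a point. -/
theorem transgression (a : Fin 8 → Mat8) (ha : ∀ M, (a M).transpose = -a M)
    (d : Fin 8 → Fin 8 → Mat8) (e : Fin 8 → Fin 8 → Fin 8 → Mat8)
    (he : ∀ K M N, e K M N = e M K N) (X : Fin 8 → Fin 8 → Mat8)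
    (X' : Fin 8 → Fin 8 → Fin 8 → Mat8)
    (hX : ∀ M N, X M N = (1 / 2 : ℂ) • (d M N - d N M + a M * a N - a N * a M))
    (hX' : ∀ K M N, X' K M N = (1 / 2 : ℂ) • (e K M N - e K N M + dsqr a d K M N -
      dsqr a d K N M)) :
    altSum (fun m => P.dP a d X X' X X' X X' (m 0) (fun i => m i.succ) -
      3 / 5 * P.dP a d X X' X X' (sqr a) (dsqr a d) (m 0) (fun i => m i.succ) +
      1 / 5 * P.dP a d X X' (sqr a) (dsqr a d) (sqr a) (dsqr a d) (m 0) (fun i => m i.succ) -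
      1 / 35 * P.dP a d (sqr a) (dsqr a d) (sqr a) (dsqr a d) (sqr a) (dsqr a d) (m 0)
        (fun i => m i.succ)) =
      P.wedge X X X X := by
  -- The structure equation da = F - a ∧ a; antisymmetrization makes the factor 1/2 in `X`
  -- disappear.
  have hd : ∀ Y Z W, P.wedge d Y Z W = P.wedge X Y Z W - P.wedge (sqr a) Y Z W := by
    intro Y Z W
    have : X = fun M N => (1 / 2 : ℂ) • ((d M N + sqr a M N) + (-1 : ℂ) • (d N M + sqr a N M)) := by
      funext M N; rw [hX]; simp only [sqr]; module
    rw [this, wedge_smul, wedge_add, wedge_smul,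
      P.wedge_flip (fun M N => d M N + sqr a M N), wedge_add]
    ring
  -- [a, da] = [a, F], because [a, a ∧ a] = 0.
  have hdX : ∀ Y Z, P.wedge3 a (brk a d) Y Z = P.wedge3 a (brk a X) Y Z := by
    intro Y Z
    have : brk a X = fun K M N => (1 / 2 : ℂ) • ((brk a d K M N + brk a (sqr a) K M N) +
        (-1 : ℂ) • (brk a d K N M + brk a (sqr a) K N M)) := by
      funext K M N
      simp only [brk, hX, sqr, mul_smul_comm, smul_mul_assoc, mul_sub, mul_add, sub_mul, add_mul]
      module
    rw [this, wedge3_smul, wedge3_add, wedge3_smul,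
      P.wedge3_flip a (fun K M N => brk a d K M N + brk a (sqr a) K M N), wedge3_add,
      wedge3_brk_sqr]
    ring
  -- d(a ∧ a) = da ∧ a - a ∧ da = -[a, F].
  have hs : ∀ Y Z, P.wedge3 a (dsqr a d) Y Z = -P.wedge3 a (brk a X) Y Z := by
    intro Y Z
    rw [← hdX]
    have h1 := P.wedge3_flip' a (fun K M N => a K * d M N) Y Z
    have h2 := P.wedge3_rotate a (fun K M N => d K M * a N) Y Z
    have h3 := P.wedge3_add a (fun K M N => d K M * a N) (fun K M N => a M * d K N) Y Z
    have h4 := P.wedge3_add a (brk a d) (fun K M N => d M N * a K) Y Z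
    have h5 : (fun K M N => brk a d K M N + d M N * a K) = fun K M N => a K * d M N := by
      funext K M N; simp only [brk]; abel
    rw [h5] at h4
    change P.wedge3 a (fun K M N => d K M * a N + a M * d K N) Y Z = _
    linear_combination h3 + h1 - h4 - h2
  -- The Bianchi identity dF = -[a, F]; the second derivatives `e` drop out by their symmetry.
  have hXX : ∀ Y Z, P.wedge3 a X' Y Z = -P.wedge3 a (brk a X) Y Z := by
    intro Y Z
    have h1 : X' = fun K M N => (1 / 2 : ℂ) • ((e K M N + dsqr a d K M N) +
        (-1 : ℂ) • (e K N M + dsqr a d K N M)) := by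
      funext K M N; rw [hX']; module
    have h2 : P.wedge3 a e Y Z = 0 := by
      have := P.wedge3_flip' a e Y Z
      simp only [← he] at this
      linear_combination this / 2
    rw [h1, wedge3_smul, wedge3_add, wedge3_smul,
      P.wedge3_flip a (fun K M N => e K M N + dsqr a d K M N), wedge3_add, h2, hs]
    ring
  rw [altSum_sub, altSum_add, altSum_sub, altSum_mul_left, altSum_mul_left, altSum_mul_left]
  simp only [altSum_dP, hd, hs, hXX]
  -- Everything is now expressed by wedges of `X` and `a ∧ a` and by terms with one bracket [a, X].
  -- Invariance with zero to three factors `a ∧ a` supplies all the relations between them that are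
  -- needed.
  have i1 := P.wedge3_brk a ha X X X
  have i2 := P.wedge3_brk a ha X X (sqr a)
  have i3 := P.wedge3_brk a ha X (sqr a) (sqr a)
  have i4 := P.wedge3_brk a ha (sqr a) (sqr a) (sqr a)
  simp only [wedge3_brk_sqr] at i2 i3 i4
  have w1 : P.wedge X X X (sqr a) = P.wedge (sqr a) X X X := by
    rw [wedge_swap23, wedge_swap12, wedge_swap01]
  have w2 : P.wedge X X (sqr a) (sqr a) = P.wedge (sqr a) X X (sqr a) := by
    rw [wedge_swap12, wedge_swap01]
  have w3 : P.wedge X (sqr a) (sqr a) (sqr a) = P.wedge (sqr a) X (sqr a) (sqr a) := by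
    rw [wedge_swap01]
  have u1 : P.wedge3 a (brk a X) (sqr a) X = P.wedge3 a (brk a X) X (sqr a) := by
    rw [wedge3_swap_right]
  simp only [w1, w2, w3, u1] at *
  linear_combination -(4 / 5) * i1 + (2 / 5) * i2 - (4 / 35) * i3 + (1 / 70) * i4

end InvPoly


/-! ### The divergence theorem at infinity -/

/-- Integration in polar coordinates of a product of a radial and an angular function. -/
theorem integral_radial_mul_angular (h : ℝ → ℂ) (Φ : E8 → ℂ) :
    ∫ x : E8, h ‖x‖ * Φ (‖x‖⁻¹ • x) =
      (∫ z : Metric.sphere (0 : E8) 1, Φ z ∂(volume : Measure E8).toSphere) *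
        ∫ r in Set.Ioi (0 : ℝ), ((r : ℂ) ^ 7) * h r := by
  have hdim : Module.finrank ℝ E8 = 8 := by simp
  calc
    ∫ x : E8, h ‖x‖ * Φ (‖x‖⁻¹ • x) =
        ∫ x : ({(0 : E8)}ᶜ : Set E8), h ‖x.1‖ * Φ (‖x.1‖⁻¹ • x.1)
          ∂((volume : Measure E8).comap (↑)) := by
      rw [integral_subtype_comap (measurableSet_singleton _).compl
        fun x : E8 => h ‖x‖ * Φ (‖x‖⁻¹ • x), restrict_compl_singleton]
    _ = ∫ p : Metric.sphere (0 : E8) 1 × Set.Ioi (0 : ℝ), Φ p.1 * h p.2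
          ∂(volume : Measure E8).toSphere.prod (Measure.volumeIoiPow 7) := by
      have := (volume : Measure E8).measurePreserving_homeomorphUnitSphereProd.integral_comp
        (Homeomorph.measurableEmbedding _)
        (fun p : Metric.sphere (0 : E8) 1 × Set.Ioi (0 : ℝ) => Φ p.1 * h p.2)
      rw [hdim] at this
      rw [← this]
      refine integral_congr_ae (Eventually.of_forall fun x => ?_)
      simp [mul_comm]
    _ = (∫ z : Metric.sphere (0 : E8) 1, Φ z ∂(volume : Measure E8).toSphere) *
          ∫ r : Set.Ioi (0 : ℝ), h r ∂(Measure.volumeIoiPow 7) :=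
      integral_prod_mul (fun z : Metric.sphere (0 : E8) 1 => Φ z)
        (fun r : Set.Ioi (0 : ℝ) => h r)
    _ = _ := by
      congr 1
      simp only [Measure.volumeIoiPow, ENNReal.ofReal]
      rw [integral_withDensity_eq_integral_smul,
        integral_subtype_comap measurableSet_Ioi fun a : ℝ => Real.toNNReal (a ^ 7) • h a,
        setIntegral_congr_fun measurableSet_Ioi fun x hx => ?_]
      · simp only [NNReal.smul_def]
        rw [Real.coe_toNNReal _ (pow_nonneg hx.out.le _)]
        simp
      · exact (measurable_subtype_coe.pow_const _).real_toNNReal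

/-- A smooth step, equal to `1` on `(-∞, 1]` and to `0` on `[2, ∞)`. -/
noncomputable def step (s : ℝ) : ℝ := Real.smoothTransition (2 - s)

theorem step_contDiff {n : ℕ∞} : ContDiff ℝ n step :=
  Real.smoothTransition.contDiff.comp (contDiff_const.sub contDiff_id)

theorem step_eq_one {s : ℝ} (h : s ≤ 1) : step s = 1 :=
  Real.smoothTransition.one_of_one_le (by linarith)

theorem step_eq_zero {s : ℝ} (h : 2 ≤ s) : step s = 0 :=
  Real.smoothTransition.zero_of_nonpos (by linarith)

theorem step_antitone : Antitone step := fun _ _ h =>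
  Real.smoothTransition.monotone (by linarith)

theorem abs_step_le_one (s : ℝ) : |step s| ≤ 1 := by
  rw [step, abs_le]
  exact ⟨by linarith [Real.smoothTransition.nonneg (2 - s)], Real.smoothTransition.le_one _⟩

theorem step_differentiable : Differentiable ℝ step :=
  (step_contDiff (n := 1)).differentiable (by simp)

theorem deriv_step_eq_zero {s : ℝ} (h : s < 1 ∨ 2 < s) : deriv step s = 0 := by
  rcases h with h | h
  · have : step =ᶠ[𝓝 s] fun _ => 1 := by
      filter_upwards [Iio_mem_nhds h] with t ht using step_eq_one (le_of_lt ht)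
    rw [this.deriv_eq]; simp
  · have : step =ᶠ[𝓝 s] fun _ => 0 := by
      filter_upwards [Ioi_mem_nhds h] with t ht using step_eq_zero (le_of_lt ht)
    rw [this.deriv_eq]; simp

/-- The total drop of the step from 1 to 0 along a ray; monotonicity gives the integrability. Only
this drop, not the shape of the step, enters the flux. -/
theorem integral_deriv_step : ∫ r in Set.Ioi (0 : ℝ), deriv step (r ^ 2) * (2 * r) = -1 := by
  have h1 : ∀ r ∈ Set.Ici (0 : ℝ), HasDerivAt (fun r : ℝ => step (r ^ 2))
      (deriv step (r ^ 2) * (2 * r)) r := fun r _ => by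
    refine ((step_differentiable (r ^ 2)).hasDerivAt.comp r (hasDerivAt_pow 2 r)).congr_deriv ?_
    simp
  have h2 : Tendsto (fun r : ℝ => step (r ^ 2)) atTop (𝓝 0) := by
    refine tendsto_const_nhds.congr' ?_
    filter_upwards [eventually_ge_atTop 2] with r hr
    rw [step_eq_zero (by nlinarith)]
  rw [integral_Ioi_of_hasDerivAt_of_nonpos' h1 (fun r hr => ?_) h2]
  · rw [step_eq_one (by norm_num)]; norm_num
  · exact mul_nonpos_of_nonpos_of_nonneg step_antitone.deriv_nonpos
      (by have := hr.out; positivity)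

/-- The radial cutoff function, equal to `1` for `‖x‖ ≤ 1` and to `0` for `‖x‖² ≥ 2`. -/
noncomputable def cutoff (x : E8) : ℂ := (step (‖x‖ ^ 2) : ℂ)

theorem cutoff_contDiff {n : ℕ∞} : ContDiff ℝ n cutoff :=
  Complex.ofRealCLM.contDiff.comp (step_contDiff.comp (contDiff_norm_sq ℝ))

theorem norm_cutoff_le_one (x : E8) : ‖cutoff x‖ ≤ 1 := by
  simpa [cutoff] using abs_step_le_one (‖x‖ ^ 2)

/-- The partial derivatives of `cutoff`. -/
theorem fderiv_cutoff (x v : E8) :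
    fderiv ℝ cutoff x v = ((deriv step (‖x‖ ^ 2) * (2 * inner ℝ x v) : ℝ) : ℂ) := by
  have h1 : HasFDerivAt (fun x : E8 => step (‖x‖ ^ 2))
      (deriv step (‖x‖ ^ 2) • (2 • innerSL ℝ x)) x :=
    HasDerivAt.comp_hasFDerivAt (h₂ := step) x (step_differentiable (‖x‖ ^ 2)).hasDerivAt
      (hasStrictFDerivAt_norm_sq x).hasFDerivAt
  have h2 := Complex.ofRealCLM.hasFDerivAt.comp x h1
  have h3 : HasFDerivAt cutoff _ x := h2
  rw [h3.fderiv]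
  simp

theorem hasCompactSupport_of_norm_sq {F : Type*} [Zero F] {f : E8 → F}
    {c : ℝ} (hf : ∀ x, c ≤ ‖x‖ ^ 2 → f x = 0) :
    HasCompactSupport f := by
  refine HasCompactSupport.intro (isCompact_closedBall (0 : E8) (|c| + 1)) fun x hx => hf x ?_
  simp only [Metric.mem_closedBall, dist_zero_right, not_le] at hx
  nlinarith [abs_nonneg c, le_abs_self c]

/-- The gradient of the cutoff is radial, so only the normal component of `J` counts. The
homogeneity of degree -7 cancels the factor r⁷ of the volume element, and the remaining radial
integral is `integral_deriv_step`. -/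
theorem flux_integral (J : Fin 8 → E8 → ℂ)
    (hJ : ∀ M (r : ℝ) y, 0 < r → y ≠ 0 → J M (r • y) = ((r : ℂ) ^ 7)⁻¹ * J M y) :
    ∫ y : E8, ∑ M, fderiv ℝ cutoff y (EuclideanSpace.single M 1) * J M y =
      -∫ z : Metric.sphere (0 : E8) 1, ∑ M, (((z : E8) M : ℝ) : ℂ) * J M z
        ∂(volume : Measure E8).toSphere := by
  have h1 : ∀ y : E8, y ≠ 0 → ∑ M, fderiv ℝ cutoff y (EuclideanSpace.single M 1) * J M y =
      ((deriv step (‖y‖ ^ 2) * (2 * ‖y‖) : ℝ) * ((‖y‖ : ℂ) ^ 7)⁻¹) *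
        (fun z : E8 => ∑ M, ((z M : ℝ) : ℂ) * J M z) (‖y‖⁻¹ • y) := by
    intro y hy
    have hn : 0 < ‖y‖ := norm_pos_iff.mpr hy
    simp only [Finset.mul_sum]
    refine Finset.sum_congr rfl fun M _ => ?_
    rw [fderiv_cutoff, hJ M _ y (inv_pos.mpr hn) hy]
    have hn' : (‖y‖ : ℂ) ≠ 0 := by exact_mod_cast hn.ne'
    rw [EuclideanSpace.inner_single_right]
    simp
    field_simp
  have h2 : ∫ y : E8, ∑ M, fderiv ℝ cutoff y (EuclideanSpace.single M 1) * J M y =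
      ∫ y : E8, ((deriv step (‖y‖ ^ 2) * (2 * ‖y‖) : ℝ) * ((‖y‖ : ℂ) ^ 7)⁻¹) *
        (fun z : E8 => ∑ M, ((z M : ℝ) : ℂ) * J M z) (‖y‖⁻¹ • y) := by
    refine integral_congr_ae ?_
    filter_upwards [(measure_singleton (0 : E8) : volume {(0 : E8)} = 0) |> compl_mem_ae_iff.mpr]
      with y hy using h1 y hy
  rw [h2]
  refine (integral_radial_mul_angular
    (fun r => ((deriv step (r ^ 2) * (2 * r) : ℝ) * ((r : ℂ) ^ 7)⁻¹))
    (fun z => ∑ M, ((z M : ℝ) : ℂ) * J M z)).trans ?_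
  have h3 : ∫ r in Set.Ioi (0 : ℝ), ((r : ℂ) ^ 7) *
      (((deriv step (r ^ 2) * (2 * r) : ℝ) : ℂ) * ((r : ℂ) ^ 7)⁻¹) = -1 := by
    have : ∫ r in Set.Ioi (0 : ℝ), ((r : ℂ) ^ 7) *
      (((deriv step (r ^ 2) * (2 * r) : ℝ) : ℂ) * ((r : ℂ) ^ 7)⁻¹) =
      ∫ r in Set.Ioi (0 : ℝ), ((deriv step (r ^ 2) * (2 * r) : ℝ) : ℂ) := by
      refine setIntegral_congr_fun measurableSet_Ioi fun r hr => ?_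
      have : (r : ℂ) ≠ 0 := by exact_mod_cast hr.out.ne'
      field_simp
    rw [this, integral_complex_ofReal, integral_deriv_step]; simp
  rw [h3]; ring

/-- The divergence theorem on `ℝ⁸` with the flux through the sphere at infinity. -/
theorem integral_div_eq_flux (J J₀ : Fin 8 → E8 → ℂ) (hJ : ∀ M, ContDiff ℝ 1 (J M))
    (hint : Integrable fun x => ∑ M, fderiv ℝ (J M) x (EuclideanSpace.single M 1))
    (hlim : ∀ M y, y ≠ 0 → Tendsto (fun R : ℝ => (R : ℂ) ^ 7 * J M (R • y)) atTop (𝓝 (J₀ M y)))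
    (hbd : ∃ C R₀ : ℝ, ∀ M x, R₀ ≤ ‖x‖ → ‖x‖ ^ 7 * ‖J M x‖ ≤ C) :
    ∫ x, ∑ M, fderiv ℝ (J M) x (EuclideanSpace.single M 1) =
      ∫ z : Metric.sphere (0 : E8) 1, ∑ M, (((z : E8) M : ℝ) : ℂ) * J₀ M z
        ∂(volume : Measure E8).toSphere := by
  obtain ⟨C, R₀, hC⟩ := hbd
  set D : E8 → ℂ := fun x => ∑ M, fderiv ℝ (J M) x (EuclideanSpace.single M 1) with hD
  -- A limit of R⁷ J(R y) is automatically homogeneous of degree -7, as `flux_integral` requires.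
  have hhom : ∀ M (r : ℝ) y, 0 < r → y ≠ 0 → J₀ M (r • y) = ((r : ℂ) ^ 7)⁻¹ * J₀ M y := by
    intro M r y hr hy
    have hr' : (r : ℂ) ≠ 0 := by exact_mod_cast hr.ne'
    have h1 := hlim M (r • y) (smul_ne_zero hr.ne' hy)
    have h2 := ((hlim M y hy).comp (tendsto_id.atTop_mul_const hr)).const_mul (((r : ℂ) ^ 7)⁻¹)
    refine tendsto_nhds_unique h1 (h2.congr fun R => ?_)
    simp only [Function.comp, id, smul_smul]
    push_cast
    field_simp
  have hc0 : Continuous fun x => fderiv ℝ cutoff x :=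
    (cutoff_contDiff (n := 1)).continuous_fderiv (by simp)
  -- Multiply the divergence by a cutoff at radius R and integrate by parts. As R tends to infinity,
  -- the left side tends to the full integral and the right side to the flux of `J₀`.
  have eq : ∀ R : ℝ, 0 < R → ∫ x, cutoff (R⁻¹ • x) * D x =
      -∫ y, ∑ M, fderiv ℝ cutoff y (EuclideanSpace.single M 1) * ((R : ℂ) ^ 7 * J M (R • y)) := by
    intro R hR
    have hRc : (R : ℂ) ≠ 0 := by exact_mod_cast hR.ne'
    set c : E8 → ℂ := fun x => cutoff (R⁻¹ • x) with hc
    have hcd : ContDiff ℝ 1 c := (cutoff_contDiff (n := 1)).comp (contDiff_const_smul _)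
    have hcs : HasCompactSupport c := by
      refine hasCompactSupport_of_norm_sq (c := 2 * R ^ 2) fun x hx => ?_
      simp only [hc, cutoff]
      rw [step_eq_zero, ofReal_zero]
      rw [norm_smul, mul_pow, norm_inv, Real.norm_eq_abs, inv_pow, sq_abs]
      field_simp
      exact hx
    have hfc : ∀ x v, fderiv ℝ c x v = (R : ℂ)⁻¹ * fderiv ℝ cutoff (R⁻¹ • x) v := by
      intro x v
      have h1 : HasFDerivAt (fun x : E8 => R⁻¹ • x) (R⁻¹ • ContinuousLinearMap.id ℝ E8) x :=
        (hasFDerivAt_id x).const_smul R⁻¹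
      have h2 := (((cutoff_contDiff (n := 1)).differentiable (by simp)
        (R⁻¹ • x)).hasFDerivAt).comp x h1
      have h3 : HasFDerivAt c _ x := h2
      rw [h3.fderiv]
      simp
    have hJc : ∀ M, Continuous fun x => fderiv ℝ (J M) x (EuclideanSpace.single M 1) := fun M =>
      ((hJ M).continuous_fderiv (by simp)).clm_apply continuous_const
    have hcc : ∀ M : Fin 8, Continuous fun x => fderiv ℝ c x (EuclideanSpace.single M 1) := fun M =>
      (hcd.continuous_fderiv (by simp)).clm_apply continuous_const
    have i1 : ∀ M, Integrable fun x => c x * fderiv ℝ (J M) x (EuclideanSpace.single M 1) :=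
      fun M => (hcd.continuous.mul (hJc M)).integrable_of_hasCompactSupport hcs.mul_right
    have i2 : ∀ M, Integrable fun x => fderiv ℝ c x (EuclideanSpace.single M 1) * J M x :=
      fun M => ((hcc M).mul (hJ M).continuous).integrable_of_hasCompactSupport
        (hcs.fderiv_apply ℝ _).mul_right
    have i3 : ∀ M, Integrable fun x => c x * J M x :=
      fun M => (hcd.continuous.mul (hJ M).continuous).integrable_of_hasCompactSupport hcs.mul_right
    have e1 : ∫ x, c x * D x = -∫ x, ∑ M, fderiv ℝ c x (EuclideanSpace.single M 1) * J M x := by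
      simp only [hD, Finset.mul_sum]
      rw [integral_finsetSum _ fun M _ => i1 M, integral_finsetSum _ fun M _ => i2 M,
        ← Finset.sum_neg_distrib]
      refine Finset.sum_congr rfl fun M _ => ?_
      exact integral_mul_fderiv_eq_neg_fderiv_mul_of_integrable (i2 M) (i1 M) (i3 M)
        (fun x _ => hcd.differentiable (by simp) x) (fun x _ => (hJ M).differentiable (by simp) x)
    rw [e1]
    -- Substitution x = R y: the volume element contributes R⁸ and the derivative of the rescaled
    -- cutoff R⁻¹, which leaves R⁷.
    have e2 := Measure.integral_comp_smul_of_nonneg (volume : Measure E8)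
      (fun x => ∑ M, fderiv ℝ c x (EuclideanSpace.single M 1) * J M x) R (hR := hR.le)
    have hdim : Module.finrank ℝ E8 = 8 := by simp
    rw [hdim, eq_inv_smul_iff₀ (by positivity)] at e2
    rw [← e2, ← integral_smul]
    congr 1
    refine integral_congr_ae (Eventually.of_forall fun y => ?_)
    simp only [hfc, Finset.smul_sum, inv_smul_smul₀ hR.ne']
    refine Finset.sum_congr rfl fun M _ => ?_
    rw [Complex.real_smul]
    push_cast
    field_simp
  have t1 : Tendsto (fun R : ℝ => ∫ x, cutoff (R⁻¹ • x) * D x) atTop (𝓝 (∫ x, D x)) := by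
    refine tendsto_integral_filter_of_dominated_convergence (fun x => ‖D x‖) ?_ ?_ hint.norm ?_
    · refine Eventually.of_forall fun R => ?_
      exact ((cutoff_contDiff (n := 1)).continuous.comp
        (continuous_const_smul _)).aestronglyMeasurable.mul hint.aestronglyMeasurable
    · refine Eventually.of_forall fun R => Eventually.of_forall fun x => ?_
      rw [norm_mul]
      exact mul_le_of_le_one_left (norm_nonneg _) (norm_cutoff_le_one _)
    · refine Eventually.of_forall fun x => ?_
      refine tendsto_const_nhds.congr' ?_
      filter_upwards [eventually_ge_atTop (max 1 ‖x‖)] with R hR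
      have h1 : 0 < R := lt_of_lt_of_le one_pos ((le_max_left _ _).trans hR)
      have h2 : ‖x‖ ≤ R := (le_max_right _ _).trans hR
      rw [cutoff, step_eq_one, ofReal_one, one_mul]
      rw [norm_smul, norm_inv, Real.norm_eq_abs, abs_of_pos h1]
      refine pow_le_one₀ (by positivity) ?_
      rw [inv_mul_le_iff₀ h1]; simpa using h2
  have t2 : Tendsto (fun R : ℝ => ∫ y, ∑ M, fderiv ℝ cutoff y (EuclideanSpace.single M 1) *
      ((R : ℂ) ^ 7 * J M (R • y))) atTop
      (𝓝 (∫ y, ∑ M, fderiv ℝ cutoff y (EuclideanSpace.single M 1) * J₀ M y)) := by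
    have hcc : ∀ M : Fin 8, Continuous fun x => fderiv ℝ cutoff x (EuclideanSpace.single M 1) :=
      fun M => hc0.clm_apply continuous_const
    have hcs : HasCompactSupport cutoff := hasCompactSupport_of_norm_sq (c := 2) fun x hx => by
      rw [cutoff, step_eq_zero hx, ofReal_zero]
    refine tendsto_integral_filter_of_dominated_convergence
      (fun y => ∑ M, ‖fderiv ℝ cutoff y (EuclideanSpace.single M 1)‖ * C) ?_ ?_ ?_ ?_
    · refine Eventually.of_forall fun R => Continuous.aestronglyMeasurable ?_
      refine continuous_finsetSum _ fun M _ => (hcc M).mul (continuous_const.mul ?_)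
      exact (hJ M).continuous.comp (continuous_const_smul R)
    · filter_upwards [eventually_ge_atTop (max 1 R₀)] with R hR
      have h1 : 1 ≤ R := (le_max_left _ _).trans hR
      have h2 : R₀ ≤ R := (le_max_right _ _).trans hR
      refine Eventually.of_forall fun y => (norm_sum_le _ _).trans
        (Finset.sum_le_sum fun M _ => ?_)
      rw [norm_mul]
      -- `hbd` controls `J` only far from the origin. The derivative of the cutoff vanishes for ‖y‖
      -- < 1, and for ‖y‖ ≥ 1 the point R y has norm at least R ≥ R₀.
      by_cases hy : ‖y‖ < 1
      · rw [fderiv_cutoff, deriv_step_eq_zero (Or.inl (by nlinarith [norm_nonneg y]))]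
        simp
      · push Not at hy
        refine mul_le_mul_of_nonneg_left ?_ (norm_nonneg _)
        have h3 : ‖R • y‖ = R * ‖y‖ := by
          rw [norm_smul, Real.norm_eq_abs, abs_of_pos (by linarith)]
        have h4 : R ≤ ‖R • y‖ := by rw [h3]; nlinarith
        refine le_trans ?_ (hC M (R • y) (h2.trans h4))
        rw [norm_mul, norm_pow, Complex.norm_real, Real.norm_eq_abs, abs_of_pos (by linarith)]
        gcongr
    · refine integrable_finsetSum _ fun M _ => Integrable.mul_const ?_ _
      exact ((hcc M).integrable_of_hasCompactSupport (hcs.fderiv_apply ℝ _)).norm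
    · filter_upwards [compl_mem_ae_iff.mpr (measure_singleton (0 : E8) : volume {(0 : E8)} = 0)]
        with y hy
      exact tendsto_finsetSum _ fun M _ => (hlim M y hy).const_mul _
  have t3 := t2.neg
  rw [flux_integral J₀ hhom, neg_neg] at t3
  refine tendsto_nhds_unique t1 (t3.congr' ?_)
  filter_upwards [eventually_gt_atTop 0] with R hR using (eq R hR).symm


/-! ### Calculus of matrix-valued functions -/

/-- A matrix-valued function is smooth at a point if its entries are. -/
def MSmoothAt (g : E8 → Mat8) (x : E8) : Prop := ∀ a b, ContDiffAt ℝ ∞ (fun y => g y a b) x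

namespace MSmoothAt

variable {f g : E8 → Mat8} {x : E8}

theorem diff (hf : MSmoothAt f x) (a b : Fin 8) : DifferentiableAt ℝ (fun y => f y a b) x :=
  (hf a b).differentiableAt (by simp)

theorem const (C : Mat8) : MSmoothAt (fun _ => C) x := fun _ _ => contDiffAt_const

theorem add (hf : MSmoothAt f x) (hg : MSmoothAt g x) : MSmoothAt (fun y => f y + g y) x :=
  fun a b => (hf a b).add (hg a b)

theorem sub (hf : MSmoothAt f x) (hg : MSmoothAt g x) : MSmoothAt (fun y => f y - g y) x :=
  fun a b => (hf a b).sub (hg a b)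

theorem mul (hf : MSmoothAt f x) (hg : MSmoothAt g x) : MSmoothAt (fun y => f y * g y) x := by
  intro a b
  simp only [Matrix.mul_apply]
  exact ContDiffAt.sum fun c _ => (hf a c).mul (hg c b)

theorem smul {φ : E8 → ℂ} (hφ : ContDiffAt ℝ ∞ φ x) (hf : MSmoothAt f x) :
    MSmoothAt (fun y => φ y • f y) x := fun a b => hφ.mul (hf a b)

theorem const_smul (c : ℂ) (hf : MSmoothAt f x) : MSmoothAt (fun y => c • f y) x :=
  smul contDiffAt_const hf

theorem transpose (hf : MSmoothAt f x) : MSmoothAt (fun y => (f y).transpose) x :=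
  fun a b => hf b a

theorem congr (hf : MSmoothAt f x) (h : g =ᶠ[𝓝 x] f) : MSmoothAt g x := fun a b =>
  (hf a b).congr_of_eventuallyEq (h.mono fun y hy => by simp only [hy])

theorem pd (hf : MSmoothAt f x) (M : Fin 8) : MSmoothAt (fun y => pd M f y) x := by
  intro a b
  exact ((hf a b).fderiv_right (m := ∞) (by simp)).clm_apply contDiffAt_const

end MSmoothAt

section pd

variable {f g : E8 → Mat8} {x : E8} (M N : Fin 8)

theorem pd_congr (h : g =ᶠ[𝓝 x] f) : pd M g x = pd M f x := by
  ext a b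
  have : (fun y => g y a b) =ᶠ[𝓝 x] fun y => f y a b := h.mono fun y hy => by simp only [hy]
  simp only [pd, Matrix.of_apply, this.fderiv_eq]

theorem pd_const (C : Mat8) : pd M (fun _ => C) x = 0 := by
  ext a b; simp [pd]

theorem pd_add (hf : MSmoothAt f x) (hg : MSmoothAt g x) :
    pd M (fun y => f y + g y) x = pd M f x + pd M g x := by
  ext a b
  simp only [pd, Matrix.of_apply, Matrix.add_apply]
  rw [fderiv_fun_add (hf.diff a b) (hg.diff a b)]; rfl

theorem pd_sub (hf : MSmoothAt f x) (hg : MSmoothAt g x) :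
    pd M (fun y => f y - g y) x = pd M f x - pd M g x := by
  ext a b
  simp only [pd, Matrix.of_apply, Matrix.sub_apply]
  rw [fderiv_fun_sub (hf.diff a b) (hg.diff a b)]; rfl

theorem pd_const_smul (c : ℂ) (hf : MSmoothAt f x) :
    pd M (fun y => c • f y) x = c • pd M f x := by
  ext a b
  simp only [pd, Matrix.of_apply, Matrix.smul_apply]
  rw [fderiv_fun_const_smul (hf.diff a b)]; rfl

theorem pd_transpose : pd M (fun y => (f y).transpose) x = (pd M f x).transpose := rfl

theorem pd_mul (hf : MSmoothAt f x) (hg : MSmoothAt g x) :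
    pd M (fun y => f y * g y) x = pd M f x * g x + f x * pd M g x := by
  ext a b
  simp only [pd, Matrix.of_apply, Matrix.mul_apply, Matrix.add_apply]
  have h := HasFDerivAt.fun_sum (u := Finset.univ) fun c _ =>
    (hf.diff a c).hasFDerivAt.mul (hg.diff c b).hasFDerivAt
  refine (congrArg (fun L => L (EuclideanSpace.single M 1)) h.fderiv).trans ?_
  rw [sum_apply, ← Finset.sum_add_distrib]
  refine Finset.sum_congr rfl fun c _ => ?_
  simp
  ring

theorem pd_comm (hf : MSmoothAt f x) :
    pd M (fun y => pd N f y) x = pd N (fun y => pd M f y) x := by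
  ext a b
  simp only [pd, Matrix.of_apply]
  have hs : IsSymmSndFDerivAt ℝ (fun y => f y a b) x := (hf a b).isSymmSndFDerivAt (by
    simp only [minSmoothness_of_isRCLikeNormedField]
    exact WithTop.coe_le_coe.mpr (le_top : (2 : ℕ∞) ≤ ⊤))
  have hd : DifferentiableAt ℝ (fderiv ℝ (fun y => f y a b)) x :=
    ((hf a b).fderiv_right (m := ∞) (by simp)).differentiableAt (by simp)
  have e : ∀ K L : Fin 8, fderiv ℝ (fun y => fderiv ℝ (fun y => f y a b) y
      (EuclideanSpace.single K 1)) x (EuclideanSpace.single L 1) =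
      fderiv ℝ (fderiv ℝ (fun y => f y a b)) x (EuclideanSpace.single L 1)
        (EuclideanSpace.single K 1) := by
    intro K L
    rw [fderiv_clm_apply hd (differentiableAt_const _)]
    simp
  rw [e, e, hs.eq]

end pd

/-! ### Smoothness and product rule for invariant polynomials of matrix-valued functions. -/

namespace InvPoly

variable (P : InvPoly)

/-- The elementary matrices. -/
noncomputable def elem (i : Fin 8 × Fin 8) : Mat8 := Matrix.single i.1 i.2 1

theorem map_sum0 {ι : Type*} (s : Finset ι) (f : ι → Mat8) (Y Z W) :
    P (∑ i ∈ s, f i) Y Z W = ∑ i ∈ s, P (f i) Y Z W := by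
  classical
  induction s using Finset.induction_on with
  | empty => simp [P.zero0]
  | insert i s hi ih => rw [Finset.sum_insert hi, Finset.sum_insert hi, P.add0, ih]

theorem expand0 (X Y Z W) : P X Y Z W = ∑ i : Fin 8 × Fin 8, X i.1 i.2 * P (elem i) Y Z W := by
  conv_lhs => rw [Matrix.matrix_eq_sum_single X]
  rw [map_sum0, Fintype.sum_prod_type]
  refine Finset.sum_congr rfl fun a _ => ?_
  rw [map_sum0]
  refine Finset.sum_congr rfl fun b _ => ?_
  rw [← P.smul0, elem, Matrix.smul_single, smul_eq_mul, mul_one]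

/-- Multilinearity turns `P` into a polynomial with constant coefficients in the matrix entries, so
that smoothness and the product rule reduce to scalar functions. -/
theorem expand (X Y Z W) : P X Y Z W = ∑ i : Fin 8 × Fin 8, ∑ j : Fin 8 × Fin 8,
    ∑ k : Fin 8 × Fin 8, ∑ l : Fin 8 × Fin 8,
      X i.1 i.2 * Y j.1 j.2 * Z k.1 k.2 * W l.1 l.2 * P (elem i) (elem j) (elem k) (elem l) := by
  rw [expand0]
  refine Finset.sum_congr rfl fun i _ => ?_
  rw [P.swap01, expand0, Finset.mul_sum]
  refine Finset.sum_congr rfl fun j _ => ?_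
  rw [P.swap12, P.swap01, expand0, Finset.mul_sum, Finset.mul_sum]
  refine Finset.sum_congr rfl fun k _ => ?_
  rw [P.swap23, P.swap12, P.swap01, expand0, Finset.mul_sum, Finset.mul_sum, Finset.mul_sum]
  refine Finset.sum_congr rfl fun l _ => ?_
  rw [P.swap01 (elem l), P.swap12 _ (elem l), P.swap23 _ _ (elem l), P.swap12 (elem k),
    P.swap01 (elem k), P.swap12 (elem i) (elem k)]
  ring_nf

variable {X Y Z W : E8 → Mat8} {x : E8}

theorem contDiffAt (hX : MSmoothAt X x) (hY : MSmoothAt Y x) (hZ : MSmoothAt Z x)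
    (hW : MSmoothAt W x) : ContDiffAt ℝ ∞ (fun y => P (X y) (Y y) (Z y) (W y)) x := by
  simp only [fun y => P.expand (X y)]
  exact ContDiffAt.sum fun i _ => ContDiffAt.sum fun j _ => ContDiffAt.sum fun k _ =>
    ContDiffAt.sum fun l _ => ((((hX _ _).mul (hY _ _)).mul (hZ _ _)).mul (hW _ _)).mul
      contDiffAt_const

theorem fderiv_apply (hX : MSmoothAt X x) (hY : MSmoothAt Y x) (hZ : MSmoothAt Z x)
    (hW : MSmoothAt W x) (M : Fin 8) :
    fderiv ℝ (fun y => P (X y) (Y y) (Z y) (W y)) x (EuclideanSpace.single M 1) =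
      P (pd M X x) (Y x) (Z x) (W x) + P (X x) (pd M Y x) (Z x) (W x) +
      P (X x) (Y x) (pd M Z x) (W x) + P (X x) (Y x) (Z x) (pd M W x) := by
  have h := fun i j k l : Fin 8 × Fin 8 => ((((hX.diff i.1 i.2).hasFDerivAt.mul
    (hY.diff j.1 j.2).hasFDerivAt).mul (hZ.diff k.1 k.2).hasFDerivAt).mul
      (hW.diff l.1 l.2).hasFDerivAt).mul_const (P (elem i) (elem j) (elem k) (elem l))
  have h' := HasFDerivAt.fun_sum (u := Finset.univ) fun i _ => HasFDerivAt.fun_sum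
    (u := Finset.univ) fun j _ => HasFDerivAt.fun_sum (u := Finset.univ) fun k _ =>
    HasFDerivAt.fun_sum (u := Finset.univ) fun l _ => h i j k l
  have e : (fun y => P (X y) (Y y) (Z y) (W y)) = _ := funext fun y => P.expand (X y) _ _ _
  rw [e]
  refine (congrArg (fun L => L (EuclideanSpace.single M 1)) h'.fderiv).trans ?_
  rw [P.expand (pd M X x), P.expand _ (pd M Y x), P.expand _ _ (pd M Z x), P.expand _ _ _ (pd M W x)]
  simp only [← Finset.sum_add_distrib, sum_apply]
  refine Finset.sum_congr rfl fun i _ => Finset.sum_congr rfl fun j _ =>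
    Finset.sum_congr rfl fun k _ => Finset.sum_congr rfl fun l _ => ?_
  simp [pd]
  ring

end InvPoly


/-! ### Real matrices as complex matrices -/

/-- A real matrix as a complex matrix. -/
noncomputable def cx : Matrix (Fin 8) (Fin 8) ℝ →+* Mat8 := Complex.ofRealHom.mapMatrix

theorem cx_apply (R : Matrix (Fin 8) (Fin 8) ℝ) : cx R = R.map fun t : ℝ => (t : ℂ) := rfl

theorem cx_transpose (R : Matrix (Fin 8) (Fin 8) ℝ) : cx R.transpose = (cx R).transpose := rfl

theorem cx_det (R : Matrix (Fin 8) (Fin 8) ℝ) : (cx R).det = (R.det : ℂ) :=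
  (Complex.ofRealHom.map_det R).symm

theorem cx_injective : Function.Injective cx := fun A B h => by
  ext i j
  have := congrFun (congrFun h i) j
  exact Complex.ofReal_injective this

theorem exists_cx_eq {G : Mat8} (h : ∀ a b, (G a b).im = 0) : ∃ R, cx R = G :=
  ⟨G.map Complex.re, by
    ext a b
    exact Complex.ext (by simp [cx_apply]) (by simp [cx_apply, h])⟩

/-- A complex matrix is special orthogonal. -/
def IsSO (G : Mat8) : Prop := G * G.transpose = 1 ∧ G.det = 1 ∧ ∀ a b, (G a b).im = 0

theorem isSO_iff (G : Mat8) : IsSO G ↔ ∃ R ∈ Matrix.specialOrthogonalGroup (Fin 8) ℝ,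
    G = R.map (fun t : ℝ => (t : ℂ)) := by
  constructor
  · rintro ⟨h1, h2, h3⟩
    obtain ⟨R, rfl⟩ := exists_cx_eq h3
    refine ⟨R, Matrix.mem_specialOrthogonalGroup_iff.mpr
      ⟨(Matrix.mem_orthogonalGroup_iff _ _).mpr ?_, ?_⟩, rfl⟩
    · apply cx_injective; rw [map_mul, map_one, cx_transpose, h1]
    · rw [cx_det] at h2; exact_mod_cast h2
  · rintro ⟨R, hR, rfl⟩
    obtain ⟨h1, h2⟩ := Matrix.mem_specialOrthogonalGroup_iff.mp hR
    rw [Matrix.mem_orthogonalGroup_iff] at h1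
    rw [← cx_apply]
    refine ⟨?_, ?_, fun a b => by simp [cx_apply]⟩
    · rw [← cx_transpose, ← map_mul, h1, map_one]
    · rw [cx_det, h2, ofReal_one]

namespace IsSO

variable {G H : Mat8}

theorem transpose_mul (hG : IsSO G) : G.transpose * G = 1 := mul_eq_one_comm.mp hG.1

theorem inv_eq (hG : IsSO G) : G⁻¹ = G.transpose := Matrix.inv_eq_right_inv hG.1

theorem isUnit (hG : IsSO G) : IsUnit G.det := by rw [hG.2.1]; exact isUnit_one

theorem im_mul (hG : ∀ a b, (G a b).im = 0) (hH : ∀ a b, (H a b).im = 0) (a b) :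
    ((G * H) a b).im = 0 := by
  obtain ⟨R, rfl⟩ := exists_cx_eq hG
  obtain ⟨S, rfl⟩ := exists_cx_eq hH
  rw [← map_mul]; simp [cx_apply]

theorem one : IsSO 1 := ⟨by simp, by simp, fun a b => by
  rw [← map_one cx]; simp [cx_apply]⟩

theorem mul (hG : IsSO G) (hH : IsSO H) : IsSO (G * H) := by
  refine ⟨?_, by rw [Matrix.det_mul, hG.2.1, hH.2.1, one_mul], im_mul hG.2.2 hH.2.2⟩
  rw [Matrix.transpose_mul]
  calc G * H * (H.transpose * G.transpose) = G * (H * H.transpose) * G.transpose := by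
        noncomm_ring
    _ = 1 := by rw [hH.1, mul_one, hG.1]

theorem inv (hG : IsSO G) : IsSO G⁻¹ := by
  rw [hG.inv_eq]
  exact ⟨by rw [Matrix.transpose_transpose, hG.transpose_mul],
    by rw [Matrix.det_transpose, hG.2.1], fun a b => hG.2.2 b a⟩

end IsSO

/-! ### Maps from the sphere to `SO(8)` -/

namespace IsSphereMapToSO8

variable {g h : E8 → Mat8} {x : E8}

theorem isSO (hg : IsSphereMapToSO8 g) (hx : x ≠ 0) : IsSO (g x) :=
  (isSO_iff _).mpr (hg.mem_SO x hx)

theorem smoothAt (hg : IsSphereMapToSO8 g) (hx : x ≠ 0) : MSmoothAt g x := fun a b =>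
  (hg.smooth a b).contDiffAt (isOpen_compl_singleton.mem_nhds hx)

theorem mk' (h1 : ∀ (c : ℝ) (x : E8), 0 < c → g (c • x) = g x)
    (h2 : ∀ x, x ≠ 0 → MSmoothAt g x) (h3 : ∀ x, x ≠ 0 → IsSO (g x)) : IsSphereMapToSO8 g :=
  ⟨h1, fun a b x hx => (h2 x hx a b).contDiffWithinAt, fun x hx => (isSO_iff _).mp (h3 x hx)⟩

theorem one : IsSphereMapToSO8 fun _ => 1 :=
  mk' (fun _ _ _ => rfl) (fun _ _ => MSmoothAt.const _) fun _ _ => IsSO.one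

theorem mul (hg : IsSphereMapToSO8 g) (hh : IsSphereMapToSO8 h) :
    IsSphereMapToSO8 fun x => g x * h x :=
  mk' (fun c x hc => by rw [hg.homogeneous c x hc, hh.homogeneous c x hc])
    (fun _ hx => (hg.smoothAt hx).mul (hh.smoothAt hx)) fun _ hx => (hg.isSO hx).mul (hh.isSO hx)

theorem eventually_ne (hx : x ≠ 0) : ∀ᶠ y in 𝓝 x, y ≠ 0 :=
  isOpen_compl_singleton.mem_nhds hx

theorem inv_smoothAt (hg : IsSphereMapToSO8 g) (hx : x ≠ 0) : MSmoothAt (fun x => (g x)⁻¹) x :=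
  (hg.smoothAt hx).transpose.congr
    ((eventually_ne hx).mono fun _ hy => (hg.isSO hy).inv_eq)

theorem inv (hg : IsSphereMapToSO8 g) : IsSphereMapToSO8 fun x => (g x)⁻¹ :=
  mk' (fun c x hc => by rw [hg.homogeneous c x hc]) (fun _ hx => hg.inv_smoothAt hx)
    fun _ hx => (hg.isSO hx).inv

theorem conj (hg : IsSphereMapToSO8 g) {O : Mat8} (hO : O * O.transpose = 1)
    (him : ∀ a b, (O a b).im = 0) : IsSphereMapToSO8 fun x => O * g x * O.transpose := by
  refine mk' (fun c x hc => by rw [hg.homogeneous c x hc])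
    (fun _ hx => ((MSmoothAt.const O).mul (hg.smoothAt hx)).mul (MSmoothAt.const _))
    fun x hx => ⟨?_, ?_, IsSO.im_mul (IsSO.im_mul him (hg.isSO hx).2.2) fun a b => him b a⟩
  · have hO' : O.transpose * O = 1 := mul_eq_one_comm.mp hO
    rw [Matrix.transpose_mul, Matrix.transpose_mul, Matrix.transpose_transpose]
    calc O * g x * O.transpose * (O * ((g x).transpose * O.transpose)) =
        O * (g x * (O.transpose * O) * (g x).transpose) * O.transpose := by noncomm_ring
      _ = 1 := by rw [hO', mul_one, (hg.isSO hx).1, mul_one, hO]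
  · have := congrArg Matrix.det hO
    rw [Matrix.det_mul, Matrix.det_one] at this
    rw [Matrix.det_mul, Matrix.det_mul, (hg.isSO hx).2.1, mul_one, this]

theorem mc_smoothAt (hg : IsSphereMapToSO8 g) (hx : x ≠ 0) (M : Fin 8) :
    MSmoothAt (mc g M) x :=
  (hg.inv_smoothAt hx).mul ((hg.smoothAt hx).pd M)

theorem mul_mc (hg : IsSphereMapToSO8 g) (hx : x ≠ 0) (M : Fin 8) :
    g x * mc g M x = pd M g x := by
  rw [mc, ← mul_assoc, Matrix.mul_nonsing_inv _ (hg.isSO hx).isUnit, one_mul]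

/-- Differentiate gᵀg = 1, which holds in a neighbourhood of x because x is not the origin. -/
theorem mc_transpose (hg : IsSphereMapToSO8 g) (hx : x ≠ 0) (M : Fin 8) :
    (mc g M x).transpose = -mc g M x := by
  have h1 : pd M (fun y => (g y).transpose * g y) x = 0 := by
    rw [← pd_const (x := x) M (1 : Mat8)]
    exact pd_congr M ((eventually_ne hx).mono fun y hy => (hg.isSO hy).transpose_mul)
  rw [pd_mul M (hg.smoothAt hx).transpose (hg.smoothAt hx), pd_transpose] at h1
  rw [mc, (hg.isSO hx).inv_eq, Matrix.transpose_mul, Matrix.transpose_transpose]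
  exact eq_neg_of_add_eq_zero_left h1

theorem pd_im (hg : IsSphereMapToSO8 g) (hx : x ≠ 0) (M a b : Fin 8) :
    (pd M g x a b).im = 0 := by
  have h1 := Complex.imCLM.hasFDerivAt.comp x ((hg.smoothAt hx).diff a b).hasFDerivAt
  have h2 : (Complex.imCLM ∘ fun y => g y a b) =ᶠ[𝓝 x] fun _ => (0 : ℝ) :=
    (eventually_ne hx).mono fun y hy => (hg.isSO hy).2.2 a b
  have h3 := (hasFDerivAt_const (𝕜 := ℝ) (0 : ℝ) x).congr_of_eventuallyEq h2
  have h4 := congrArg (fun L => L (EuclideanSpace.single M 1)) (h1.unique h3)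
  simpa [pd] using h4

theorem mc_im (hg : IsSphereMapToSO8 g) (hx : x ≠ 0) (M a b : Fin 8) :
    (mc g M x a b).im = 0 :=
  IsSO.im_mul (hg.isSO hx).inv.2.2 (hg.pd_im hx M) a b

/-- Derivatives of a function of degree 0 are homogeneous of degree -1; so is therefore θ, and its
values on the unit sphere control it everywhere. -/
theorem pd_smul (hg : IsSphereMapToSO8 g) (hx : x ≠ 0) {c : ℝ} (hc : 0 < c) (M : Fin 8) :
    (c : ℂ) • pd M g (c • x) = pd M g x := by
  ext a b
  have h1 : HasFDerivAt (fun y : E8 => c • y) (c • ContinuousLinearMap.id ℝ E8) x :=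
    (hasFDerivAt_id x).const_smul c
  have h2 := (((hg.smoothAt (smul_ne_zero hc.ne' hx)).diff a b).hasFDerivAt).comp x h1
  have h3 : ((fun y => g y a b) ∘ fun y : E8 => c • y) = fun y => g y a b := by
    funext y; simp [hg.homogeneous c y hc]
  rw [h3] at h2
  simp [pd, h2.fderiv]

theorem mc_smul (hg : IsSphereMapToSO8 g) (hx : x ≠ 0) {c : ℝ} (hc : 0 < c) (M : Fin 8) :
    (c : ℂ) • mc g M (c • x) = mc g M x := by
  rw [mc, mc, hg.homogeneous c x hc, ← Matrix.mul_smul, hg.pd_smul hx hc]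

end IsSphereMapToSO8

/-! ### The charge of a map for an invariant polynomial -/

/-- The Chern–Simons form of a map, `P (θ ∧ θ² ∧ θ² ∧ θ²)` with `θ = g⁻¹ dg`. -/
noncomputable def mapForm (P : InvPoly) (g : E8 → Mat8) (m : Fin 7 → Fin 8) (x : E8) : ℂ :=
  P (mc g (m 0) x) (mc g (m 1) x * mc g (m 2) x) (mc g (m 3) x * mc g (m 4) x)
    (mc g (m 5) x * mc g (m 6) x)

/-- Antihermitian components of a gauge field. -/
noncomputable def acon (A : Fin 8 → E8 → Mat8) (M : Fin 8) (x : E8) : Mat8 :=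
  (-Complex.I) • A M x

/-- Half of the field strength of `acon A`. -/
noncomputable def fs (A : Fin 8 → E8 → Mat8) (M N : Fin 8) (x : E8) : Mat8 :=
  (-(Complex.I / 2)) • fieldStrength A M N x

/-- The charge density `P (F ∧ F ∧ F ∧ F)`. -/
noncomputable def fieldForm (P : InvPoly) (A : Fin 8 → E8 → Mat8) (x : E8) : ℂ :=
  P.wedge (fun M N => fs A M N x) (fun M N => fs A M N x) (fun M N => fs A M N x)
    fun M N => fs A M N x

theorem MSmoothAt.acon {A : Fin 8 → E8 → Mat8} {x : E8} (hA : ∀ M, MSmoothAt (A M) x) (M : Fin 8) :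
    MSmoothAt (acon A M) x := (hA M).const_smul _

theorem MSmoothAt.fieldStrength {A : Fin 8 → E8 → Mat8} {x : E8} (hA : ∀ M, MSmoothAt (A M) x)
    (M N : Fin 8) : MSmoothAt (fieldStrength A M N) x :=
  (((hA N).pd M).sub ((hA M).pd N)).sub
    ((((hA M).mul (hA N)).sub ((hA N).mul (hA M))).const_smul _)

theorem MSmoothAt.fs {A : Fin 8 → E8 → Mat8} {x : E8} (hA : ∀ M, MSmoothAt (A M) x)
    (M N : Fin 8) : MSmoothAt (fs A M N) x := (MSmoothAt.fieldStrength hA M N).const_smul _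

/-- For a = -iA one has -iF = da + a ∧ a, free of factors i. This is the shape of the hypothesis
`hX` of `InvPoly.transgression`. -/
theorem fs_eq {A : Fin 8 → E8 → Mat8} {x : E8} (hA : ∀ M, MSmoothAt (A M) x) (M N : Fin 8) :
    fs A M N x = (1 / 2 : ℂ) • (pd M (acon A N) x - pd N (acon A M) x +
      acon A M x * acon A N x - acon A N x * acon A M x) := by
  have h : ∀ M N, pd M (acon A N) x = (-Complex.I) • pd M (A N) x := fun M N =>
    pd_const_smul M _ (hA N)
  rw [h, h]
  simp only [fs, fieldStrength, acon, smul_mul_assoc, mul_smul_comm, smul_sub, smul_add, smul_smul]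
  have e : -(I / 2) * I = 1 / 2 := by linear_combination (-1 / 2) * I_mul_I
  have e' : 1 / 2 * (-I * -I) = -(1 / 2) := by linear_combination (1 / 2) * I_mul_I
  rw [e, e']
  module


/-! ### The charge of a gauge field is the charge of its asymptotic map -/

namespace InvPoly

variable (P : InvPoly)

theorem cs_contDiffAt {a : Fin 8 → E8 → Mat8} {X : Fin 8 → Fin 8 → E8 → Mat8} {x : E8}
    (ha : ∀ M, MSmoothAt (a M) x) (hX : ∀ M N, MSmoothAt (X M N) x) (m : Fin 7 → Fin 8) :
    ContDiffAt ℝ ∞ (fun y => P.cs (fun M => a M y) (fun M N => X M N y) m) x := by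
  have hs : ∀ M N, MSmoothAt (fun y => sqr (fun M => a M y) M N) x := fun M N => (ha M).mul (ha N)
  exact ((P.contDiffAt (ha _) (hX _ _) (hX _ _) (hX _ _)).sub
    (contDiffAt_const.mul (P.contDiffAt (ha _) (hX _ _) (hX _ _) (hs _ _)))).add
    (contDiffAt_const.mul (P.contDiffAt (ha _) (hX _ _) (hs _ _) (hs _ _))) |>.sub
    (contDiffAt_const.mul (P.contDiffAt (ha _) (hs _ _) (hs _ _) (hs _ _)))

theorem fderiv_cs {a : Fin 8 → E8 → Mat8} {X : Fin 8 → Fin 8 → E8 → Mat8} {x : E8}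
    (ha : ∀ M, MSmoothAt (a M) x) (hX : ∀ M N, MSmoothAt (X M N) x) (m : Fin 7 → Fin 8)
    (K : Fin 8) :
    fderiv ℝ (fun y => P.cs (fun M => a M y) (fun M N => X M N y) m) x
        (EuclideanSpace.single K 1) =
      let a' := fun M => a M x
      let d := fun K M => pd K (a M) x
      let Y := fun M N => X M N x
      let Y' := fun K M N => pd K (X M N) x
      P.dP a' d Y Y' Y Y' Y Y' K m - 3 / 5 * P.dP a' d Y Y' Y Y' (sqr a') (dsqr a' d) K m +
      1 / 5 * P.dP a' d Y Y' (sqr a') (dsqr a' d) (sqr a') (dsqr a' d) K m -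
      1 / 35 * P.dP a' d (sqr a') (dsqr a' d) (sqr a') (dsqr a' d) (sqr a') (dsqr a' d) K m := by
  have hs : ∀ M N, MSmoothAt (fun y => sqr (fun M => a M y) M N) x := fun M N => (ha M).mul (ha N)
  have hs' : ∀ K M N, pd K (fun y => sqr (fun M => a M y) M N) x =
      dsqr (fun M => a M x) (fun K M => pd K (a M) x) K M N := fun K M N =>
    pd_mul K (ha M) (ha N)
  have h1 := (P.contDiffAt (ha (m 0)) (hX (m 1) (m 2)) (hX (m 3) (m 4)) (hX (m 5) (m 6)))
    |>.differentiableAt (by simp)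
  have h2 := (P.contDiffAt (ha (m 0)) (hX (m 1) (m 2)) (hX (m 3) (m 4)) (hs (m 5) (m 6)))
    |>.differentiableAt (by simp)
  have h3 := (P.contDiffAt (ha (m 0)) (hX (m 1) (m 2)) (hs (m 3) (m 4)) (hs (m 5) (m 6)))
    |>.differentiableAt (by simp)
  have h4 := (P.contDiffAt (ha (m 0)) (hs (m 1) (m 2)) (hs (m 3) (m 4)) (hs (m 5) (m 6)))
    |>.differentiableAt (by simp)
  have h := ((h1.hasFDerivAt.sub (h2.hasFDerivAt.const_mul (3 / 5 : ℂ))).add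
    (h3.hasFDerivAt.const_mul (1 / 5 : ℂ))).sub (h4.hasFDerivAt.const_mul (1 / 35 : ℂ))
  refine (congrArg (fun L => L (EuclideanSpace.single K 1)) h.fderiv).trans ?_
  have e1 := P.fderiv_apply (ha (m 0)) (hX (m 1) (m 2)) (hX (m 3) (m 4)) (hX (m 5) (m 6)) K
  have e2 := P.fderiv_apply (ha (m 0)) (hX (m 1) (m 2)) (hX (m 3) (m 4)) (hs (m 5) (m 6)) K
  have e3 := P.fderiv_apply (ha (m 0)) (hX (m 1) (m 2)) (hs (m 3) (m 4)) (hs (m 5) (m 6)) K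
  have e4 := P.fderiv_apply (ha (m 0)) (hs (m 1) (m 2)) (hs (m 3) (m 4)) (hs (m 5) (m 6)) K
  simp only [hs'] at e2 e3 e4
  simp only [_root_.sub_apply, _root_.add_apply, _root_.smul_apply, smul_eq_mul, e1, e2, e3, e4, dP]

theorem continuous_cs (m : Fin 7 → Fin 8) :
    Continuous fun p : (Fin 8 → Mat8) × (Fin 8 → Fin 8 → Mat8) => P.cs p.1 p.2 m := by
  have h : ∀ {f₀ f₁ f₂ f₃ : (Fin 8 → Mat8) × (Fin 8 → Fin 8 → Mat8) → Mat8},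
      Continuous f₀ → Continuous f₁ → Continuous f₂ → Continuous f₃ →
      Continuous fun p => P (f₀ p) (f₁ p) (f₂ p) (f₃ p) := fun h0 h1 h2 h3 =>
    P.cont.comp (h0.prodMk (h1.prodMk (h2.prodMk h3)))
  unfold cs sqr
  refine ((h ?_ ?_ ?_ ?_).sub (continuous_const.mul (h ?_ ?_ ?_ ?_))).add
    (continuous_const.mul (h ?_ ?_ ?_ ?_)) |>.sub (continuous_const.mul (h ?_ ?_ ?_ ?_)) <;>
  fun_prop

/-- Weighted homogeneity of the Chern–Simons form. -/
theorem cs_smul (c : ℂ) (a : Fin 8 → Mat8) (X : Fin 8 → Fin 8 → Mat8) (m : Fin 7 → Fin 8) :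
    P.cs (fun M => c • a M) (fun M N => c ^ 2 • X M N) m = c ^ 7 * P.cs a X m := by
  have : ∀ M N, sqr (fun M => c • a M) M N = c ^ 2 • sqr a M N := fun M N => by
    simp only [sqr, smul_mul_smul_comm, sq]
  simp only [cs, this, P.smul0, P.smul1, P.smul2, P.smul3]
  ring

/-- Where F = 0 only the last term of the Chern–Simons form remains. Its coefficient is the source
of the factor -1/35 between the charges of fields and of maps. -/
theorem cs_zero (a : Fin 8 → Mat8) (m : Fin 7 → Fin 8) :
    P.cs a (fun _ _ => 0) m =
      -(1 / 35) * P (a (m 0)) (sqr a (m 1) (m 2)) (sqr a (m 3) (m 4)) (sqr a (m 5) (m 6)) := by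
  have h : ∀ X Z W, P X 0 Z W = 0 := fun X Z W => by rw [P.swap01, P.zero0]
  simp only [cs, h]
  ring

/-- The components of the Chern–Simons current as functions of connection and field strength. -/
noncomputable def currentFun (M : Fin 8) (p : (Fin 8 → Mat8) × (Fin 8 → Fin 8 → Mat8)) : ℂ :=
  altSum fun m => if m 0 = M then P.cs p.1 p.2 (fun i => m i.succ) else 0

theorem continuous_currentFun (M : Fin 8) : Continuous (P.currentFun M) := by
  unfold currentFun altSum
  refine continuous_finsetSum _ fun σ _ => continuous_const.mul ?_
  dsimp only
  split_ifs
  · exact P.continuous_cs _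
  · exact continuous_const

theorem currentFun_smul (M : Fin 8) (c : ℂ) (a : Fin 8 → Mat8) (X : Fin 8 → Fin 8 → Mat8) :
    P.currentFun M (fun M => c • a M, fun M N => c ^ 2 • X M N) =
      c ^ 7 * P.currentFun M (a, X) := by
  simp only [currentFun, cs_smul, ← altSum_mul_left, mul_ite, mul_zero]

/-- The components of the Chern–Simons current. -/
noncomputable def current (A : Fin 8 → E8 → Mat8) (M : Fin 8) (x : E8) : ℂ :=
  P.currentFun M (fun K => acon A K x, fun K L => fs A K L x)

theorem current_contDiff {A : Fin 8 → E8 → Mat8} (hA : ∀ M x, MSmoothAt (A M) x) (M : Fin 8) :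
    ContDiff ℝ ∞ (P.current A M) := by
  rw [contDiff_iff_contDiffAt]
  intro x
  unfold current currentFun altSum
  refine ContDiffAt.sum fun σ _ => contDiffAt_const.mul ?_
  dsimp only
  split_ifs
  · exact P.cs_contDiffAt (MSmoothAt.acon fun M => hA M x) (MSmoothAt.fs fun M => hA M x) _
  · exact contDiffAt_const

/-- The current is the vector field dual to the Chern–Simons seven-form, so its divergence is the
exterior derivative of that form, which `transgression` computes. -/
theorem div_current {A : Fin 8 → E8 → Mat8} (hA : ∀ M x, MSmoothAt (A M) x)
    (hanti : ∀ M x, (A M x).transpose = -A M x) (x : E8) :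
    ∑ M, fderiv ℝ (P.current A M) x (EuclideanSpace.single M 1) = fieldForm P A x := by
  have ha := MSmoothAt.acon fun M => hA M x
  have hX := MSmoothAt.fs fun M => hA M x
  have h1 : ∀ M, fderiv ℝ (P.current A M) x (EuclideanSpace.single M 1) =
      altSum fun m => if m 0 = M then fderiv ℝ (fun y => P.cs (fun K => acon A K y)
        (fun K L => fs A K L y) (fun i => m i.succ)) x (EuclideanSpace.single M 1) else 0 := by
    intro M
    have h := HasFDerivAt.fun_sum (u := Finset.univ) (A := fun (σ : Equiv.Perm (Fin 8)) (y : E8) =>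
      ((Equiv.Perm.sign σ : ℤ) : ℂ) * if σ 0 = M then
      P.cs (fun K => acon A K y) (fun K L => fs A K L y) (fun i => σ i.succ) else 0)
      (A' := fun σ => ((Equiv.Perm.sign σ : ℤ) : ℂ) • if σ 0 = M then fderiv ℝ (fun y =>
        P.cs (fun K => acon A K y) (fun K L => fs A K L y) (fun i => σ i.succ)) x else 0)
      (x := x) (fun σ _ => ?_)
    · refine (congrArg (fun L => L (EuclideanSpace.single M 1)) h.fderiv).trans ?_
      simp only [_root_.sum_apply, _root_.smul_apply, smul_eq_mul, altSum]
      refine Finset.sum_congr rfl fun σ _ => ?_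
      split_ifs <;> rfl
    · refine HasFDerivAt.const_mul ?_ _
      split_ifs
      · exact ((P.cs_contDiffAt ha hX _).differentiableAt (by simp)).hasFDerivAt
      · exact hasFDerivAt_const _ _
  simp only [h1]
  -- Summing over `M` releases the constraint on the first index, which becomes the index of the
  -- derivative.
  have h2 : ∀ f : Fin 8 → (Fin 8 → Fin 8) → ℂ,
      ∑ M, altSum (fun m => if m 0 = M then f M m else 0) = altSum fun m => f (m 0) m := by
    intro f
    simp only [altSum]
    rw [Finset.sum_comm]
    refine Finset.sum_congr rfl fun σ _ => ?_
    rw [← Finset.mul_sum]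
    simp
  rw [h2]
  simp only [P.fderiv_cs ha hX]
  refine P.transgression (fun M => acon A M x) (fun M => ?_) (fun K M => pd K (acon A M) x)
    (fun K M N => pd K (fun y => pd M (acon A N) y) x) (fun K M N => pd_comm K M (ha N))
    (fun M N => fs A M N x) (fun K M N => pd K (fs A M N) x)
    (fun M N => fs_eq (fun M => hA M x) M N) fun K M N => ?_
  · simp only [acon, Matrix.transpose_smul, hanti, smul_neg]
  · have e : fs A M N = fun y => (1 / 2 : ℂ) • (pd M (acon A N) y - pd N (acon A M) y +
      acon A M y * acon A N y - acon A N y * acon A M y) :=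
      funext fun y => fs_eq (fun M => hA M y) M N
    rw [e, pd_const_smul K _ (((((ha N).pd M).sub ((ha M).pd N)).add ((ha M).mul (ha N))).sub
      ((ha N).mul (ha M))), pd_sub K ((((ha N).pd M).sub ((ha M).pd N)).add ((ha M).mul (ha N)))
      ((ha N).mul (ha M)), pd_add K (((ha N).pd M).sub ((ha M).pd N)) ((ha M).mul (ha N)),
      pd_sub K ((ha N).pd M) ((ha M).pd N), pd_mul K (ha M) (ha N), pd_mul K (ha N) (ha M)]
    simp only [dsqr]

theorem sum_mul_currentFun (z : Fin 8 → ℂ) (p : (Fin 8 → Mat8) × (Fin 8 → Fin 8 → Mat8)) :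
    ∑ M, z M * P.currentFun M p = altSum fun m => z (m 0) * P.cs p.1 p.2 fun i => m i.succ := by
  simp only [currentFun, altSum, Finset.mul_sum]
  rw [Finset.sum_comm]
  refine Finset.sum_congr rfl fun σ _ => ?_
  rw [Finset.sum_eq_single (σ 0) (fun M _ hM => by rw [if_neg hM.symm]; ring)
    (by simp)]
  rw [if_pos rfl]
  ring

/-- A continuous function on a compact set of pairs (connection, field strength). It will be applied
to the rescaled pairs ‖x‖ a(x), ‖x‖² F(x), which stay bounded at infinity. -/
theorem exists_bound_currentFun (B : ℝ) : ∃ C : ℝ, ∀ M (p : (Fin 8 → Mat8) × (Fin 8 → Fin 8 → Mat8)),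
    (∀ K a b, ‖p.1 K a b‖ ≤ B) → (∀ K L a b, ‖p.2 K L a b‖ ≤ B) → ‖P.currentFun M p‖ ≤ C := by
  have hK1 : IsCompact {G : Mat8 | ∀ a b, ‖G a b‖ ≤ B} := by
    have : IsCompact (Set.pi Set.univ fun _ : Fin 8 => Set.pi Set.univ fun _ : Fin 8 =>
        Metric.closedBall (0 : ℂ) B) :=
      isCompact_univ_pi fun _ => isCompact_univ_pi fun _ => isCompact_closedBall _ _
    have e : (Set.pi Set.univ fun _ : Fin 8 => Set.pi Set.univ fun _ : Fin 8 =>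
        Metric.closedBall (0 : ℂ) B) = {G : Fin 8 → Fin 8 → ℂ | ∀ a b, ‖G a b‖ ≤ B} := by
      ext G; simp [Set.mem_pi]
    rw [e] at this
    exact this
  have hK := (isCompact_univ_pi fun _ : Fin 8 => hK1).prod
    (isCompact_univ_pi fun _ : Fin 8 => isCompact_univ_pi fun _ : Fin 8 => hK1)
  choose C hC using fun M => hK.exists_bound_of_continuousOn (P.continuous_currentFun M).continuousOn
  refine ⟨∑ M, |C M|, fun M p h1 h2 => ?_⟩
  refine (hC M p ⟨fun K _ => h1 K, fun K _ L _ => h2 K L⟩).trans ((le_abs_self _).trans ?_)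
  exact Finset.single_le_sum (f := fun M => |C M|) (fun _ _ => abs_nonneg _) (Finset.mem_univ M)

end InvPoly

/-! ### Behaviour of the Chern–Simons current at infinity. -/

theorem IsSphereMapToSO8.exists_mc_bound {g : E8 → Mat8} (hg : IsSphereMapToSO8 g) :
    ∃ B : ℝ, ∀ M a b (x : E8), x ≠ 0 → ‖(‖x‖ : ℂ) * mc g M x a b‖ ≤ B := by
  have h1 : ∀ M a b, ∃ B : ℝ, ∀ x ∈ Metric.sphere (0 : E8) 1, ‖mc g M x a b‖ ≤ B := by
    intro M a b
    refine (isCompact_sphere (0 : E8) 1).exists_bound_of_continuousOn fun x hx => ?_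
    exact ((hg.mc_smoothAt (ne_zero_of_mem_unit_sphere ⟨x, hx⟩) M) a b).continuousAt.continuousWithinAt
  choose B hB using h1
  refine ⟨∑ M, ∑ a, ∑ b, |B M a b|, fun M a b x hx => ?_⟩
  have hn : 0 < ‖x‖ := norm_pos_iff.mpr hx
  -- Homogeneity of degree -1 carries the bound from the compact unit sphere to all x ≠ 0.
  have h2 := hg.mc_smul (c := ‖x‖) (x := ‖x‖⁻¹ • x) (smul_ne_zero (inv_ne_zero hn.ne') hx) hn M
  rw [smul_inv_smul₀ hn.ne'] at h2
  have h3 : (‖x‖ : ℂ) * mc g M x a b = mc g M (‖x‖⁻¹ • x) a b := by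
    rw [← h2]; simp
  rw [h3]
  have hmem : ‖x‖⁻¹ • x ∈ Metric.sphere (0 : E8) 1 := by simp [norm_smul, hn.ne']
  refine (hB M a b _ hmem).trans ((le_abs_self _).trans ?_)
  refine le_trans ?_ (Finset.single_le_sum (f := fun M => ∑ a, ∑ b, |B M a b|)
    (fun _ _ => by positivity) (Finset.mem_univ M))
  refine le_trans ?_ (Finset.single_le_sum (f := fun a => ∑ b, |B M a b|)
    (fun _ _ => by positivity) (Finset.mem_univ a))
  exact Finset.single_le_sum (f := fun b => |B M a b|)
    (fun _ _ => abs_nonneg _) (Finset.mem_univ b)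

theorem InvPoly.flux_mapForm (P : InvPoly) (g : E8 → Mat8) :
    ∫ z : Metric.sphere (0 : E8) 1, ∑ M, (((z : E8) M : ℝ) : ℂ) *
      P.currentFun M (fun K => mc g K z, fun _ _ => 0) ∂(volume : Measure E8).toSphere =
    -(1 / 35) * sphereIntegral (mapForm P g) := by
  rw [sphereIntegral, ← integral_const_mul]
  congr 1
  funext z
  rw [P.sum_mul_currentFun]
  simp only [P.cs_zero, altSum, Finset.mul_sum, mapForm, InvPoly.sqr]
  refine Finset.sum_congr rfl fun σ _ => ?_
  change _ * (_ * (_ * P (mc g (σ 1) z) (mc g (σ 2) z * mc g (σ 3) z)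
    (mc g (σ 4) z * mc g (σ 5) z) (mc g (σ 6) z * mc g (σ 7) z))) = -(1 / 35) * (_ * _ *
      P (mc g (σ 1) z) (mc g (σ 2) z * mc g (σ 3) z)
    (mc g (σ 4) z * mc g (σ 5) z) (mc g (σ 6) z * mc g (σ 7) z))
  ring

/-- R a(R y) tends to θ(y) and R² F(R y) tends to 0. The current has weight 7 if a has weight 1 and
F weight 2, so R⁷ is absorbed in these rescalings and continuity of `currentFun` gives the limit. -/
theorem InvPoly.tendsto_current (P : InvPoly) {A : Fin 8 → E8 → Mat8} {g : E8 → Mat8}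
    (hg : IsSphereMapToSO8 g)
    (hasym : ∀ M a b, Tendsto (fun x : E8 => (‖x‖ : ℂ) * (A M x a b - pureGauge g M x a b))
      (Bornology.cobounded E8) (𝓝 0))
    (hdecay : ∀ M N a b, Tendsto (fun x : E8 => (‖x‖ : ℂ) ^ 2 * fieldStrength A M N x a b)
      (Bornology.cobounded E8) (𝓝 0)) (M : Fin 8) (y : E8) (hy : y ≠ 0) :
    Tendsto (fun R : ℝ => (R : ℂ) ^ 7 * P.current A M (R • y)) atTop
      (𝓝 (P.currentFun M (fun K => mc g K y, fun _ _ => 0))) := by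
  have hny : 0 < ‖y‖ := norm_pos_iff.mpr hy
  have hny' : (‖y‖ : ℂ) ≠ 0 := by exact_mod_cast hny.ne'
  have hcob : Tendsto (fun R : ℝ => R • y) atTop (Bornology.cobounded E8) := by
    rw [← tendsto_norm_atTop_iff_cobounded]
    refine (tendsto_id.atTop_mul_const hny).congr' ?_
    filter_upwards [eventually_ge_atTop 0] with R hR
    rw [norm_smul, Real.norm_eq_abs, abs_of_nonneg hR, id]
  have t1 : ∀ K, Tendsto (fun R : ℝ => (R : ℂ) • acon A K (R • y)) atTop (𝓝 (mc g K y)) := by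
    intro K
    refine tendsto_pi_nhds.mpr fun a => tendsto_pi_nhds.mpr fun b => ?_
    have h := (((hasym K a b).comp hcob).const_mul (-Complex.I * (‖y‖ : ℂ)⁻¹)).add_const (mc g K y a b)
    rw [mul_zero, zero_add] at h
    refine h.congr' ?_
    filter_upwards [eventually_gt_atTop 0] with R hR
    have h2 := congrFun (congrFun (hg.mc_smul hy hR K) a) b
    simp only [Matrix.smul_apply, smul_eq_mul] at h2
    simp only [Function.comp, pureGauge, acon, Matrix.smul_apply, smul_eq_mul, norm_smul,
      Real.norm_eq_abs, abs_of_pos hR, ← h2]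
    push_cast
    field_simp
    linear_combination (R * mc g K (R • y) a b) * Complex.I_sq
  have t2 : ∀ K L, Tendsto (fun R : ℝ => (R : ℂ) ^ 2 • fs A K L (R • y)) atTop (𝓝 0) := by
    intro K L
    refine tendsto_pi_nhds.mpr fun a => tendsto_pi_nhds.mpr fun b => ?_
    rw [Matrix.zero_apply]
    have h := ((hdecay K L a b).comp hcob).const_mul (-(Complex.I / 2) * ((‖y‖ : ℂ) ^ 2)⁻¹)
    rw [mul_zero] at h
    refine h.congr' ?_
    filter_upwards [eventually_gt_atTop 0] with R hR
    simp only [Function.comp, fs, Matrix.smul_apply, smul_eq_mul, norm_smul,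
      Real.norm_eq_abs, abs_of_pos hR]
    push_cast
    field_simp
  have t3 : Tendsto (fun R : ℝ => ((fun K => (R : ℂ) • acon A K (R • y),
      fun K L => (R : ℂ) ^ 2 • fs A K L (R • y)) : (Fin 8 → Mat8) × (Fin 8 → Fin 8 → Mat8))) atTop
      (𝓝 (fun K => mc g K y, fun _ _ => 0)) :=
    (tendsto_pi_nhds.mpr t1).prodMk_nhds
      (tendsto_pi_nhds.mpr fun K => tendsto_pi_nhds.mpr fun L => t2 K L)
  have t4 := (P.continuous_currentFun M).continuousAt.tendsto.comp t3
  exact t4.congr fun R => P.currentFun_smul M R (fun K => acon A K (R • y))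
    fun K L => fs A K L (R • y)

/-- The same rescaling as in `tendsto_current`, by ‖x‖ instead of R. Bounds uniform in the direction
give the domination that `integral_div_eq_flux` asks for. -/
theorem InvPoly.exists_bound_current (P : InvPoly) {A : Fin 8 → E8 → Mat8} {g : E8 → Mat8}
    (hg : IsSphereMapToSO8 g)
    (hasym : ∀ M a b, Tendsto (fun x : E8 => (‖x‖ : ℂ) * (A M x a b - pureGauge g M x a b))
      (Bornology.cobounded E8) (𝓝 0))
    (hdecay : ∀ M N a b, Tendsto (fun x : E8 => (‖x‖ : ℂ) ^ 2 * fieldStrength A M N x a b)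
      (Bornology.cobounded E8) (𝓝 0)) :
    ∃ C R₀ : ℝ, ∀ M x, R₀ ≤ ‖x‖ → ‖x‖ ^ 7 * ‖P.current A M x‖ ≤ C := by
  obtain ⟨B, hB⟩ := hg.exists_mc_bound
  obtain ⟨C, hC⟩ := P.exists_bound_currentFun (|B| + 1)
  have e1 : ∀ᶠ x in Bornology.cobounded E8, ∀ M a b,
      ‖(‖x‖ : ℂ) * (A M x a b - pureGauge g M x a b)‖ ≤ 1 := by
    simp only [eventually_all]
    intro M a b
    have := (hasym M a b).norm
    rw [norm_zero] at this
    exact this.eventually (ge_mem_nhds one_pos)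
  have e2 : ∀ᶠ x in Bornology.cobounded E8, ∀ M N a b,
      ‖(‖x‖ : ℂ) ^ 2 * fieldStrength A M N x a b‖ ≤ 1 := by
    simp only [eventually_all]
    intro M N a b
    have := (hdecay M N a b).norm
    rw [norm_zero] at this
    exact this.eventually (ge_mem_nhds one_pos)
  obtain ⟨R, -, hR⟩ := (hasBasis_cobounded_norm (E := E8)).eventually_iff.mp (e1.and e2)
  refine ⟨C, max R 1, fun M x hx => ?_⟩
  have hx1 : 1 ≤ ‖x‖ := (le_max_right _ _).trans hx
  obtain ⟨f1, f2⟩ := hR (show R ≤ ‖x‖ from (le_max_left _ _).trans hx)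
  have hx0 : x ≠ 0 := norm_pos_iff.mp (by linarith)
  have := hC M (fun K => (‖x‖ : ℂ) • acon A K x, fun K L => (‖x‖ : ℂ) ^ 2 • fs A K L x) ?_ ?_
  · rw [P.currentFun_smul, norm_mul, norm_pow, Complex.norm_real, norm_norm] at this
    exact this
  · intro K a b
    have g1 := f1 K a b
    have g2 := hB K a b x hx0
    simp only [acon, Matrix.smul_apply, smul_eq_mul]
    have : (‖x‖ : ℂ) * (-Complex.I * A K x a b) =
        -Complex.I * ((‖x‖ : ℂ) * (A K x a b - pureGauge g K x a b)) +
          (‖x‖ : ℂ) * mc g K x a b := by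
      simp only [pureGauge, Matrix.smul_apply, smul_eq_mul]
      linear_combination -((‖x‖ : ℂ) * mc g K x a b) * Complex.I_sq
    rw [this]
    refine (norm_add_le _ _).trans ?_
    rw [norm_mul (-Complex.I), norm_neg, Complex.norm_I, one_mul]
    linarith [le_abs_self B]
  · intro K L a b
    have g1 := f2 K L a b
    simp only [fs, Matrix.smul_apply, smul_eq_mul]
    have : (‖x‖ : ℂ) ^ 2 * (-(Complex.I / 2) * fieldStrength A K L x a b) =
      -(Complex.I / 2) * ((‖x‖ : ℂ) ^ 2 * fieldStrength A K L x a b) := by ring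
    rw [this, norm_mul, norm_neg, norm_div, Complex.norm_I]
    simp only [Complex.norm_ofNat]
    linarith [abs_nonneg B]

/-- The charge of a gauge field which approaches `i g⁻¹ dg` is the charge of `g`. -/
theorem integral_fieldForm (P : InvPoly) {A : Fin 8 → E8 → Mat8} {g : E8 → Mat8}
    (hA : ∀ M x, MSmoothAt (A M) x) (hanti : ∀ M x, (A M x).transpose = -A M x)
    (hg : IsSphereMapToSO8 g)
    (hasym : ∀ M a b, Tendsto (fun x : E8 => (‖x‖ : ℂ) * (A M x a b - pureGauge g M x a b))
      (Bornology.cobounded E8) (𝓝 0))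
    (hdecay : ∀ M N a b, Tendsto (fun x : E8 => (‖x‖ : ℂ) ^ 2 * fieldStrength A M N x a b)
      (Bornology.cobounded E8) (𝓝 0))
    (hint : Integrable (fieldForm P A)) :
    ∫ x, fieldForm P A x = -(1 / 35) * sphereIntegral (mapForm P g) := by
  have hfun : fieldForm P A = fun x => ∑ M, fderiv ℝ (P.current A M) x (EuclideanSpace.single M 1) :=
    funext fun x => (P.div_current hA hanti x).symm
  rw [hfun] at hint ⊢
  rw [integral_div_eq_flux (P.current A)
    (fun M y => P.currentFun M (fun K => mc g K y, fun _ _ => 0))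
    (fun M => (P.current_contDiff hA M).of_le (by simp)) hint
    (P.tendsto_current hg hasym hdecay) (P.exists_bound_current hg hasym hdecay)]
  exact P.flux_mapForm g


/-! ### Gauge transformations -/

theorem fieldStrength_congr {A B : Fin 8 → E8 → Mat8} {x : E8} (h : ∀ M, A M =ᶠ[𝓝 x] B M)
    (M N : Fin 8) : fieldStrength A M N x = fieldStrength B M N x := by
  simp only [fieldStrength, pd_congr _ (h _), (h _).eq_of_nhds]

theorem fieldForm_congr (P : InvPoly) {A B : Fin 8 → E8 → Mat8} {x : E8}
    (h : ∀ M, A M =ᶠ[𝓝 x] B M) : fieldForm P A x = fieldForm P B x := by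
  simp only [fieldForm, fs, fieldStrength_congr h]

theorem fieldForm_eq_zero (P : InvPoly) {A : Fin 8 → E8 → Mat8} {x : E8}
    (h : ∀ M N, fieldStrength A M N x = 0) : fieldForm P A x = 0 := by
  simp only [fieldForm, fs, h, smul_zero, InvPoly.wedge, P.zero0, altSum, mul_zero,
    Finset.sum_const_zero]

theorem fieldStrength_zero {A : Fin 8 → E8 → Mat8} {x : E8} (h : ∀ M, A M =ᶠ[𝓝 x] fun _ => 0)
    (M N : Fin 8) : fieldStrength A M N x = 0 := by
  simp only [fieldStrength, pd_congr _ (h _), (h _).eq_of_nhds, pd_const]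
  simp

/-- The field strength transforms covariantly under a gauge transformation. -/
theorem fs_gauge {A B : Fin 8 → E8 → Mat8} {h : E8 → Mat8} {x : E8}
    (hA : ∀ M, MSmoothAt (A M) x) (hB : ∀ M, MSmoothAt (B M) x) (hh : MSmoothAt h x)
    (hrel : ∀ M, (fun y => h y * acon A M y) =ᶠ[𝓝 x] fun y => acon B M y * h y + pd M h y)
    (M N : Fin 8) : h x * fs A M N x = fs B M N x * h x := by
  have ha := MSmoothAt.acon hA
  have hb := MSmoothAt.acon hB
  have r0 : ∀ M, h x * acon A M x = acon B M x * h x + pd M h x := fun M => (hrel M).eq_of_nhds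
  -- `hrel` is the gauge transformation a = h⁻¹bh + h⁻¹dh multiplied by h, which keeps inverses out
  -- of the derivatives; here it is differentiated once. In the field strength the second
  -- derivatives of h cancel by symmetry.
  have r1 : ∀ M N, h x * pd N (acon A M) x = pd N (acon B M) x * h x + acon B M x * pd N h x +
      pd N (fun y => pd M h y) x - pd N h x * acon A M x := by
    intro M N
    have := pd_congr N (hrel M)
    rw [pd_mul N hh (ha M), pd_add N ((hb M).mul hh) (hh.pd M), pd_mul N (hb M) hh] at this
    rw [eq_sub_iff_add_eq, add_comm, this]
  have r2 : ∀ M N, h x * (acon A M x * acon A N x) =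
      acon B M x * (acon B N x * h x + pd N h x) + pd M h x * acon A N x := by
    intro M N
    rw [← mul_assoc, r0, add_mul, mul_assoc, r0]
  rw [fs_eq hA, fs_eq hB, mul_smul_comm, smul_mul_assoc]
  congr 1
  rw [mul_sub, mul_add, mul_sub, r1, r1, r2, r2, pd_comm N M hh]
  noncomm_ring

/-- All four field strengths are conjugated by the same element of SO(8), on which `χ` is 1. The
factor `χ` is therefore seen only by conjugations with determinant -1. -/
theorem fieldForm_gauge (P : InvPoly) {A B : Fin 8 → E8 → Mat8} {h : E8 → Mat8} {x : E8}
    (hA : ∀ M, MSmoothAt (A M) x) (hB : ∀ M, MSmoothAt (B M) x) (hh : MSmoothAt h x)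
    (hSO : IsSO (h x))
    (hrel : ∀ M, (fun y => h y * acon A M y) =ᶠ[𝓝 x] fun y => acon B M y * h y + pd M h y) :
    fieldForm P A x = fieldForm P B x := by
  have e : ∀ M N, fs A M N x =
      (h x).transpose * fs B M N x * (h x).transpose.transpose := fun M N => by
    rw [Matrix.transpose_transpose, mul_assoc, ← fs_gauge hA hB hh hrel, ← mul_assoc,
      hSO.transpose_mul, one_mul]
  simp only [fieldForm, InvPoly.wedge, e]
  refine altSum_congr fun σ => ?_
  rw [P.conj' _ _ _ _ _ (by rw [Matrix.transpose_transpose, hSO.transpose_mul]),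
    P.χ_one _ (by rw [Matrix.det_transpose, hSO.2.1]), one_mul]

/-- A pure gauge is the gauge transform of the zero field. -/
theorem fieldStrength_eq_zero_of_gauge {A : Fin 8 → E8 → Mat8} {h : E8 → Mat8} {x : E8}
    (hA : ∀ M, MSmoothAt (A M) x) (hh : MSmoothAt h x) (hSO : IsSO (h x))
    (hrel : ∀ M, (fun y => h y * acon A M y) =ᶠ[𝓝 x] fun y => pd M h y) (M N : Fin 8) :
    fieldStrength A M N x = 0 := by
  have h1 := fs_gauge (B := fun _ _ => 0) hA (fun _ => MSmoothAt.const 0) hh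
    (fun M => (hrel M).trans (Eventually.of_forall fun y => by simp [acon])) M N
  have h2 : fs (fun _ _ => 0) M N x = 0 := by
    simp only [fs, fieldStrength_zero (fun _ => EventuallyEq.rfl), smul_zero]
  rw [h2, zero_mul] at h1
  have h3 : fs A M N x = 0 := by
    rw [← one_mul (fs A M N x), ← hSO.transpose_mul, mul_assoc, h1, mul_zero]
  rw [fs, smul_eq_zero] at h3
  exact h3.resolve_left (by simp)

theorem acon_pureGauge (g : E8 → Mat8) (M : Fin 8) (x : E8) :
    acon (pureGauge g) M x = mc g M x := by
  simp [acon, pureGauge, smul_smul]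

/-! ### Cut-off pure gauge fields -/

/-- A radial cutoff, vanishing near the origin and equal to `1` far away. -/
structure IsCut (φ : E8 → ℂ) : Prop where
  smooth : ContDiff ℝ ∞ φ
  im : ∀ x, (φ x).im = 0
  zero : ∀ x, ‖x‖ < 1 → φ x = 0
  one : ∀ x, 3 ≤ ‖x‖ → φ x = 1

/-- This cutoff rises in the shell 1 ≤ ‖x‖ ≤ √2, and the one of `isCut_outer` in 2 ≤ ‖x‖ ≤ 2√2. The
shells are disjoint, as the proof of `mapCharge_mul` requires, and both lie in ‖x‖ < 3. -/
theorem isCut_inner : IsCut fun x => 1 - cutoff x where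
  smooth := contDiff_const.sub cutoff_contDiff
  im x := by simp [cutoff]
  zero x hx := by
    rw [cutoff, step_eq_one (by nlinarith [norm_nonneg x])]; simp
  one x hx := by
    rw [cutoff, step_eq_zero (by nlinarith [norm_nonneg x])]; simp

theorem isCut_outer : IsCut fun x => 1 - cutoff ((2 : ℝ)⁻¹ • x) where
  smooth := contDiff_const.sub (cutoff_contDiff.comp (contDiff_const_smul _))
  im x := by simp [cutoff]
  zero x hx := by
    rw [cutoff, step_eq_one]; · simp
    rw [norm_smul, mul_pow]; norm_num; nlinarith [norm_nonneg x]
  one x hx := by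
    rw [cutoff, step_eq_zero]; · simp
    rw [norm_smul, mul_pow]; norm_num; nlinarith [norm_nonneg x]

/-- The pure gauge field `i g⁻¹ dg`, cut off by `φ`. -/
noncomputable def cutField (φ : E8 → ℂ) (g : E8 → Mat8) (M : Fin 8) (x : E8) : Mat8 :=
  φ x • pureGauge g M x

theorem eventually_norm_lt {x : E8} {r : ℝ} (hx : ‖x‖ < r) : ∀ᶠ y in 𝓝 x, ‖y‖ < r :=
  continuous_norm.continuousAt.eventually (gt_mem_nhds hx)

theorem eventually_lt_norm {x : E8} {r : ℝ} (hx : r < ‖x‖) : ∀ᶠ y in 𝓝 x, r < ‖y‖ :=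
  continuous_norm.continuousAt.eventually (lt_mem_nhds hx)

theorem cutField_smoothAt {φ : E8 → ℂ} (hφ : IsCut φ) {g : E8 → Mat8}
    (hg : IsSphereMapToSO8 g) (M : Fin 8) (x : E8) : MSmoothAt (cutField φ g M) x := by
  by_cases hx : x = 0
  · refine (MSmoothAt.const 0).congr ?_
    filter_upwards [eventually_norm_lt (x := x) (r := 1) (by simp [hx])] with y hy
    rw [cutField, hφ.zero y hy, zero_smul]
  · exact MSmoothAt.smul hφ.smooth.contDiffAt ((hg.mc_smoothAt hx M).const_smul _)

theorem cutField_transpose {φ : E8 → ℂ} (hφ : IsCut φ) {g : E8 → Mat8}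
    (hg : IsSphereMapToSO8 g) (M : Fin 8) (x : E8) :
    (cutField φ g M x).transpose = -cutField φ g M x := by
  by_cases hx : x = 0
  · rw [cutField, hφ.zero x (by simp [hx])]; simp
  · rw [cutField, pureGauge, Matrix.transpose_smul, Matrix.transpose_smul, hg.mc_transpose hx]
    simp

theorem cutField_re {φ : E8 → ℂ} (hφ : IsCut φ) {g : E8 → Mat8}
    (hg : IsSphereMapToSO8 g) (M : Fin 8) (x : E8) (a b : Fin 8) : (cutField φ g M x a b).re = 0 := by
  by_cases hx : x = 0
  · rw [cutField, hφ.zero x (by simp [hx])]; simp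
  · simp [cutField, pureGauge, hφ.im, hg.mc_im hx]

theorem cutField_eq {φ : E8 → ℂ} (hφ : IsCut φ) (g : E8 → Mat8)
    {x : E8} (hx : 3 ≤ ‖x‖) (M : Fin 8) :
    cutField φ g M x = pureGauge g M x := by
  rw [cutField, hφ.one x hx, one_smul]

/-- A cut-off pure gauge field is flat where the cutoff is locally `1`. -/
theorem fieldStrength_cutField {φ : E8 → ℂ} (hφ : IsCut φ) {g : E8 → Mat8}
    (hg : IsSphereMapToSO8 g) {x : E8} (hx : x ≠ 0) (h1 : ∀ᶠ y in 𝓝 x, φ y = 1) (M N : Fin 8) :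
    fieldStrength (cutField φ g) M N x = 0 := by
  refine fieldStrength_eq_zero_of_gauge (fun M => cutField_smoothAt hφ hg M x) (hg.smoothAt hx)
    (hg.isSO hx) (fun M => ?_) M N
  filter_upwards [h1, IsSphereMapToSO8.eventually_ne hx] with y hy hy0
  rw [acon, cutField, hy, one_smul]
  exact (congrArg (g y * ·) (acon_pureGauge g M y)).trans (hg.mul_mc hy0 M)

theorem eventually_cut_eq_one {φ : E8 → ℂ} (hφ : IsCut φ) {x : E8} (hx : 3 < ‖x‖) :
    ∀ᶠ y in 𝓝 x, φ y = 1 :=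
  (eventually_lt_norm hx).mono fun y hy => hφ.one y hy.le

theorem fieldForm_continuous (P : InvPoly) {A : Fin 8 → E8 → Mat8}
    (hA : ∀ M x, MSmoothAt (A M) x) : Continuous (fieldForm P A) := by
  refine continuous_iff_continuousAt.mpr fun x => ?_
  have hX := MSmoothAt.fs fun M => hA M x
  unfold fieldForm InvPoly.wedge altSum
  exact tendsto_finsetSum _ fun σ _ =>
    ((P.contDiffAt (hX _ _) (hX _ _) (hX _ _) (hX _ _)).continuousAt).const_mul _

theorem integrable_of_flat {f : E8 → ℂ} (hf : Continuous f)
    (hflat : ∀ x, 3 < ‖x‖ → f x = 0) : Integrable f := by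
  refine hf.integrable_of_hasCompactSupport (hasCompactSupport_of_norm_sq (c := 16) fun x hx => ?_)
  exact hflat x (by nlinarith [norm_nonneg x])

theorem tendsto_cobounded_of_eq_zero {f : E8 → ℂ} (h : ∀ x, 3 < ‖x‖ → f x = 0) :
    Tendsto f (Bornology.cobounded E8) (𝓝 0) := by
  refine tendsto_const_nhds.congr' ?_
  filter_upwards [tendsto_norm_cobounded_atTop.eventually_gt_atTop 3] with x hx
  rw [h x hx]

/-- The charge of a map for the invariant polynomial `P`, up to normalization. -/
noncomputable def mapCharge (P : InvPoly) (g : E8 → Mat8) : ℂ := sphereIntegral (mapForm P g)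

/-- `integral_fieldForm` for fields which are flat and equal to the pure gauge far away. -/
theorem integral_fieldForm_of_flat (P : InvPoly) {A : Fin 8 → E8 → Mat8} {g : E8 → Mat8}
    (hA : ∀ M x, MSmoothAt (A M) x) (hanti : ∀ M x, (A M x).transpose = -A M x)
    (hg : IsSphereMapToSO8 g) (hpg : ∀ M x, 3 < ‖x‖ → A M x = pureGauge g M x)
    (hflat : ∀ M N x, 3 < ‖x‖ → fieldStrength A M N x = 0) :
    ∫ x, fieldForm P A x = -(1 / 35) * mapCharge P g :=
  integral_fieldForm P hA hanti hg
    (fun M a b => tendsto_cobounded_of_eq_zero fun x hx => by rw [hpg M x hx, sub_self, mul_zero])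
    (fun M N a b => tendsto_cobounded_of_eq_zero fun x hx => by
      rw [hflat M N x hx, Matrix.zero_apply, mul_zero])
    (integrable_of_flat (fieldForm_continuous P hA) fun x hx =>
      fieldForm_eq_zero P fun M N => hflat M N x hx)

theorem integral_cutField (P : InvPoly) {φ : E8 → ℂ} (hφ : IsCut φ) {g : E8 → Mat8}
    (hg : IsSphereMapToSO8 g) :
    ∫ x, fieldForm P (cutField φ g) x = -(1 / 35) * mapCharge P g :=
  integral_fieldForm_of_flat P (cutField_smoothAt hφ hg) (cutField_transpose hφ hg) hg
    (fun M _ hx => cutField_eq hφ g hx.le M) fun M N x hx =>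
      fieldStrength_cutField hφ hg (norm_pos_iff.mp (by linarith)) (eventually_cut_eq_one hφ hx) M N

theorem integrable_cutField (P : InvPoly) {φ : E8 → ℂ} (hφ : IsCut φ) {g : E8 → Mat8}
    (hg : IsSphereMapToSO8 g) : Integrable (fieldForm P (cutField φ g)) :=
  integrable_of_flat (fieldForm_continuous P (cutField_smoothAt hφ hg)) fun x hx =>
    fieldForm_eq_zero P fun M N => fieldStrength_cutField hφ hg (norm_pos_iff.mp (by linarith))
      (eventually_cut_eq_one hφ hx) M N

theorem mc_mul {g h : E8 → Mat8} (hg : IsSphereMapToSO8 g) (hh : IsSphereMapToSO8 h) {x : E8}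
    (hx : x ≠ 0) (M : Fin 8) :
    mc (fun y => g y * h y) M x = (h x)⁻¹ * mc g M x * h x + mc h M x := by
  have e : (g x)⁻¹ * g x = 1 := Matrix.nonsing_inv_mul _ (hg.isSO hx).isUnit
  simp only [mc]
  rw [pd_mul M (hg.smoothAt hx) (hh.smoothAt hx), Matrix.mul_inv_rev, mul_add]
  calc _ = (h x)⁻¹ * ((g x)⁻¹ * pd M g x) * h x + (h x)⁻¹ * ((g x)⁻¹ * g x) * pd M h x := by
        noncomm_ring
    _ = _ := by rw [e, mul_one]

/-- The charges of maps are additive. -/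
theorem mapCharge_mul (P : InvPoly) {g h : E8 → Mat8} (hg : IsSphereMapToSO8 g)
    (hh : IsSphereMapToSO8 h) :
    mapCharge P (fun x => g x * h x) = mapCharge P g + mapCharge P h := by
  set χ : E8 → ℂ := fun x => 1 - cutoff x with hχ
  set ψ : E8 → ℂ := fun x => 1 - cutoff ((2 : ℝ)⁻¹ • x) with hψ
  have cχ : IsCut χ := isCut_inner
  have cψ : IsCut ψ := isCut_outer
  -- For ‖x‖ < 2 this is the cut-off pure gauge of `h`. For ‖x‖ ≥ 2 one has χ = 1, and it is the
  -- gauge transform by `h` of the cut-off pure gauge of `g`.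
  set A : Fin 8 → E8 → Mat8 := fun M x =>
    cutField χ h M x + (h x)⁻¹ * cutField ψ g M x * h x with hAdef
  have hψ0 : ∀ {x : E8}, ‖x‖ < 2 → ∀ᶠ y in 𝓝 x, ψ y = 0 := fun hx =>
    (eventually_norm_lt hx).mono fun y hy => by
      rw [hψ]; simp only [cutoff]; rw [step_eq_one]; · simp
      rw [norm_smul, mul_pow]; norm_num; nlinarith [norm_nonneg y]
  -- Any radius strictly between √2 and 2 serves in place of 3/2: χ must be 1 in a neighbourhood of
  -- the whole region ‖x‖ ≥ 2.
  have hχ1 : ∀ {x : E8}, 2 ≤ ‖x‖ → ∀ᶠ y in 𝓝 x, χ y = 1 := fun {x} hx =>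
    (eventually_lt_norm (x := x) (r := 3 / 2) (by linarith)).mono fun y hy => by
      rw [hχ]; simp only [cutoff]; rw [step_eq_zero (by nlinarith [norm_nonneg y])]; simp
  have hA0 : ∀ {x : E8}, ‖x‖ < 2 → ∀ M, A M =ᶠ[𝓝 x] cutField χ h M := fun hx M =>
    (hψ0 hx).mono fun y hy => by simp [hAdef, cutField, hy]
  have hne : ∀ {x : E8}, 2 ≤ ‖x‖ → x ≠ 0 := fun hx => norm_pos_iff.mp (by linarith)
  have hA : ∀ M x, MSmoothAt (A M) x := by
    intro M x
    by_cases hx : ‖x‖ < 2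
    · exact (cutField_smoothAt cχ hh M x).congr (hA0 hx M)
    · push Not at hx
      exact (cutField_smoothAt cχ hh M x).add (((hh.inv_smoothAt (hne hx)).mul
        (cutField_smoothAt cψ hg M x)).mul (hh.smoothAt (hne hx)))
  have hanti : ∀ M x, (A M x).transpose = -A M x := by
    intro M x
    by_cases hx : ‖x‖ < 2
    · rw [(hA0 hx M).eq_of_nhds, cutField_transpose cχ hh]
    · push Not at hx
      simp only [hAdef]
      rw [Matrix.transpose_add, cutField_transpose cχ hh, (hh.isSO (hne hx)).inv_eq,
        Matrix.transpose_mul, Matrix.transpose_mul, Matrix.transpose_transpose,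
        cutField_transpose cψ hg]
      noncomm_ring
  have hrel : ∀ x, 2 ≤ ‖x‖ → ∀ M, (fun y => h y * acon A M y) =ᶠ[𝓝 x]
      fun y => acon (cutField ψ g) M y * h y + pd M h y := by
    intro x hx M
    filter_upwards [hχ1 hx, IsSphereMapToSO8.eventually_ne (hne hx)] with y hy hy0
    have e1 : h y * (h y)⁻¹ = 1 := Matrix.mul_nonsing_inv _ (hh.isSO hy0).isUnit
    have e2 : acon A M y = mc h M y + (h y)⁻¹ * acon (cutField ψ g) M y * h y := by
      rw [← acon_pureGauge]
      simp only [acon, hAdef, cutField, hy, one_smul, smul_add, mul_smul_comm, smul_mul_assoc]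
    rw [e2, mul_add, hh.mul_mc hy0, ← mul_assoc, ← mul_assoc, e1, one_mul, add_comm]
  -- The densities add because their supports are separated: at every point at least one of the two
  -- cut-off fields is flat, and the density of `A` equals that of the other, by equality inside and
  -- by gauge invariance outside.
  have hform : ∀ x, fieldForm P A x =
      fieldForm P (cutField χ h) x + fieldForm P (cutField ψ g) x := by
    intro x
    by_cases hx : ‖x‖ < 2
    · rw [fieldForm_congr P (hA0 hx), fieldForm_eq_zero P (A := cutField ψ g), add_zero]
      exact fieldStrength_zero fun M => (hψ0 hx).mono fun y hy => by simp [cutField, hy]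
    · push Not at hx
      rw [fieldForm_eq_zero P (A := cutField χ h)
        (fieldStrength_cutField cχ hh (hne hx) (hχ1 hx)), zero_add]
      exact fieldForm_gauge P (fun M => hA M x) (fun M => cutField_smoothAt cψ hg M x)
        (hh.smoothAt (hne hx)) (hh.isSO (hne hx)) (hrel x hx)
  have hgh : ∀ M x, 3 < ‖x‖ → A M x = pureGauge (fun x => g x * h x) M x := by
    intro M x hx
    have hx0 : x ≠ 0 := norm_pos_iff.mp (by linarith)
    simp only [hAdef]
    rw [cutField_eq cχ h hx.le, cutField_eq cψ g hx.le, pureGauge, pureGauge, pureGauge,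
      mc_mul hg hh hx0, smul_add, mul_smul_comm, smul_mul_assoc, add_comm]
  have hflat : ∀ M N x, 3 < ‖x‖ → fieldStrength A M N x = 0 := by
    intro M N x hx
    have hx0 : x ≠ 0 := norm_pos_iff.mp (by linarith)
    refine fieldStrength_eq_zero_of_gauge (h := fun x => g x * h x) (fun M => hA M x)
      ((hg.mul hh).smoothAt hx0) ((hg.mul hh).isSO hx0) (fun M => ?_) M N
    filter_upwards [eventually_lt_norm hx, IsSphereMapToSO8.eventually_ne hx0] with y hy hy0
    rw [acon, hgh M y hy]
    exact (congrArg (g y * h y * ·) (acon_pureGauge _ M y)).trans ((hg.mul hh).mul_mc hy0 M)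
  have key := integral_fieldForm_of_flat P hA hanti (hg.mul hh) hgh hflat
  simp only [hform] at key
  rw [integral_add (integrable_cutField P cχ hh) (integrable_cutField P cψ hg),
    integral_cutField P cχ hh, integral_cutField P cψ hg] at key
  linear_combination 35 * key

theorem mapCharge_one (P : InvPoly) : mapCharge P (fun _ => 1) = 0 := by
  have := mapCharge_mul P IsSphereMapToSO8.one IsSphereMapToSO8.one
  simp only [mul_one] at this
  linear_combination -this

theorem mapCharge_congr (P : InvPoly) {g h : E8 → Mat8} (hgh : ∀ x, x ≠ 0 → g x = h x) :
    mapCharge P g = mapCharge P h := by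
  unfold mapCharge sphereIntegral
  congr 1
  funext z
  have hz : (z : E8) ≠ 0 := ne_zero_of_mem_unit_sphere z
  have e : ∀ M, mc g M z = mc h M z := fun M => by
    rw [mc, mc, hgh z hz, pd_congr M ((IsSphereMapToSO8.eventually_ne hz).mono hgh)]
  simp only [mapForm, e]

theorem mapCharge_inv (P : InvPoly) {g : E8 → Mat8} (hg : IsSphereMapToSO8 g) :
    mapCharge P (fun x => (g x)⁻¹) = -mapCharge P g := by
  have h1 := mapCharge_mul P hg hg.inv
  rw [mapCharge_congr P (h := fun _ => 1)
    (fun x hx => Matrix.mul_nonsing_inv _ (hg.isSO hx).isUnit), mapCharge_one] at h1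
  linear_combination -h1

/-- Conjugation by a constant orthogonal matrix. -/
theorem mapCharge_conj (P : InvPoly) {g : E8 → Mat8} (hg : IsSphereMapToSO8 g) {O : Mat8}
    (hO : O * O.transpose = 1) :
    mapCharge P (fun x => O * g x * O.transpose) = P.χ O * mapCharge P g := by
  have hO' : O.transpose * O = 1 := mul_eq_one_comm.mp hO
  have e : ∀ x, x ≠ 0 → ∀ M, mc (fun x => O * g x * O.transpose) M x =
      O * mc g M x * O.transpose := by
    intro x hx M
    have s := hg.smoothAt hx
    have e1 : pd M (fun x => O * g x * O.transpose) x = O * pd M g x * O.transpose := by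
      rw [pd_mul M ((MSmoothAt.const O).mul s) (MSmoothAt.const _), pd_mul M (MSmoothAt.const O) s,
        pd_const, pd_const]
      simp
    have e2 : (O * g x * O.transpose)⁻¹ = O * (g x)⁻¹ * O.transpose := by
      refine Matrix.inv_eq_right_inv ?_
      calc _ = O * (g x * (O.transpose * O) * (g x)⁻¹) * O.transpose := by noncomm_ring
        _ = 1 := by rw [hO', mul_one, Matrix.mul_nonsing_inv _ (hg.isSO hx).isUnit, mul_one, hO]
    simp only [mc]
    rw [e1, e2]
    calc _ = O * ((g x)⁻¹ * (O.transpose * O) * pd M g x) * O.transpose := by noncomm_ring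
      _ = _ := by rw [hO', mul_one]
  have em : ∀ U V : Mat8, O * U * O.transpose * (O * V * O.transpose) =
      O * (U * V) * O.transpose := fun U V => by
    calc _ = O * U * (O.transpose * O) * V * O.transpose := by noncomm_ring
      _ = _ := by rw [hO']; noncomm_ring
  unfold mapCharge sphereIntegral
  rw [← integral_const_mul]
  congr 1
  funext z
  rw [Finset.mul_sum]
  refine Finset.sum_congr rfl fun σ _ => ?_
  simp only [mapForm, e z (ne_zero_of_mem_unit_sphere z), em, P.conj' O _ _ _ _ hO]
  ring


/-! ### The two charges in terms of invariant polynomials -/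

/-- The symmetrization in `tracePoly` is invisible here: the six orderings permute three equal
two-forms `V`, which is an even permutation of the eight indices. -/
theorem altSum_tracePoly (U V : Fin 8 → Fin 8 → Mat8) :
    altSum (fun m => tracePoly (U (m 0) (m 1)) (V (m 2) (m 3)) (V (m 4) (m 5)) (V (m 6) (m 7))) =
      altSum fun m => (U (m 0) (m 1) * V (m 2) (m 3) * V (m 4) (m 5) * V (m 6) (m 7)).trace := by
  set w : (Fin 8 → Fin 8) → ℂ := fun m =>
    (U (m 0) (m 1) * V (m 2) (m 3) * V (m 4) (m 5) * V (m 6) (m 7)).trace with hw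
  have h : ∀ ρ : Equiv.Perm (Fin 8), Equiv.Perm.sign ρ = 1 →
      altSum (fun m => w (m ∘ ρ)) = altSum w := fun ρ hρ => by rw [altSum_comp, hρ]; simp
  have h1 := h (Equiv.swap 4 6 * Equiv.swap 5 7) (by decide)
  have h2 := h (Equiv.swap 2 4 * Equiv.swap 3 5) (by decide)
  have h3 := h (Equiv.swap 2 4 * Equiv.swap 3 5 * (Equiv.swap 4 6 * Equiv.swap 5 7)) (by decide)
  have h4 := h (Equiv.swap 4 6 * Equiv.swap 5 7 * (Equiv.swap 2 4 * Equiv.swap 3 5)) (by decide)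
  have h5 := h (Equiv.swap 2 6 * Equiv.swap 3 7) (by decide)
  have e : altSum (fun m => tracePoly (U (m 0) (m 1)) (V (m 2) (m 3)) (V (m 4) (m 5))
      (V (m 6) (m 7))) = altSum (fun m => (1 / 6 : ℂ) * (w m +
        w (m ∘ (Equiv.swap 4 6 * Equiv.swap 5 7 : Equiv.Perm (Fin 8))) +
        w (m ∘ (Equiv.swap 2 4 * Equiv.swap 3 5 : Equiv.Perm (Fin 8))) +
        w (m ∘ (Equiv.swap 2 4 * Equiv.swap 3 5 * (Equiv.swap 4 6 * Equiv.swap 5 7) :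
          Equiv.Perm (Fin 8))) +
        w (m ∘ (Equiv.swap 4 6 * Equiv.swap 5 7 * (Equiv.swap 2 4 * Equiv.swap 3 5) :
          Equiv.Perm (Fin 8))) +
        w (m ∘ (Equiv.swap 2 6 * Equiv.swap 3 7 : Equiv.Perm (Fin 8))))) := by
    refine altSum_congr fun σ => ?_
    simp only [tracePoly, hw]
    congr 1
  rw [e, altSum_mul_left, altSum_add, altSum_add, altSum_add, altSum_add, altSum_add, h1, h2, h3,
    h4, h5]
  ring

theorem sphereIntegral_eq (w : (Fin 7 → Fin 8) → E8 → ℂ) : sphereIntegral w =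
    ∫ z : Metric.sphere (0 : E8) 1, altSum (fun m => (((z : E8) (m 0) : ℝ) : ℂ) *
      w (fun i => m i.succ) z) ∂(volume : Measure E8).toSphere := by
  simp only [sphereIntegral, altSum, mul_assoc]

theorem chargeQ_eq (g : E8 → Mat8) :
    chargeQ g = -(1 / (2 ^ 7 * 3 * 35 * (Real.pi : ℂ) ^ 4)) * mapCharge tracePoly g := by
  rw [chargeQ, mapCharge, sphereIntegral_eq, sphereIntegral_eq]
  congr 2
  funext z
  -- The normal coordinate is absorbed in the first two-tensor, so that all eight indices occur in
  -- pairs.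
  have := altSum_tracePoly (fun K M => (((z : E8) K : ℝ) : ℂ) • mc g M z)
    (fun M N => mc g M z * mc g N z)
  simp only [tracePoly.smul0, smul_mul_assoc, Matrix.trace_smul, smul_eq_mul] at this
  refine Eq.trans ?_ this.symm
  refine altSum_congr fun σ => ?_
  simp only [mul_assoc]
  rfl

/-- (-i/2)⁴ = 1/16 is the factor in `densityQ` and `densityQt` that comes from F = ½ F_{MN} dx_M ∧
dx_N. -/
theorem smul_I_four (P : InvPoly) (X Y Z W : Mat8) :
    P ((-(Complex.I / 2)) • X) ((-(Complex.I / 2)) • Y) ((-(Complex.I / 2)) • Z)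
      ((-(Complex.I / 2)) • W) = (1 / 16) * P X Y Z W := by
  rw [P.smul0, P.smul1, P.smul2, P.smul3]
  have : Complex.I ^ 4 = 1 := Complex.I_pow_four
  linear_combination (P X Y Z W / 16) * this

theorem densityQ_eq (A : Fin 8 → E8 → Mat8) : densityQ A = fieldForm tracePoly A := by
  funext x
  simp only [fieldForm, InvPoly.wedge, fs, smul_I_four]
  rw [altSum_mul_left]
  rw [altSum_tracePoly (fun M N => fieldStrength A M N x) fun M N => fieldStrength A M N x]
  simp only [densityQ, altSum]

theorem densityQt_eq (A : Fin 8 → E8 → Mat8) : densityQt A = fieldForm pfInvPoly A := by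
  funext x
  simp only [fieldForm, InvPoly.wedge, fs, smul_I_four]
  rw [altSum_mul_left, densityQt]
  congr 1
  rw [Finset.sum_comm]
  refine Finset.sum_congr rfl fun σ _ => ?_
  simp only [pfInvPoly, pfPoly, altSum, Finset.mul_sum]
  refine Finset.sum_congr rfl fun τ _ => ?_
  ring

theorem sphereIntegral_sum {ι : Type*} [Fintype ι] (c : ι → ℂ)
    (w : ι → (Fin 7 → Fin 8) → E8 → ℂ)
    (hw : ∀ i M, Continuous fun z : Metric.sphere (0 : E8) 1 => w i M z) :
    ∑ i, c i * sphereIntegral (w i) = sphereIntegral fun M x => ∑ i, c i * w i M x := by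
  have hz : ∀ M, Continuous fun z : Metric.sphere (0 : E8) 1 => (((z : E8) M : ℝ) : ℂ) := by
    intro M; fun_prop
  have hint : ∀ i, Integrable (fun z : Metric.sphere (0 : E8) 1 =>
      c i * altSum (fun m => (((z : E8) (m 0) : ℝ) : ℂ) * w i (fun i => m i.succ) z))
      (volume : Measure E8).toSphere := by
    intro i
    refine Continuous.integrable_of_hasCompactSupport (continuous_const.mul ?_)
      (HasCompactSupport.of_compactSpace _)
    unfold altSum
    refine continuous_finsetSum _ fun σ _ => continuous_const.mul ?_
    exact (hz (σ 0)).mul (hw i fun j => σ j.succ)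
  simp only [sphereIntegral_eq, ← integral_const_mul]
  rw [← integral_finsetSum _ fun i _ => hint i]
  congr 1
  funext z
  simp only [altSum, Finset.mul_sum]
  rw [Finset.sum_comm]
  refine Finset.sum_congr rfl fun σ _ => Finset.sum_congr rfl fun τ _ => ?_
  ring

theorem sphereIntegral_const_mul (c : ℂ) (w : (Fin 7 → Fin 8) → E8 → ℂ) :
    sphereIntegral (fun M x => c * w M x) = c * sphereIntegral w := by
  simp only [sphereIntegral_eq, ← integral_const_mul, ← altSum_mul_left, mul_left_comm c]

theorem chargeQt_eq {g : E8 → Mat8} (hg : IsSphereMapToSO8 g) :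
    chargeQt g = -(1 / (3 * 2 ^ 11 * 35 * (Real.pi : ℂ) ^ 4)) * mapCharge pfInvPoly g := by
  have hp : ∀ M a b, Continuous fun z : Metric.sphere (0 : E8) 1 => pureGauge g M z a b :=
    fun M a b => continuous_const.mul (continuous_iff_continuousAt.mpr fun z =>
      ((hg.mc_smoothAt (ne_zero_of_mem_unit_sphere z) M) a b).continuousAt.comp
        continuous_subtype_val.continuousAt)
  have hm : ∀ M N a b, Continuous fun z : Metric.sphere (0 : E8) 1 =>
      (pureGauge g M z * pureGauge g N z) a b := fun M N a b => by
    simp only [Matrix.mul_apply]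
    exact continuous_finsetSum _ fun j _ => (hp M a j).mul (hp N j b)
  rw [chargeQt, sphereIntegral_sum]
  · have hsum : ∀ M x, ∑ τ : Equiv.Perm (Fin 8), ((Equiv.Perm.sign τ : ℤ) : ℂ) *
        (pureGauge g (M 0) x (τ 0) (τ 1) *
        (pureGauge g (M 1) x * pureGauge g (M 2) x) (τ 2) (τ 3) *
        (pureGauge g (M 3) x * pureGauge g (M 4) x) (τ 4) (τ 5) *
        (pureGauge g (M 5) x * pureGauge g (M 6) x) (τ 6) (τ 7)) =
        -Complex.I * mapForm pfInvPoly g M x := by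
      intro M x
      -- Seven factors A = iθ; with the prefactor -i of the charge, i⁷ gives the real sign -1.
      have h7 : Complex.I ^ 7 = -Complex.I := by
        rw [show 7 = 4 + 3 from rfl, pow_add, Complex.I_pow_four, Complex.I_pow_three, one_mul]
      rw [← h7]
      simp only [mapForm, pfInvPoly, pfPoly, altSum, Finset.mul_sum, pureGauge,
        smul_mul_smul_comm, Matrix.smul_apply, smul_eq_mul]
      refine Finset.sum_congr rfl fun τ _ => ?_
      ring
    simp only [hsum]
    rw [sphereIntegral_const_mul, mapCharge]
    linear_combination (1 / (3 * 2 ^ 11 * 35 * (Real.pi : ℂ) ^ 4) *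
      sphereIntegral (mapForm pfInvPoly g)) * Complex.I_mul_I
  · exact fun τ M => (((hp _ _ _).mul (hm _ _ _ _)).mul (hm _ _ _ _)).mul (hm _ _ _ _)

/-- The normalizations of the field and map charges differ exactly by the factor -1/35 of
`integral_fieldForm`; note that 384 = 2⁷ · 3. -/
theorem IsAssociatedField.charges {A : Fin 8 → E8 → Mat8} {g : E8 → Mat8}
    (hA : IsAssociatedField A g) (hg : IsSphereMapToSO8 g) :
    fieldQ A = chargeQ g ∧ fieldQt A = chargeQt g := by
  have hs : ∀ M x, MSmoothAt (A M) x := fun M x a b => (hA.smooth M a b).contDiffAt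
  constructor
  · rw [fieldQ, densityQ_eq, integral_fieldForm tracePoly hs hA.antisymm hg hA.asymptotic hA.decay
      (densityQ_eq A ▸ hA.integrableQ), chargeQ_eq, mapCharge]
    have hpi : (Real.pi : ℂ) ≠ 0 := by exact_mod_cast Real.pi_ne_zero
    field_simp
    ring
  · rw [fieldQt, densityQt_eq, integral_fieldForm pfInvPoly hs hA.antisymm hg hA.asymptotic
      hA.decay (densityQt_eq A ▸ hA.integrableQt), chargeQt_eq hg, mapCharge]
    have hpi : (Real.pi : ℂ) ≠ 0 := by exact_mod_cast Real.pi_ne_zero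
    field_simp

/-- Outside the ball of radius 3 the cut-off field is the pure gauge itself and flat, so
asymptotics, decay and integrability are immediate. -/
theorem isAssociatedField_cutField {φ : E8 → ℂ} (hφ : IsCut φ) {g : E8 → Mat8}
    (hg : IsSphereMapToSO8 g) : IsAssociatedField (cutField φ g) g where
  smooth M a b := contDiff_iff_contDiffAt.mpr fun x => cutField_smoothAt hφ hg M x a b
  imaginary M x a b := cutField_re hφ hg M x a b
  antisymm := cutField_transpose hφ hg
  asymptotic M a b := tendsto_cobounded_of_eq_zero fun x hx => by
    rw [cutField_eq hφ g hx.le, sub_self, mul_zero]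
  decay M N a b := tendsto_cobounded_of_eq_zero fun x hx => by
    rw [fieldStrength_cutField hφ hg (norm_pos_iff.mp (by linarith)) (eventually_cut_eq_one hφ hx),
      Matrix.zero_apply, mul_zero]
  integrableQ := densityQ_eq _ ▸ integrable_cutField _ hφ hg
  integrableQt := densityQt_eq _ ▸ integrable_cutField _ hφ hg


/-! ### Signed permutation matrices -/

/-- The matrix with the single entry `(f i).2` in the row `i`, in the column `(f i).1`. -/
def monoMat (f : Fin 8 → Fin 8 × ℤ) : Matrix (Fin 8) (Fin 8) ℤ := fun i j =>
  if (f i).1 = j then (f i).2 else 0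

/-- All matrices attached to the standard system are signed permutation matrices; composing tables
instead of multiplying matrices keeps the finite checks small. -/
def monoMul (f g : Fin 8 → Fin 8 × ℤ) (i : Fin 8) : Fin 8 × ℤ :=
  ((g (f i).1).1, (f i).2 * (g (f i).1).2)

theorem monoMat_mul (f g : Fin 8 → Fin 8 × ℤ) :
    monoMat f * monoMat g = monoMat (monoMul f g) := by
  ext i j
  rw [Matrix.mul_apply, Finset.sum_eq_single (f i).1]
  · rw [monoMat, monoMat, monoMat, if_pos rfl, mul_ite, mul_zero]
    rfl
  · intro k _ hk
    rw [monoMat, if_neg (Ne.symm hk), zero_mul]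
  · simp

theorem monoMat_one : monoMat (fun i => (i, 1)) = 1 := by
  ext i j
  simp [monoMat, Matrix.one_apply]

/-! ### The standard gamma matrices -/

/-- Row by row, the column and the sign of the only non-zero entry; the table is compared with the
Pauli matrices in `lStd_eq_lTensor` and `gammaStd_apply`. -/
def lTab : Fin 7 → Fin 8 → Fin 8 × ℤ :=
  ![![(7, 1), (6, -1), (5, -1), (4, 1), (3, -1), (2, 1), (1, 1), (0, -1)],
    ![(3, 1), (2, -1), (1, 1), (0, -1), (7, 1), (6, -1), (5, 1), (4, -1)],
    ![(1, 1), (0, -1), (3, -1), (2, 1), (5, 1), (4, -1), (7, -1), (6, 1)],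
    ![(6, -1), (7, -1), (4, 1), (5, 1), (2, -1), (3, -1), (0, 1), (1, 1)],
    ![(2, 1), (3, 1), (0, -1), (1, -1), (6, -1), (7, -1), (4, 1), (5, 1)],
    ![(5, 1), (4, 1), (7, 1), (6, 1), (1, -1), (0, -1), (3, -1), (2, -1)],
    ![(4, 1), (5, -1), (6, 1), (7, -1), (0, -1), (1, 1), (2, -1), (3, 1)]]

/-- The matrices `i Γₘ` for the standard gamma matrices. -/
def lStd (m : Fin 7) : Matrix (Fin 8) (Fin 8) ℤ := monoMat (lTab m)

theorem lStd_clifford : ∀ m n, lStd m * lStd n + lStd n * lStd m = if m = n then -2 else 0 := by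
  intro m n
  -- In either order the products have the same underlying permutation, the identity if m = n; only
  -- the signs have to be added.
  have h : ∀ m n i, (monoMul (lTab m) (lTab n) i).1 = (monoMul (lTab n) (lTab m) i).1 ∧
      (monoMul (lTab m) (lTab n) i).2 + (monoMul (lTab n) (lTab m) i).2 =
        (if m = n then -2 else 0) ∧
      (m = n → (monoMul (lTab m) (lTab n) i).1 = i) := by decide +kernel
  rw [lStd, lStd, monoMat_mul, monoMat_mul]
  ext i j
  obtain ⟨h1, h2, h3⟩ := h m n i
  rw [Matrix.add_apply, monoMat, monoMat, ← h1]
  split_ifs with h4 h5 h5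
  · rw [h2, if_pos h5, ← h4, h3 h5]; simp [Matrix.ofNat_apply]
  · rw [h2, if_neg h5]; simp
  · rw [h3 h5] at h4; simp [Matrix.ofNat_apply, h4]
  · simp

theorem lStd_product : lStd 0 * lStd 1 * lStd 2 * lStd 3 * lStd 4 * lStd 5 * lStd 6 = 1 := by
  simp only [lStd, monoMat_mul, ← monoMat_one]
  refine congrArg monoMat ?_
  decide +kernel

theorem lStd_antisymm : ∀ m i j, lStd m j i = - lStd m i j := by
  decide +kernel

/-- The reflection `diag (-1, …, -1, 1)`. -/
def cTab (i : Fin 8) : Fin 8 × ℤ := (i, if i = 7 then 1 else -1)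

def cStd : Matrix (Fin 8) (Fin 8) ℤ := monoMat cTab

/-! ### The octonion structure constants and the standard matrices. -/

theorem sum_perm_three {M : Type*} [AddCommMonoid M] (F : Equiv.Perm (Fin 3) → M) :
    ∑ σ, F σ = F 1 + F (Equiv.swap 0 1) + F (Equiv.swap 0 2) + F (Equiv.swap 1 2) +
      F (Equiv.swap 0 1 * Equiv.swap 1 2) + F (Equiv.swap 1 2 * Equiv.swap 0 1) := by
  have : (Finset.univ : Finset (Equiv.Perm (Fin 3))) = {1, Equiv.swap 0 1, Equiv.swap 0 2,
      Equiv.swap 1 2, Equiv.swap 0 1 * Equiv.swap 1 2, Equiv.swap 1 2 * Equiv.swap 0 1} := by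
    decide
  rw [this, Finset.sum_insert (by decide), Finset.sum_insert (by decide),
    Finset.sum_insert (by decide), Finset.sum_insert (by decide), Finset.sum_insert (by decide),
    Finset.sum_singleton]
  simp only [add_assoc]

/-- Only the six orderings of the seven lines contribute, so the sum over all pairs (n, k) becomes a
sum of 42 conditional terms that can be checked by computation. -/
theorem sum_octF {M : Type*} [AddCommGroup M] (m : Fin 7) (X : Fin 7 → Fin 7 → M) :
    ∑ n, ∑ k, octF m n k • X n k = ∑ l, ∑ σ : Equiv.Perm (Fin 3),
      if m = fanoLine l (σ 0) then (Equiv.Perm.sign σ : ℤ) • X (fanoLine l (σ 1)) (fanoLine l (σ 2))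
      else 0 := by
  simp only [octF, Finset.sum_smul]
  have h : ∀ n k l (σ : Equiv.Perm (Fin 3)), (![m, n, k] = fanoLine l ∘ σ) ↔
      m = fanoLine l (σ 0) ∧ n = fanoLine l (σ 1) ∧ k = fanoLine l (σ 2) := fun n k l σ => by
    rw [funext_iff, Fin.forall_fin_succ, Fin.forall_fin_two]
    rfl
  calc _ = ∑ n, ∑ l, ∑ σ : Equiv.Perm (Fin 3), ∑ k,
        (if ![m, n, k] = fanoLine l ∘ σ then (Equiv.Perm.sign σ : ℤ) else 0) • X n k := by
        refine Finset.sum_congr rfl fun n _ => ?_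
        rw [Finset.sum_comm]
        refine Finset.sum_congr rfl fun l _ => ?_
        rw [Finset.sum_comm]
    _ = ∑ l, ∑ σ : Equiv.Perm (Fin 3), ∑ n, ∑ k,
        (if ![m, n, k] = fanoLine l ∘ σ then (Equiv.Perm.sign σ : ℤ) else 0) • X n k := by
        rw [Finset.sum_comm]
        refine Finset.sum_congr rfl fun l _ => ?_
        rw [Finset.sum_comm]
    _ = _ := by
        refine Finset.sum_congr rfl fun l _ => Finset.sum_congr rfl fun σ _ => ?_
        simp only [h, ite_smul, zero_smul, ite_and]
        split_ifs <;> simp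

/-- The origin of g₇ = g₈⁻¹ · C g₈² C. Up to a relabelling of the basis, the `lStd m` are left
multiplications by octonion units, the last basis vector is the unit element, and `cStd` is octonion
conjugation, so that C L C is up to sign a right multiplication. The generators of g₇ are thus
combinations of left and right multiplications. -/
theorem lStd_octF (m : Fin 7) : ∑ n, ∑ k, octF m n k • (lStd n * lStd k) =
    2 • (-lStd m + 2 • (cStd * lStd m * cStd)) := by
  rw [sum_octF]
  simp only [sum_perm_three, lStd, cStd, monoMat_mul]
  ext i j
  simp only [Matrix.sum_apply, Matrix.add_apply, Matrix.smul_apply, Matrix.neg_apply,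
    Matrix.zero_apply, apply_ite (fun M : Matrix (Fin 8) (Fin 8) ℤ => M i j)]
  revert m i j
  decide +kernel

/-- The polarization of the statement that L(α) commutes with C L(α) C. For octonions this is the
flexible law (ax)a = a(xa). -/
theorem lStd_commute (m n : Fin 7) :
    lStd m * (cStd * lStd n * cStd) + lStd n * (cStd * lStd m * cStd) =
    cStd * lStd n * cStd * lStd m + cStd * lStd m * cStd * lStd n := by
  simp only [lStd, cStd, monoMat_mul]
  ext i j
  rw [Matrix.add_apply, Matrix.add_apply]
  revert m n i j
  decide +kernel


/-! ### Comparison of the integral tables with the Kronecker products, and real Clifford systems. -/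

/-- The real matrix `i σ₂`. -/
def eps2 : Matrix (Fin 2) (Fin 2) ℤ := !![0, 1; -1, 0]

def sigma1 : Matrix (Fin 2) (Fin 2) ℤ := !![0, 1; 1, 0]

def sigma3 : Matrix (Fin 2) (Fin 2) ℤ := !![1, 0; 0, -1]

/-- The integral Kronecker product of three `2 × 2` matrices as an `8 × 8` matrix. -/
def tensorInt (a b c : Matrix (Fin 2) (Fin 2) ℤ) (i j : Fin 8) : ℤ :=
  a (tensorBasis i).1 (tensorBasis j).1 *
    (b (tensorBasis i).2.1 (tensorBasis j).2.1 * c (tensorBasis i).2.2 (tensorBasis j).2.2)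

theorem pauli2_apply (i j : Fin 2) : pauli2 i j = -Complex.I * (eps2 i j : ℂ) := by
  fin_cases i <;> fin_cases j <;> simp [pauli2, eps2]

theorem pauli1_apply (i j : Fin 2) : pauli1 i j = (sigma1 i j : ℂ) := by
  fin_cases i <;> fin_cases j <;> simp [pauli1, sigma1]

theorem pauli3_apply (i j : Fin 2) : pauli3 i j = (sigma3 i j : ℂ) := by
  fin_cases i <;> fin_cases j <;> simp [pauli3, sigma3]

def lTensor : Fin 7 → Fin 8 → Fin 8 → ℤ :=
  ![tensorInt eps2 eps2 eps2, tensorInt 1 sigma1 eps2, tensorInt 1 sigma3 eps2,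
    fun i j => -tensorInt sigma1 eps2 1 i j, tensorInt sigma3 eps2 1, tensorInt eps2 1 sigma1,
    tensorInt eps2 1 sigma3]

theorem lStd_eq_lTensor : ∀ (m : Fin 7) (i j : Fin 8), lStd m i j = lTensor m i j := by
  have h : ∀ (m : Fin 7) (i j : Fin 8), (decide (lStd m i j = lTensor m i j)) = true := by
    decide +kernel
  exact fun m i j => of_decide_eq_true (h m i j)

theorem gammaStd_apply (m : Fin 7) (i j : Fin 8) :
    gammaStd m i j = -Complex.I * (lStd m i j : ℂ) := by
  have h1 : ∀ i j : Fin 2, (1 : Matrix (Fin 2) (Fin 2) ℂ) i j =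
      (((1 : Matrix (Fin 2) (Fin 2) ℤ) i j : ℤ) : ℂ) := fun i j => by
    fin_cases i <;> fin_cases j <;> simp
  -- Γ₁ contains three factors σ₂ and needs the cube of i; every other Γₘ contains exactly one.
  have h2 : Complex.I ^ 3 = -Complex.I := Complex.I_pow_three
  rw [lStd_eq_lTensor]
  fin_cases m <;>
    simp only [gammaStd, lTensor, tensor3, tensorInt, Matrix.kronecker, Matrix.submatrix_apply,
      Matrix.kroneckerMap_apply, pauli1_apply, pauli2_apply, pauli3_apply, Matrix.neg_apply,
      h1, Fin.reduceFinMk, Fin.zero_eta, Fin.mk_one, Matrix.cons_val, Matrix.cons_val_zero,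
      Matrix.cons_val_one, Int.cast_mul, Int.cast_neg] <;>
    first
    | ring1
    | linear_combination (eps2 (tensorBasis i).1 (tensorBasis j).1 *
        eps2 (tensorBasis i).2.1 (tensorBasis j).2.1 *
        eps2 (tensorBasis i).2.2 (tensorBasis j).2.2 : ℂ) * h2

/-- Integral matrices as real matrices. -/
noncomputable def zr : Matrix (Fin 8) (Fin 8) ℤ →+* Matrix (Fin 8) (Fin 8) ℝ :=
  (Int.castRingHom ℝ).mapMatrix

theorem zr_apply (M : Matrix (Fin 8) (Fin 8) ℤ) (i j : Fin 8) : zr M i j = (M i j : ℝ) := rfl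

/-- Seven real antisymmetric matrices which anticommute, have squares `-1` and product `1`. -/
structure IsRealClifford (A : Fin 7 → Matrix (Fin 8) (Fin 8) ℝ) : Prop where
  antisymm : ∀ m, (A m).transpose = -A m
  clifford : ∀ m n, A m * A n + A n * A m = if m = n then -2 else 0
  product : A 0 * A 1 * A 2 * A 3 * A 4 * A 5 * A 6 = 1

theorem isRealClifford_lStd : IsRealClifford fun m => zr (lStd m) where
  antisymm m := by
    ext i j
    rw [Matrix.transpose_apply, Matrix.neg_apply, zr_apply, zr_apply, lStd_antisymm, Int.cast_neg]
  clifford m n := by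
    rw [← map_mul, ← map_mul, ← map_add, lStd_clifford, apply_ite zr, map_neg, map_ofNat, map_zero]
  product := by
    simp only [← map_mul, lStd_product, map_one]

theorem gammaStd_eq (m : Fin 7) : gammaStd m = -Complex.I • cx (zr (lStd m)) := by
  ext i j
  rw [gammaStd_apply]
  simp [cx_apply, zr_apply]

theorem IsRealClifford.isGammaSystem {A : Fin 7 → Matrix (Fin 8) (Fin 8) ℝ}
    (hA : IsRealClifford A) : IsGammaSystem fun m => -Complex.I • cx (A m) where
  imaginary m a b := by simp [cx_apply]
  antisymm m := by
    rw [Matrix.transpose_smul, ← cx_transpose, hA.antisymm, map_neg, smul_neg]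
  clifford m n := by
    rw [smul_mul_smul_comm, smul_mul_smul_comm, ← smul_add, ← map_mul, ← map_mul, ← map_add,
      hA.clifford, neg_mul_neg, Complex.I_mul_I]
    split_ifs
    · rw [map_neg, map_ofNat, neg_one_smul, neg_neg]
    · simp
  product := by
    simp only [smul_mul_smul_comm, ← map_mul, hA.product, map_one]
    congr 1
    linear_combination (-Complex.I ^ 5 + Complex.I ^ 3 - Complex.I) * Complex.I_sq

theorem IsGammaSystem.exists_isRealClifford {Γ : Fin 7 → Mat8} (hΓ : IsGammaSystem Γ) :
    ∃ A, IsRealClifford A ∧ ∀ m, Γ m = -Complex.I • cx (A m) := by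
  choose A hA using fun m => exists_cx_eq (G := Complex.I • Γ m) fun a b => by
    simp [hΓ.imaginary]
  refine ⟨A, ⟨fun m => cx_injective ?_, fun m n => cx_injective ?_, cx_injective ?_⟩, fun m => ?_⟩
  · rw [cx_transpose, map_neg, hA, Matrix.transpose_smul, hΓ.antisymm, smul_neg]
  · rw [map_add, map_mul, map_mul, hA, hA, smul_mul_smul_comm, smul_mul_smul_comm, ← smul_add,
      hΓ.clifford, Complex.I_mul_I]
    split_ifs
    · rw [map_neg, map_ofNat, neg_one_smul]
    · simp
  · simp only [map_mul, hA, smul_mul_smul_comm, hΓ.product, smul_smul, map_one]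
    rw [← one_smul ℂ (1 : Mat8), smul_smul]
    congr 1
    linear_combination (Complex.I ^ 6 - Complex.I ^ 4 + Complex.I ^ 2 - 1) * Complex.I_sq
  · rw [hA, smul_smul, neg_mul, Complex.I_mul_I, neg_neg, one_smul]

theorem isGammaSystem_gammaStd : IsGammaSystem gammaStd := by
  rw [funext gammaStd_eq]
  exact isRealClifford_lStd.isGammaSystem

/-! ### Uniqueness of the gamma matrices up to rotations -/

namespace IsRealClifford

variable {A : Fin 7 → Matrix (Fin 8) (Fin 8) ℝ}

theorem sq (hA : IsRealClifford A) (m : Fin 7) : A m * A m = -1 := by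
  have h := hA.clifford m m
  rw [if_pos rfl, ← two_smul ℝ] at h
  have h2 : (2 : ℝ) • (A m * A m) = (2 : ℝ) • (-1 : Matrix (Fin 8) (Fin 8) ℝ) := by
    rw [h, two_smul]; norm_num
  exact smul_right_injective _ (two_ne_zero' ℝ) h2

theorem anti (hA : IsRealClifford A) {m n : Fin 7} (h : m ≠ n) : A m * A n = -(A n * A m) := by
  have h' := hA.clifford m n
  rw [if_neg h] at h'
  exact eq_neg_of_add_eq_zero_left h'

theorem sq_left (hA : IsRealClifford A) (m : Fin 7) (X : Matrix (Fin 8) (Fin 8) ℝ) :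
    A m * (A m * X) = -X := by
  rw [← mul_assoc, hA.sq, neg_one_mul]

theorem anti_left (hA : IsRealClifford A) {m n : Fin 7} (h : m ≠ n)
    (X : Matrix (Fin 8) (Fin 8) ℝ) : A m * (A n * X) = -(A n * (A m * X)) := by
  rw [← mul_assoc, hA.anti h, neg_mul, mul_assoc]

theorem anti_lt (hA : IsRealClifford A) {m n : Fin 7} (h : n < m) : A m * A n = -(A n * A m) :=
  hA.anti h.ne'

theorem anti_left_lt (hA : IsRealClifford A) {m n : Fin 7} (h : n < m)
    (X : Matrix (Fin 8) (Fin 8) ℝ) : A m * (A n * X) = -(A n * (A m * X)) :=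
  hA.anti_left h.ne' X

/-- If an involution and an invertible matrix that anticommutes with it both preserve a space
of vectors, the involution has a non-zero fixed vector there. -/
theorem exists_fixed {p : (Fin 8 → ℝ) → Prop} {W D : Matrix (Fin 8) (Fin 8) ℝ} (hWW : W * W = 1)
    (hDD : D * D = -1) (hWD : W * D = -(D * W)) (hp : ∀ u v, p u → p v → p (u + v))
    (hW : ∀ u, p u → p (W.mulVec u)) (hD : ∀ u, p u → p (D.mulVec u)) (h : ∃ u ≠ 0, p u) :
    ∃ u ≠ 0, p u ∧ W.mulVec u = u := by
  obtain ⟨u, hu, hpu⟩ := h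
  by_cases h0 : u + W.mulVec u = 0
  · have h1 : W.mulVec u = -u := eq_neg_of_add_eq_zero_right h0
    refine ⟨D.mulVec u, fun h2 => hu ?_, hD u hpu, ?_⟩
    · have := congrArg D.mulVec h2
      rw [Matrix.mulVec_mulVec, hDD, Matrix.mulVec_zero, Matrix.neg_mulVec,
        Matrix.one_mulVec] at this
      exact neg_eq_zero.mp this
    · rw [Matrix.mulVec_mulVec, hWD, Matrix.neg_mulVec, ← Matrix.mulVec_mulVec, h1,
        Matrix.mulVec_neg, neg_neg]
  · refine ⟨_, h0, hp _ _ hpu (hW u hpu), ?_⟩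
    rw [Matrix.mulVec_add, Matrix.mulVec_mulVec, hWW, Matrix.one_mulVec, add_comm]

/-- If the triple product along an oriented line fixes v, any two of its matrices applied to v give
the third up to sign. This is the multiplication table of the octonion units, with v as the unit
element. -/
theorem line (hA : IsRealClifford A) {a b c : Fin 7} (hab : a ≠ b) (hbc : b ≠ c) (hac : a ≠ c)
    {v : Fin 8 → ℝ} (hv : (A a * (A b * A c)).mulVec v = v) :
    (A a).mulVec ((A b).mulVec v) = -(A c).mulVec v ∧
    (A b).mulVec ((A a).mulVec v) = (A c).mulVec v ∧
    (A b).mulVec ((A c).mulVec v) = -(A a).mulVec v ∧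
    (A c).mulVec ((A b).mulVec v) = (A a).mulVec v ∧
    (A c).mulVec ((A a).mulVec v) = -(A b).mulVec v ∧
    (A a).mulVec ((A c).mulVec v) = (A b).mulVec v := by
  have h1 : ∀ X : Matrix (Fin 8) (Fin 8) ℝ, X.mulVec v = (X * (A a * (A b * A c))).mulVec v :=
    fun X => by rw [← Matrix.mulVec_mulVec, hv]
  simp only [Matrix.mulVec_mulVec]
  rw [h1 (A a), h1 (A b), h1 (A c)]
  simp only [← Matrix.neg_mulVec, hA.sq_left, hA.sq, hA.anti_left hab.symm,
    hA.anti_left hac.symm, hA.anti_left hbc.symm, hA.anti hab.symm, hA.anti hac.symm,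
    hA.anti hbc.symm, mul_neg, neg_neg, mul_one, and_self]

-- The triple products along the seven lines are commuting involutions. Three of them generate the
-- others with the help of A₀⋯A₆ = 1, so it suffices to find a common fixed vector of three.
set_option linter.unusedSimpArgs false in
theorem exists_octonionic (hA : IsRealClifford A) : ∃ v : Fin 8 → ℝ, v ≠ 0 ∧
    ∀ l, (A (fanoLine l 0) * (A (fanoLine l 1) * A (fanoLine l 2))).mulVec v = v := by
  have hprod := hA.product
  simp only [mul_assoc] at hprod
  have key : ∀ W D : Matrix (Fin 8) (Fin 8) ℝ, (W * D = D * W) → ∀ v, W.mulVec v = v →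
      W.mulVec (D.mulVec v) = D.mulVec v := fun W D h v hv => by
    rw [Matrix.mulVec_mulVec, h, ← Matrix.mulVec_mulVec, hv]
  obtain ⟨v, hv, ⟨⟨-, h1⟩, h2⟩, h3⟩ : ∃ v ≠ 0, ((True ∧ (A 0 * (A 5 * A 4)).mulVec v = v) ∧
      (A 0 * (A 2 * A 3)).mulVec v = v) ∧ (A 1 * (A 2 * A 4)).mulVec v = v := by
    -- The three lines are treated from the inside out: `A 1` for A₀A₅A₄, `A 5` for A₀A₂A₃ and `A 0`
    -- for A₁A₂A₄. Each `D` shares no index with its own line, hence anticommutes with its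
    -- involution, and lies on the lines already treated, hence preserves their fixed vectors.
    refine exists_fixed (D := A 0) ?_ (hA.sq 0) ?_ ?_ ?_ ?_
      (exists_fixed (D := A 5) ?_ (hA.sq 5) ?_ ?_ ?_ ?_
        (exists_fixed (D := A 1) ?_ (hA.sq 1) ?_ ?_ ?_ ?_
          ⟨Pi.single 0 1, by simp, trivial⟩))
    case refine_3 | refine_8 =>
      intro u v hu hv
      simp only [Matrix.mulVec_add, hu, hv, and_self]
    case refine_4 | refine_5 =>
      refine fun u hu => ⟨⟨trivial, key _ _ ?_ u hu.1.2⟩, key _ _ ?_ u hu.2⟩ <;>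
      simp only [hA.anti_lt, hA.anti_left_lt, hA.sq, hA.sq_left, mul_assoc, neg_mul, mul_neg,
        neg_neg, Fin.reduceLT, mul_one]
    case refine_9 | refine_10 =>
      refine fun u hu => ⟨trivial, key _ _ ?_ u hu.2⟩
      simp only [hA.anti_lt, hA.anti_left_lt, hA.sq, hA.sq_left, mul_assoc, neg_mul, mul_neg,
        neg_neg, Fin.reduceLT, mul_one]
    case refine_13 | refine_14 | refine_15 => tauto
    all_goals
      simp only [hA.anti_lt, hA.anti_left_lt, hA.sq, hA.sq_left, mul_assoc, neg_mul, mul_neg,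
        neg_neg, Fin.reduceLT, mul_one]
  have p1 : A 0 * (A 1 * A 6) = (A 0 * (A 5 * A 4)) * (A 0 * (A 2 * A 3)) := by
    rw [← mul_one (A 0 * (A 1 * A 6)), ← hprod]
    simp only [hA.anti_lt, hA.anti_left_lt, hA.sq, hA.sq_left, mul_assoc, neg_mul, mul_neg, neg_neg,
      Fin.reduceLT, mul_one]
  have p5 : A 2 * (A 5 * A 6) = (A 0 * (A 2 * A 3)) * (A 1 * (A 2 * A 4)) := by
    rw [← mul_one (A 2 * (A 5 * A 6)), ← hprod]
    simp only [hA.anti_lt, hA.anti_left_lt, hA.sq, hA.sq_left, mul_assoc, neg_mul, mul_neg, neg_neg,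
      Fin.reduceLT, mul_one]
  have p6 : A 3 * (A 6 * A 4) = (A 0 * (A 5 * A 4)) * (A 1 * (A 2 * A 4)) := by
    rw [← mul_one (A 3 * (A 6 * A 4)), ← hprod]
    simp only [hA.anti_lt, hA.anti_left_lt, hA.sq, hA.sq_left, mul_assoc, neg_mul, mul_neg, neg_neg,
      Fin.reduceLT, mul_one]
  have p4 : A 1 * (A 3 * A 5) = (A 0 * (A 2 * A 3)) * (A 3 * (A 6 * A 4)) := by
    rw [← mul_one (A 1 * (A 3 * A 5)), ← hprod]
    simp only [hA.anti_lt, hA.anti_left_lt, hA.sq, hA.sq_left, mul_assoc, neg_mul, mul_neg, neg_neg,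
      Fin.reduceLT, mul_one]
  have q6 : (A 3 * (A 6 * A 4)).mulVec v = v := by rw [p6, ← Matrix.mulVec_mulVec, h3, h1]
  refine ⟨v, hv, fun l => ?_⟩
  fin_cases l
  · exact h1
  · exact h2
  · change (A 0 * (A 1 * A 6)).mulVec v = v
    rw [p1, ← Matrix.mulVec_mulVec, h2, h1]
  · exact h3
  · change (A 1 * (A 3 * A 5)).mulVec v = v
    rw [p4, ← Matrix.mulVec_mulVec, q6, h2]
  · change (A 2 * (A 5 * A 6)).mulVec v = v
    rw [p5, ← Matrix.mulVec_mulVec, h3, h2]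
  · exact q6

/-- The vectors which correspond to the standard basis for the standard matrices. -/
def spinorBasis (A : Fin 7 → Matrix (Fin 8) (Fin 8) ℝ) (v : Fin 8 → ℝ) : Fin 8 → Fin 8 → ℝ :=
  ![(A 0).mulVec v, -(A 3).mulVec v, (A 5).mulVec v, -(A 6).mulVec v, (A 1).mulVec v,
    -(A 4).mulVec v, -(A 2).mulVec v, v]

theorem dotProduct_mulVec (hA : IsRealClifford A) (m : Fin 7) (u v : Fin 8 → ℝ) :
    (A m).mulVec u ⬝ᵥ v = -(u ⬝ᵥ (A m).mulVec v) := by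
  rw [dotProduct_comm, Matrix.dotProduct_mulVec, ← Matrix.mulVec_transpose, hA.antisymm,
    Matrix.neg_mulVec, neg_dotProduct, dotProduct_comm]

theorem dotProduct_self_mulVec (hA : IsRealClifford A) (m : Fin 7) (v : Fin 8 → ℝ) :
    (A m).mulVec v ⬝ᵥ v = 0 := by
  have := hA.dotProduct_mulVec m v v
  rw [dotProduct_comm v] at this
  linarith

theorem dotProduct_mulVec_mulVec (hA : IsRealClifford A) (m n : Fin 7) (v : Fin 8 → ℝ) :
    (A m).mulVec v ⬝ᵥ (A n).mulVec v = if m = n then v ⬝ᵥ v else 0 := by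
  have h1 := hA.dotProduct_mulVec m v ((A n).mulVec v)
  have h2 := hA.dotProduct_mulVec n v ((A m).mulVec v)
  rw [Matrix.mulVec_mulVec] at h1 h2
  have h3 : v ⬝ᵥ ((A m * A n + A n * A m).mulVec v) = if m = n then -2 * (v ⬝ᵥ v) else 0 := by
    rw [hA.clifford]
    split_ifs
    · rw [← smul_eq_mul, ← dotProduct_smul]
      congr 1
      ext i
      simp [Matrix.neg_mulVec]
    · simp
  rw [Matrix.add_mulVec, dotProduct_add] at h3
  rw [dotProduct_comm] at h2
  split_ifs at h3 ⊢ <;> linarith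

/-- Take a unit vector fixed by all line products. It and its seven images are orthonormal by the
Clifford relations, and `line` determines the action of every `A k` on them. With the order and
signs of `spinorBasis` this action has the matrices `lStd k`. -/
theorem exists_rotation (hA : IsRealClifford A) : ∃ R : Matrix (Fin 8) (Fin 8) ℝ,
    R * R.transpose = 1 ∧ ∀ k, A k = R * zr (lStd k) * R.transpose := by
  obtain ⟨v, hv, hl⟩ := hA.exists_octonionic
  have hv0 : 0 < v ⬝ᵥ v := lt_of_le_of_ne (Finset.sum_nonneg fun i _ => mul_self_nonneg (v i))
    (Ne.symm (mt dotProduct_self_eq_zero.mp hv))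
  obtain ⟨u, hu1, hu2⟩ : ∃ u : Fin 8 → ℝ, u ⬝ᵥ u = 1 ∧
      ∀ l, (A (fanoLine l 0) * (A (fanoLine l 1) * A (fanoLine l 2))).mulVec u = u := by
    refine ⟨(√(v ⬝ᵥ v))⁻¹ • v, ?_, fun l => by rw [Matrix.mulVec_smul, hl]⟩
    rw [smul_dotProduct, dotProduct_smul, smul_eq_mul, smul_eq_mul, ← mul_assoc, ← mul_inv,
      Real.mul_self_sqrt hv0.le, inv_mul_cancel₀ hv0.ne']
  clear hl hv0 hv
  set R : Matrix (Fin 8) (Fin 8) ℝ := Matrix.of fun i j => spinorBasis A u j i with hR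
  have hRR : R.transpose * R = 1 := by
    ext i j
    have h1 : (R.transpose * R) i j = spinorBasis A u i ⬝ᵥ spinorBasis A u j := rfl
    have h0 := hA.dotProduct_mulVec_mulVec (v := u)
    have h3 := fun m => hA.dotProduct_self_mulVec m u
    have h4 := fun m => (dotProduct_comm u ((A m).mulVec u)).trans (h3 m)
    rw [h1]
    fin_cases i <;> fin_cases j <;>
      simp [spinorBasis, h0, h3, h4, hu1]
  have hRR' : R * R.transpose = 1 := mul_eq_one_comm.mp hRR
  refine ⟨R, hRR', fun k => ?_⟩
  have key : A k * R = R * zr (lStd k) := by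
    ext i j
    have h1 : (A k * R) i j = (A k).mulVec (spinorBasis A u j) i := rfl
    have h2 : (R * zr (lStd k)) i j = ∑ l, spinorBasis A u l i * (lStd k l j : ℝ) := rfl
    have hs : ∀ m, (A m).mulVec ((A m).mulVec u) = -u := fun m => by
      rw [Matrix.mulVec_mulVec, hA.sq, Matrix.neg_mulVec, Matrix.one_mulVec]
    have l0 := hA.line (a := 0) (b := 5) (c := 4) (by decide) (by decide) (by decide) (hu2 0)
    have l1 := hA.line (a := 0) (b := 2) (c := 3) (by decide) (by decide) (by decide) (hu2 1)
    have l2 := hA.line (a := 0) (b := 1) (c := 6) (by decide) (by decide) (by decide) (hu2 2)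
    have l3 := hA.line (a := 1) (b := 2) (c := 4) (by decide) (by decide) (by decide) (hu2 3)
    have l4 := hA.line (a := 1) (b := 3) (c := 5) (by decide) (by decide) (by decide) (hu2 4)
    have l5 := hA.line (a := 2) (b := 5) (c := 6) (by decide) (by decide) (by decide) (hu2 5)
    have l6 := hA.line (a := 3) (b := 6) (c := 4) (by decide) (by decide) (by decide) (hu2 6)
    rw [h1, h2]
    clear h1 h2 hRR hRR' hR hu2
    fin_cases k <;> fin_cases j <;>
      simp [spinorBasis, Fin.sum_univ_eight, lStd, monoMat, lTab, Matrix.mulVec_neg, hs, l0, l1, l2,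
        l3, l4, l5, l6]
  rw [← key, mul_assoc, hRR', mul_one]

end IsRealClifford

theorem IsGammaSystem.exists_rotation {Γ : Fin 7 → Mat8} (hΓ : IsGammaSystem Γ) :
    ∃ R ∈ Matrix.orthogonalGroup (Fin 8) ℝ,
      ∀ k, Γ k = R.map (fun t : ℝ => (t : ℂ)) * gammaStd k *
        (R.map (fun t : ℝ => (t : ℂ))).transpose := by
  obtain ⟨A, hA, h⟩ := hΓ.exists_isRealClifford
  obtain ⟨R, hR, hk⟩ := hA.exists_rotation
  refine ⟨R, (Matrix.mem_orthogonalGroup_iff _ _).mpr hR, fun k => ?_⟩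
  rw [← cx_apply, ← cx_transpose, h, hk, gammaStd_eq, map_mul, map_mul, mul_smul_comm,
    smul_mul_assoc]


/-! ### The exponentials -/

/-- The exponent `i αₘ Γₘ`. -/
noncomputable def gdot (Γ : Fin 7 → Mat8) (α : Fin 7 → ℝ) : Mat8 :=
  ∑ m, (Complex.I * (α m : ℂ)) • Γ m

/-- The linear map `x ↦ x₈ + i xₘ Γₘ`. -/
noncomputable def gell (Γ : Fin 7 → Mat8) (x : E8) : Mat8 :=
  (x 7 : ℂ) • (1 : Mat8) + gdot Γ fun m => x m.castSucc

/-- J generates a copy of ℂ inside the matrices, and the algebra map that sends i to J transports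
Euler's formula. -/
theorem exp_smul_of_sq {J : Mat8} (hJ : J * J = -1) (θ : ℝ) :
    NormedSpace.exp ((θ : ℂ) • J) = (Real.cos θ : ℂ) • (1 : Mat8) + (Real.sin θ : ℂ) • J := by
  have hc : Continuous (Complex.liftAux J hJ) :=
    (Complex.liftAux J hJ).toLinearMap.continuous_of_finiteDimensional
  have h : Complex.liftAux J hJ (NormedSpace.exp ((θ : ℂ) * Complex.I)) =
      NormedSpace.exp (Complex.liftAux J hJ ((θ : ℂ) * Complex.I)) := by
    open scoped Matrix.Norms.Operator in
      exact NormedSpace.map_exp (Complex.liftAux J hJ) hc ((θ : ℂ) * Complex.I)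
  rw [← Complex.exp_eq_exp_ℂ, Complex.liftAux_apply, Complex.liftAux_apply] at h
  simp only [Complex.exp_ofReal_mul_I_re, Complex.exp_ofReal_mul_I_im,
    Algebra.algebraMap_eq_smul_one,
    Complex.re_ofReal_mul, Complex.im_ofReal_mul, Complex.I_re, Complex.I_im, mul_zero, zero_smul,
    zero_add, mul_one] at h
  simp only [Complex.coe_smul]
  exact h.symm

theorem IsGammaSystem.gdot_sq {Γ : Fin 7 → Mat8} (hΓ : IsGammaSystem Γ) (α : Fin 7 → ℝ) :
    gdot Γ α * gdot Γ α = -((∑ m, α m ^ 2 : ℝ) : ℂ) • (1 : Mat8) := by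
  have h1 : (2 : ℂ) • (gdot Γ α * gdot Γ α) = ∑ m, ∑ n, (-((α m : ℂ) * α n)) •
      (Γ m * Γ n + Γ n * Γ m) := by
    have h2 : gdot Γ α * gdot Γ α = ∑ m, ∑ n, (-((α m : ℂ) * α n)) • (Γ m * Γ n) := by
      rw [gdot, Finset.sum_mul_sum]
      refine Finset.sum_congr rfl fun m _ => Finset.sum_congr rfl fun n _ => ?_
      rw [smul_mul_smul_comm]
      congr 1
      linear_combination (α m * α n : ℂ) * Complex.I_sq
    have h3 : gdot Γ α * gdot Γ α = ∑ m, ∑ n, (-((α m : ℂ) * α n)) • (Γ n * Γ m) := by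
      rw [h2, Finset.sum_comm]
      refine Finset.sum_congr rfl fun m _ => Finset.sum_congr rfl fun n _ => ?_
      rw [mul_comm (α m : ℂ)]
    simp only [smul_add, Finset.sum_add_distrib]
    rw [← h2, ← h3, two_smul]
  have h4 : (2 : ℂ) • (gdot Γ α * gdot Γ α) =
      (2 : ℂ) • (-((∑ m, α m ^ 2 : ℝ) : ℂ) • (1 : Mat8)) := by
    rw [h1]
    simp only [hΓ.clifford]
    have h6 : ∀ m, ∑ n, (-((α m : ℂ) * α n)) • (if m = n then (2 : Mat8) else 0) =
        (-((α m : ℂ) * α m)) • (2 : Mat8) := fun m => by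
      rw [Finset.sum_eq_single m, if_pos rfl]
      · intro n _ hn
        rw [if_neg hn.symm, smul_zero]
      · simp
    simp only [h6]
    rw [Complex.ofReal_sum, ← Finset.sum_neg_distrib, Finset.sum_smul, Finset.smul_sum]
    refine Finset.sum_congr rfl fun m _ => ?_
    have h5 : (2 : Mat8) = (2 : ℂ) • (1 : Mat8) := by rw [two_smul, one_add_one_eq_two]
    rw [h5, smul_smul, smul_smul, ofReal_pow]
    congr 1
    ring
  exact smul_right_injective _ (two_ne_zero' ℂ) h4

theorem gdot_smul (Γ : Fin 7 → Mat8) (c : ℝ) (α : Fin 7 → ℝ) :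
    gdot Γ (fun m => c * α m) = (c : ℂ) • gdot Γ α := by
  simp only [gdot, Finset.smul_sum, smul_smul, ofReal_mul]
  exact Finset.sum_congr rfl fun m _ => by ring_nf

theorem ballToSphere_castSucc (α : E7) (m : Fin 7) :
    ballToSphere α m.castSucc = Real.sinc ‖α‖ * α m := by
  simp [ballToSphere]

theorem ballToSphere_last (α : E7) : ballToSphere α 7 = Real.cos ‖α‖ := by
  exact Fin.snoc_last (α := fun _ : Fin 8 => ℝ) (Real.cos ‖α‖)
    fun m : Fin 7 => Real.sinc ‖α‖ * α m

/-- gdot/‖α‖ squares to -1, so Euler's formula applies and the result is linear in the point of the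
sphere. In particular it does not depend on the preimage of the south pole. -/
theorem exp8_eq {Γ : Fin 7 → Mat8} (hΓ : IsGammaSystem Γ) (α : E7) :
    exp8 Γ α = gell Γ (ballToSphere α) := by
  have h1 : exp8 Γ α = NormedSpace.exp (gdot Γ α) := rfl
  simp only [gell, ballToSphere_castSucc, ballToSphere_last, gdot_smul]
  rw [h1]
  rcases eq_or_ne α 0 with rfl | hα
  · simp [gdot]
  have hn : (‖α‖ : ℂ) ≠ 0 := by simpa using hα
  have hJ : ((‖α‖ : ℂ)⁻¹ • gdot Γ α) * ((‖α‖ : ℂ)⁻¹ • gdot Γ α) = -1 := by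
    rw [smul_mul_smul_comm, hΓ.gdot_sq, ← EuclideanSpace.real_norm_sq_eq, smul_smul, ofReal_pow,
      mul_neg, ← sq, ← mul_pow, inv_mul_cancel₀ hn, one_pow, neg_one_smul]
  have h2 := exp_smul_of_sq hJ ‖α‖
  rw [smul_smul, smul_smul, mul_inv_cancel₀ hn, one_smul] at h2
  rw [h2, Real.sinc_of_ne_zero (by simpa using hα), ofReal_div, div_eq_mul_inv]

theorem norm_ballToSphere (α : E7) : ‖ballToSphere α‖ = 1 := by
  rw [← sq_eq_sq₀ (norm_nonneg _) zero_le_one, EuclideanSpace.real_norm_sq_eq,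
    Fin.sum_univ_castSucc]
  have h7 : ballToSphere α (Fin.last 7) = Real.cos ‖α‖ := ballToSphere_last α
  simp only [h7, ballToSphere_castSucc, mul_pow, ← Finset.mul_sum]
  rw [← EuclideanSpace.real_norm_sq_eq]
  rcases eq_or_ne α 0 with rfl | hα
  · simp
  rw [Real.sinc_of_ne_zero (by simpa using hα), div_pow, div_mul_cancel₀ _ (by simpa using hα),
    Real.sin_sq_add_cos_sq, one_pow]

theorem ballToSphere_sphereToBall {x : E8} (hx : x ≠ 0) :
    ballToSphere (sphereToBall x) = ‖x‖⁻¹ • x := by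
  have hr : 0 < ‖x‖ := norm_pos_iff.mpr hx
  have hsq : ‖horiz x‖ ^ 2 + x 7 ^ 2 = ‖x‖ ^ 2 := by
    rw [EuclideanSpace.real_norm_sq_eq, EuclideanSpace.real_norm_sq_eq,
      Fin.sum_univ_castSucc (n := 7)]
    rfl
  -- The default direction on the axis is harmless: there the horizontal part, and with it sin θ,
  -- vanishes.
  obtain ⟨u, hu, hs, hhu⟩ : ∃ u : E7, ‖u‖ = 1 ∧
      sphereToBall x = Real.arccos (x 7 / ‖x‖) • u ∧ horiz x = ‖horiz x‖ • u := by
    unfold sphereToBall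
    split_ifs with h
    · exact ⟨_, by simp, rfl, by simp [h]⟩
    · have h' : ‖horiz x‖ ≠ 0 := norm_ne_zero_iff.mpr h
      refine ⟨_, ?_, rfl, ?_⟩
      · rw [norm_smul, norm_inv, norm_norm, inv_mul_cancel₀ h']
      · rw [smul_smul, mul_inv_cancel₀ h', one_smul]
  set θ := Real.arccos (x 7 / ‖x‖) with hθ
  have hθ0 : 0 ≤ θ := Real.arccos_nonneg _
  have hn : ‖sphereToBall x‖ = θ := by
    rw [hs, norm_smul, hu, mul_one, Real.norm_eq_abs, abs_of_nonneg hθ0]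
  have hab : |x 7 / ‖x‖| ≤ 1 := by
    rw [abs_div, abs_norm, div_le_one hr]
    exact abs_le_of_sq_le_sq (by nlinarith [sq_nonneg ‖horiz x‖]) hr.le
  have hcos : Real.cos θ = x 7 / ‖x‖ := Real.cos_arccos (abs_le.mp hab).1 (abs_le.mp hab).2
  have hsin : Real.sin θ = ‖horiz x‖ / ‖x‖ := by
    rw [hθ, Real.sin_arccos]
    have : 1 - (x 7 / ‖x‖) ^ 2 = (‖horiz x‖ / ‖x‖) ^ 2 := by
      field_simp; linarith
    rw [this, Real.sqrt_sq (by positivity)]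
  have hsinc : Real.sinc θ * θ = Real.sin θ := by
    rcases eq_or_ne θ 0 with h | h
    · simp [h]
    · rw [Real.sinc_of_ne_zero h, div_mul_cancel₀ _ h]
  ext i
  refine Fin.lastCases ?_ (fun m => ?_) i
  · refine (ballToSphere_last _).trans ?_
    rw [hn, hcos, PiLp.smul_apply, smul_eq_mul, div_eq_inv_mul]
    rfl
  · rw [ballToSphere_castSucc, hn, hs, PiLp.smul_apply, PiLp.smul_apply, smul_eq_mul, smul_eq_mul,
      ← mul_assoc, hsinc, hsin]
    have : x m.castSucc = ‖horiz x‖ * u m := by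
      have := congrArg (fun y : E7 => y m) hhu
      simpa [horiz] using this
    rw [this]
    ring

theorem g8_eq {Γ : Fin 7 → Mat8} (hΓ : IsGammaSystem Γ) {x : E8} (hx : x ≠ 0) :
    g8 Γ x = gell Γ (‖x‖⁻¹ • x) := by
  rw [g8, exp8_eq hΓ, ballToSphere_sphereToBall hx]

theorem g8_ballToSphere {Γ : Fin 7 → Mat8} (hΓ : IsGammaSystem Γ) (α : E7) :
    g8 Γ (ballToSphere α) = exp8 Γ α := by
  have h : ballToSphere α ≠ 0 := norm_ne_zero_iff.mp (by rw [norm_ballToSphere]; exact one_ne_zero)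
  rw [g8_eq hΓ h, exp8_eq hΓ, norm_ballToSphere, inv_one, one_smul]

theorem IsGammaSystem.gdot_im {Γ : Fin 7 → Mat8} (hΓ : IsGammaSystem Γ) (α : Fin 7 → ℝ) (a b) :
    (gdot Γ α a b).im = 0 := by
  rw [gdot, Matrix.sum_apply, Complex.im_sum]
  refine Finset.sum_eq_zero fun m _ => ?_
  simp [hΓ.imaginary]

theorem IsGammaSystem.gdot_transpose {Γ : Fin 7 → Mat8} (hΓ : IsGammaSystem Γ) (α : Fin 7 → ℝ) :
    (gdot Γ α).transpose = -gdot Γ α := by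
  rw [gdot, Matrix.transpose_sum, ← Finset.sum_neg_distrib]
  simp only [Matrix.transpose_smul, hΓ.antisymm, smul_neg]

theorem IsGammaSystem.gell_im {Γ : Fin 7 → Mat8} (hΓ : IsGammaSystem Γ) (x : E8) (a b) :
    (gell Γ x a b).im = 0 := by
  rw [gell, Matrix.add_apply, Complex.add_im, hΓ.gdot_im, add_zero, Matrix.smul_apply,
    Matrix.one_apply]
  split_ifs <;> simp

theorem IsGammaSystem.exp8_mul_transpose {Γ : Fin 7 → Mat8} (hΓ : IsGammaSystem Γ) (α : E7) :
    exp8 Γ α * (exp8 Γ α).transpose = 1 := by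
  have h1 : exp8 Γ α = NormedSpace.exp (gdot Γ α) := rfl
  have h2 : IsUnit (NormedSpace.exp (gdot Γ α)).det :=
    (Matrix.isUnit_iff_isUnit_det _).mp (Matrix.isUnit_exp _)
  rw [h1, ← Matrix.exp_transpose, hΓ.gdot_transpose, Matrix.exp_neg, Matrix.mul_nonsing_inv _ h2]

theorem IsGammaSystem.exp8_isSO {Γ : Fin 7 → Mat8} (hΓ : IsGammaSystem Γ) (α : E7) :
    IsSO (exp8 Γ α) := by
  refine ⟨hΓ.exp8_mul_transpose α, ?_, fun a b => ?_⟩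
  -- The exponential is the square of the exponential of half the argument, whose determinant
  -- squares to 1.
  · have h := congrArg Matrix.det (hΓ.exp8_mul_transpose ((2 : ℝ)⁻¹ • α))
    rw [Matrix.det_mul, Matrix.det_transpose, Matrix.det_one] at h
    have h2 : exp8 Γ α = exp8 Γ ((2 : ℝ)⁻¹ • α) * exp8 Γ ((2 : ℝ)⁻¹ • α) := by
      have h3 : exp8 Γ ((2 : ℝ)⁻¹ • α) = NormedSpace.exp (gdot Γ fun m => (2 : ℝ)⁻¹ * α m) := rfl
      have h4 : exp8 Γ α = NormedSpace.exp (gdot Γ α) := rfl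
      rw [h3, ← sq, ← Matrix.exp_nsmul, h4, gdot_smul, ← Nat.cast_smul_eq_nsmul ℂ, smul_smul]
      norm_num
    rw [h2, Matrix.det_mul, h]
  · rw [exp8_eq hΓ]
    exact hΓ.gell_im _ a b

theorem IsGammaSystem.g8_isSphereMap {Γ : Fin 7 → Mat8} (hΓ : IsGammaSystem Γ) :
    IsSphereMapToSO8 (g8 Γ) := by
  refine IsSphereMapToSO8.mk' (fun c x hc => ?_) (fun x hx => ?_) fun x _ => hΓ.exp8_isSO _
  · rcases eq_or_ne x 0 with rfl | hx
    · rw [smul_zero]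
    · rw [g8_eq hΓ hx, g8_eq hΓ (smul_ne_zero hc.ne' hx), norm_smul, Real.norm_of_nonneg hc.le,
        smul_smul, mul_inv, mul_comm c⁻¹, mul_assoc, inv_mul_cancel₀ hc.ne', mul_one]
  · refine MSmoothAt.congr (f := fun y => gell Γ (‖y‖⁻¹ • y)) ?_
      ((IsSphereMapToSO8.eventually_ne hx).mono fun y hy => g8_eq hΓ hy)
    intro a b
    have h0 : ContDiffAt ℝ ∞ (fun y : E8 => ‖y‖⁻¹) x :=
      (contDiffAt_norm ℝ hx).inv (norm_ne_zero_iff.mpr hx)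
    have h1 : ∀ i : Fin 8, ContDiffAt ℝ ∞ (fun y : E8 => ((‖y‖⁻¹ * y i : ℝ) : ℂ)) x := fun i =>
      Complex.ofRealCLM.contDiff.contDiffAt.comp x
        (h0.mul (EuclideanSpace.proj (𝕜 := ℝ) i).contDiff.contDiffAt)
    simp only [gell, gdot, Matrix.add_apply, Matrix.smul_apply, Matrix.sum_apply, smul_eq_mul,
      PiLp.smul_apply]
    exact ((h1 7).mul contDiffAt_const).add (ContDiffAt.sum fun m _ =>
      (contDiffAt_const.mul (h1 _)).mul contDiffAt_const)


/-! ### The map `g₇` -/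

/-- The reflection `diag (-1, …, -1, 1)` as a complex matrix. -/
noncomputable def refl8 : Mat8 := cx (zr cStd)

theorem refl8_sq : refl8 * refl8 = 1 := by
  have h : cStd * cStd = 1 := by
    rw [cStd, monoMat_mul, ← monoMat_one]
    refine congrArg monoMat ?_
    decide
  rw [refl8, ← map_mul, ← map_mul, h, map_one, map_one]

theorem refl8_transpose : refl8.transpose = refl8 := by
  have h : ∀ i j, decide (cStd j i = cStd i j) = true := by decide +kernel
  ext i j
  simp [refl8, cx_apply, zr_apply, of_decide_eq_true (h i j)]

theorem refl8_det : refl8.det = -1 := by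
  have h : refl8 = Matrix.diagonal fun i => if i = 7 then 1 else -1 := by
    ext i j
    have : refl8 i j = ((cStd i j : ℝ) : ℂ) := rfl
    rw [this, cStd, monoMat, cTab, Matrix.diagonal_apply]
    split_ifs <;> simp
  rw [h, Matrix.det_diagonal, Fin.prod_univ_castSucc]
  have : ∀ i : Fin 7, (if i.castSucc = (7 : Fin 8) then (1 : ℂ) else -1) = -1 := fun i =>
    if_neg (Fin.castSucc_lt_last i).ne
  rw [Finset.prod_congr rfl fun i _ => this i]
  norm_num
  rfl

theorem refl8_im (a b) : (refl8 a b).im = 0 := Complex.ofReal_im _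

theorem gdot_gammaStd (α : Fin 7 → ℝ) : gdot gammaStd α = ∑ m, (α m : ℂ) • cx (zr (lStd m)) := by
  refine Finset.sum_congr rfl fun m _ => ?_
  rw [gammaStd_eq, smul_smul]
  congr 1
  linear_combination (-(α m : ℂ)) * Complex.I_sq

/-- `lStd_octF` rewritten for Γ = -iL: since Γₙ Γₖ = -Lₙ Lₖ, the exponent is -L(α) + 2 C L(α) C. -/
theorem exp7_gammaStd_exponent (α : E7) :
    -((1 / 2 : ℂ) • ∑ m, ∑ n, ∑ k, ((α m : ℂ) * (octF m n k : ℂ)) • (gammaStd n * gammaStd k)) =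
      -gdot gammaStd α + refl8 * ((2 : ℕ) • gdot gammaStd α) * refl8 := by
  have h : ∀ m, ∑ n, ∑ k, ((α m : ℂ) * (octF m n k : ℂ)) • (gammaStd n * gammaStd k) =
      (α m : ℂ) • ((2 : ℂ) • (cx (zr (lStd m)) -
        (2 : ℂ) • (refl8 * cx (zr (lStd m)) * refl8))) := fun m => by
    have h1 : ∀ n k, ((α m : ℂ) * (octF m n k : ℂ)) • (gammaStd n * gammaStd k) =
        (-(α m : ℂ)) • cx (zr (octF m n k • (lStd n * lStd k))) := fun n k => by
      rw [gammaStd_eq, gammaStd_eq, smul_mul_smul_comm, neg_mul_neg, Complex.I_mul_I, map_zsmul,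
        map_zsmul, map_mul, map_mul, neg_one_smul, smul_neg, neg_smul, mul_smul,
        Int.cast_smul_eq_zsmul]
    simp only [h1, ← Finset.smul_sum, ← map_sum, lStd_octF]
    rw [neg_smul, ← smul_neg, map_nsmul, map_nsmul, map_add, map_add, map_nsmul, map_nsmul,
      map_neg, map_neg, map_mul, map_mul, map_mul, map_mul, ← Nat.cast_smul_eq_nsmul ℂ,
      ← Nat.cast_smul_eq_nsmul ℂ, Nat.cast_ofNat, ← smul_neg]
    rw [refl8, neg_add, neg_neg, sub_eq_add_neg]
  simp only [h]
  rw [gdot_gammaStd, ← Nat.cast_smul_eq_nsmul ℂ, Nat.cast_ofNat, Finset.smul_sum,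
    Finset.smul_sum, Finset.mul_sum, Finset.sum_mul, ← Finset.sum_neg_distrib,
    ← Finset.sum_neg_distrib, ← Finset.sum_add_distrib]
  refine Finset.sum_congr rfl fun m _ => ?_
  simp only [mul_smul_comm, smul_mul_assoc]
  module

/-- A double sum with the symmetric weights αₘ αₙ sees only the part symmetric in m and n, for which
`lStd_commute` applies. -/
theorem gdot_gammaStd_commute (α : Fin 7 → ℝ) :
    Commute (gdot gammaStd α) (refl8 * gdot gammaStd α * refl8) := by
  set D : Fin 7 → Mat8 := fun m => cx (zr (lStd m))
  have h : ∀ m n, D m * (refl8 * D n * refl8) + D n * (refl8 * D m * refl8) =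
      refl8 * D n * refl8 * D m + refl8 * D m * refl8 * D n := fun m n => by
    simp only [D, refl8, ← map_mul, ← map_add, lStd_commute]
  have h1 : ∀ X Y : Fin 7 → Fin 7 → Mat8, (∀ m n, X m n + X n m = Y m n + Y n m) →
      ∑ m, ∑ n, ((α m : ℂ) * α n) • X m n = ∑ m, ∑ n, ((α m : ℂ) * α n) • Y m n := by
    intro X Y hXY
    have h2 : ∀ X : Fin 7 → Fin 7 → Mat8, (2 : ℂ) • ∑ m, ∑ n, ((α m : ℂ) * α n) • X m n =
        ∑ m, ∑ n, ((α m : ℂ) * α n) • (X m n + X n m) := fun X => by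
      rw [two_smul]
      nth_rewrite 2 [Finset.sum_comm]
      simp only [smul_add, Finset.sum_add_distrib]
      simp only [mul_comm]
    have h3 := h2 X
    simp only [hXY] at h3
    rw [← h2 Y] at h3
    exact smul_right_injective _ (two_ne_zero' ℂ) h3
  have h4 := h1 (fun m n => D m * (refl8 * D n * refl8)) (fun m n => refl8 * D m * refl8 * D n)
    fun m n => by rw [h m n, add_comm]
  rw [commute_iff_eq, gdot_gammaStd]
  refine Eq.trans ?_ (h4.trans ?_)
  · simp only [Finset.mul_sum, Finset.sum_mul, mul_smul_comm, smul_mul_assoc, Finset.smul_sum,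
      smul_smul, D]
    rw [Finset.sum_comm]
    simp only [mul_comm]
  · simp only [Finset.mul_sum, Finset.sum_mul, mul_smul_comm, smul_mul_assoc, Finset.smul_sum,
      smul_smul, D]
    rw [Finset.sum_comm]
    exact Finset.sum_congr rfl fun m _ => Finset.sum_congr rfl fun n _ => by
      rw [mul_comm (α m : ℂ)]

/-- The two summands of the exponent commute, so the exponential splits; C is its own inverse and
transpose and passes out of the second factor. This formula also shows that g₇ is well defined and
smooth on the whole sphere. -/
theorem exp7_gammaStd (α : E7) : exp7 gammaStd α =
    (exp8 gammaStd α)⁻¹ * (refl8 * (exp8 gammaStd α * exp8 gammaStd α) * refl8.transpose) := by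
  have h1 : exp8 gammaStd α = NormedSpace.exp (gdot gammaStd α) := rfl
  have hinv : refl8⁻¹ = refl8 := Matrix.inv_eq_right_inv refl8_sq
  have hu : IsUnit refl8 := IsUnit.of_mul_eq_one _ refl8_sq
  have h2 : NormedSpace.exp (refl8 * ((2 : ℕ) • gdot gammaStd α) * refl8) =
      refl8 * (exp8 gammaStd α * exp8 gammaStd α) * refl8 := by
    have h3 := Matrix.exp_conj refl8 ((2 : ℕ) • gdot gammaStd α) hu
    rw [hinv] at h3
    rw [h3, Matrix.exp_nsmul, h1, sq]
  rw [exp7, exp7_gammaStd_exponent, Matrix.exp_add_of_commute, h2, Matrix.exp_neg, refl8_transpose,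
    h1]
  refine Commute.neg_left ?_
  rw [mul_smul_comm, smul_mul_assoc]
  exact (gdot_gammaStd_commute _).smul_right 2

theorem g7_gammaStd (x : E8) : g7 gammaStd x =
    (g8 gammaStd x)⁻¹ * (refl8 * (g8 gammaStd x * g8 gammaStd x) * refl8.transpose) :=
  exp7_gammaStd _

theorem g7_gammaStd_isSphereMap : IsSphereMapToSO8 (g7 gammaStd) := by
  have h := isGammaSystem_gammaStd.g8_isSphereMap
  rw [funext g7_gammaStd]
  exact h.inv.mul ((h.mul h).conj (by rw [refl8_transpose, refl8_sq]) refl8_im)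

/-- g₈⁻¹ contributes -1 and the conjugated square 2 χ(C). As C reverses orientation, this is 1 for
the trace and -3 for the Pfaffian. -/
theorem mapCharge_g7_gammaStd (P : InvPoly) : mapCharge P (g7 gammaStd) =
    (2 * P.χ refl8 - 1) * mapCharge P (g8 gammaStd) := by
  have h := isGammaSystem_gammaStd.g8_isSphereMap
  have hC : refl8 * refl8.transpose = 1 := by rw [refl8_transpose, refl8_sq]
  rw [funext g7_gammaStd, mapCharge_mul P h.inv ((h.mul h).conj hC refl8_im), mapCharge_inv P h,
    mapCharge_conj P (h.mul h) hC, mapCharge_mul P h h]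
  ring

/-! ### Change of the gamma matrices -/

theorem exp_conj_transpose {O : Mat8} (hO : O * O.transpose = 1) (X : Mat8) :
    NormedSpace.exp (O * X * O.transpose) = O * NormedSpace.exp X * O.transpose := by
  rw [← Matrix.inv_eq_right_inv hO]
  exact Matrix.exp_conj _ _ (IsUnit.of_mul_eq_one _ hO)

theorem exp8_conj {Γ Γ' : Fin 7 → Mat8} {O : Mat8} (hO : O * O.transpose = 1)
    (h : ∀ k, Γ k = O * Γ' k * O.transpose) (α : E7) :
    exp8 Γ α = O * exp8 Γ' α * O.transpose := by
  rw [exp8, exp8, ← exp_conj_transpose hO, Finset.mul_sum, Finset.sum_mul]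
  simp only [h, mul_smul_comm, smul_mul_assoc]

theorem exp7_conj {Γ Γ' : Fin 7 → Mat8} {O : Mat8} (hO : O * O.transpose = 1)
    (h : ∀ k, Γ k = O * Γ' k * O.transpose) (α : E7) :
    exp7 Γ α = O * exp7 Γ' α * O.transpose := by
  have h1 : ∀ n k, Γ n * Γ k = O * (Γ' n * Γ' k) * O.transpose := fun n k => by
    rw [h, h]
    calc O * Γ' n * O.transpose * (O * Γ' k * O.transpose) =
        O * Γ' n * (O.transpose * O) * Γ' k * O.transpose := by noncomm_ring
      _ = _ := by rw [mul_eq_one_comm.mp hO]; noncomm_ring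
  rw [exp7, exp7, ← exp_conj_transpose hO]
  simp only [h1, mul_neg, neg_mul, mul_smul_comm, smul_mul_assoc, Finset.mul_sum, Finset.sum_mul]

/-! ### Composites -/

theorem IsSphereMapToSO8.zpow {g : E8 → Mat8} (hg : IsSphereMapToSO8 g) (n : ℤ) :
    IsSphereMapToSO8 fun x => g x ^ n := by
  have h : ∀ n : ℕ, IsSphereMapToSO8 fun x => g x ^ n := fun n => by
    induction n with
    | zero => simpa only [pow_zero] using IsSphereMapToSO8.one
    | succ n ih => simpa only [pow_succ] using ih.mul hg
  obtain ⟨k, rfl | rfl⟩ := n.eq_nat_or_neg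
  · simpa only [zpow_natCast] using h k
  · simpa only [Matrix.zpow_neg_natCast] using (h k).inv

theorem mapCharge_zpow (P : InvPoly) {g : E8 → Mat8} (hg : IsSphereMapToSO8 g) (n : ℤ) :
    mapCharge P (fun x => g x ^ n) = n * mapCharge P g := by
  have h : ∀ n : ℕ, (IsSphereMapToSO8 fun x => g x ^ n) ∧
      mapCharge P (fun x => g x ^ n) = n * mapCharge P g := fun n => by
    induction n with
    | zero => simpa [mapCharge_one] using IsSphereMapToSO8.one
    | succ n ih =>
      simp only [pow_succ]
      refine ⟨ih.1.mul hg, ?_⟩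
      rw [mapCharge_mul P ih.1 hg, ih.2]
      push_cast
      ring
  obtain ⟨k, rfl | rfl⟩ := n.eq_nat_or_neg
  · simpa only [zpow_natCast, Int.cast_natCast] using (h k).2
  · simp only [Matrix.zpow_neg_natCast]
    rw [mapCharge_inv P (h k).1, (h k).2]
    push_cast
    ring


/-! ### Second moments of the sphere -/

/-- 8 is the inverse of ∫₀¹ r⁷ dr. As an integral over the ball, the sphere integral inherits the
rotation invariance of Lebesgue measure. -/
theorem sphere_integral_eq (Φ : E8 → ℂ) :
    ∫ z : Metric.sphere (0 : E8) 1, Φ z ∂(volume : Measure E8).toSphere =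
      8 * ∫ x : E8, (Set.Ioc (0 : ℝ) 1).indicator (fun _ => (1 : ℂ)) ‖x‖ * Φ (‖x‖⁻¹ • x) := by
  have h : ∫ r in Set.Ioi (0 : ℝ), ((r : ℂ) ^ 7) *
      (Set.Ioc (0 : ℝ) 1).indicator (fun _ => (1 : ℂ)) r = 1 / 8 := by
    have h1 : ∀ r : ℝ, ((r : ℂ) ^ 7) * (Set.Ioc (0 : ℝ) 1).indicator (fun _ => (1 : ℂ)) r =
        (Set.Ioc (0 : ℝ) 1).indicator (fun r : ℝ => ((r ^ 7 : ℝ) : ℂ)) r := fun r => by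
      by_cases hr : r ∈ Set.Ioc (0 : ℝ) 1 <;> simp [hr]
    simp only [h1]
    rw [setIntegral_indicator measurableSet_Ioc,
      Set.inter_eq_self_of_subset_right Set.Ioc_subset_Ioi_self]
    refine (integral_ofReal (𝕜 := ℂ) (f := fun r : ℝ => r ^ 7)).trans ?_
    rw [← intervalIntegral.integral_of_le zero_le_one, integral_pow]
    norm_num
  rw [integral_radial_mul_angular, h]
  ring

theorem sphere_integral_comp (T : E8 ≃ₗᵢ[ℝ] E8) (Φ : E8 → ℂ) :
    ∫ z : Metric.sphere (0 : E8) 1, Φ (T z) ∂(volume : Measure E8).toSphere =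
      ∫ z : Metric.sphere (0 : E8) 1, Φ z ∂(volume : Measure E8).toSphere := by
  rw [sphere_integral_eq Φ, sphere_integral_eq fun z => Φ (T z),
    ← T.measurePreserving.integral_comp T.toHomeomorph.measurableEmbedding
      fun x => (Set.Ioc (0 : ℝ) 1).indicator (fun _ => (1 : ℂ)) ‖x‖ * Φ (‖x‖⁻¹ • x)]
  simp only [LinearIsometryEquiv.norm_map, map_smul]

theorem sphere_integral_norm_one : ∫ _ : Metric.sphere (0 : E8) 1, (1 : ℂ)
    ∂(volume : Measure E8).toSphere = (Real.pi : ℂ) ^ 4 / 3 := by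
  have h : (volume : Measure E8).toSphere.real Set.univ = Real.pi ^ 4 / 3 := by
    rw [Measure.toSphere_real_apply_univ, measureReal_def,
      InnerProductSpace.volume_ball_of_dim_even (k := 4) (by simp)]
    rw [ENNReal.toReal_mul, ← ENNReal.ofReal_pow zero_le_one, one_pow,
      ENNReal.toReal_ofReal (by positivity), ENNReal.toReal_ofReal (by positivity)]
    simp [Nat.factorial]
    ring
  rw [integral_const, h]
  simp

/-- Exchanges of coordinates make the eight diagonal moments equal, and they sum to the area π⁴/3; a
reflection in one coordinate kills the others. -/
theorem sphere_integral_coord_mul (a b : Fin 8) :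
    ∫ z : Metric.sphere (0 : E8) 1, (((z : E8) a * (z : E8) b : ℝ) : ℂ)
      ∂(volume : Measure E8).toSphere = if a = b then (Real.pi : ℂ) ^ 4 / 24 else 0 := by
  have hint : ∀ a : Fin 8, Integrable (fun z : Metric.sphere (0 : E8) 1 =>
      (((z : E8) a * (z : E8) a : ℝ) : ℂ)) (volume : Measure E8).toSphere := fun a =>
    Continuous.integrable_of_hasCompactSupport (by fun_prop) (HasCompactSupport.of_compactSpace _)
  split_ifs with h
  · subst h
    have h1 : ∀ b, ∫ z : Metric.sphere (0 : E8) 1, (((z : E8) b * (z : E8) b : ℝ) : ℂ)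
        ∂(volume : Measure E8).toSphere = ∫ z : Metric.sphere (0 : E8) 1,
          (((z : E8) a * (z : E8) a : ℝ) : ℂ) ∂(volume : Measure E8).toSphere := fun b => by
      rw [← sphere_integral_comp (LinearIsometryEquiv.piLpCongrLeft 2 ℝ ℝ (Equiv.swap a b))
        fun x => ((x b * x b : ℝ) : ℂ)]
      congr 1
      funext z
      simp [LinearIsometryEquiv.piLpCongrLeft_apply]
    have h2 : ∑ b, ∫ z : Metric.sphere (0 : E8) 1, (((z : E8) b * (z : E8) b : ℝ) : ℂ)
        ∂(volume : Measure E8).toSphere = (Real.pi : ℂ) ^ 4 / 3 := by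
      rw [← integral_finsetSum _ fun b _ => hint b, ← sphere_integral_norm_one]
      congr 1
      funext z
      rw [← ofReal_sum]
      have h3 : ‖(z : E8)‖ = 1 := norm_eq_of_mem_sphere z
      have h4 := EuclideanSpace.real_norm_sq_eq (z : E8)
      rw [h3, one_pow] at h4
      simp only [← sq]
      rw [← h4, ofReal_one]
    simp only [h1, Finset.sum_const, Finset.card_univ, Fintype.card_fin, nsmul_eq_mul] at h2
    push_cast at h2 ⊢
    linear_combination h2 / 8
  · have h1 := sphere_integral_comp (LinearIsometryEquiv.piLpCongrRight 2 fun i : Fin 8 =>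
      if i = a then LinearIsometryEquiv.neg ℝ else LinearIsometryEquiv.refl ℝ ℝ)
        fun x => ((x a * x b : ℝ) : ℂ)
    have h2 : ∀ z : E8, ((((LinearIsometryEquiv.piLpCongrRight 2 fun i : Fin 8 =>
      if i = a then LinearIsometryEquiv.neg ℝ else LinearIsometryEquiv.refl ℝ ℝ) z) a *
      ((LinearIsometryEquiv.piLpCongrRight 2 fun i : Fin 8 =>
      if i = a then LinearIsometryEquiv.neg ℝ else LinearIsometryEquiv.refl ℝ ℝ) z) b : ℝ) : ℂ) =
        -((z a * z b : ℝ) : ℂ) := fun z => by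
      simp [Ne.symm h]
    simp only [h2] at h1
    rw [integral_neg] at h1
    linear_combination -h1 / 2

/-! ### Alternating products of Clifford frames -/

/-- Eight matrices `ℓₐ` such that `ℓₐᵀ ℓ_b + ℓ_bᵀ ℓₐ = 2 δₐ_b` and `ℓₐ ℓ_bᵀ + ℓ_b ℓₐᵀ = 2 δₐ_b`. -/
structure IsFrame (l : Fin 8 → Mat8) : Prop where
  sq : ∀ a, (l a).transpose * l a = 1
  anti : ∀ a b, a ≠ b → (l a).transpose * l b = -((l b).transpose * l a)
  anti' : ∀ a b, a ≠ b → l a * (l b).transpose = -(l b * (l a).transpose)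

/-- The bilinear expressions `ℓₐᵀ ℓ_b`. -/
def frameMul (l : Fin 8 → Mat8) (a b : Fin 8) : Mat8 := (l a).transpose * l b

namespace IsFrame

variable {l : Fin 8 → Mat8}

theorem transpose_frameMul (hl : IsFrame l) {a b : Fin 8} (h : a ≠ b) :
    (frameMul l a b).transpose = -frameMul l a b := by
  rw [frameMul, Matrix.transpose_mul, Matrix.transpose_transpose, hl.anti a b h, neg_neg]

theorem frameMul_swap (hl : IsFrame l) {a b : Fin 8} (h : a ≠ b) :
    frameMul l a b = -frameMul l b a := hl.anti a b h

theorem frameMul_mul (hl : IsFrame l) (a d : Fin 8) {b c : Fin 8} (h : b ≠ c) :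
    frameMul l a b * frameMul l c d = -(frameMul l a c * frameMul l b d) := by
  calc frameMul l a b * frameMul l c d =
      (l a).transpose * (l b * (l c).transpose) * l d := by
        simp only [frameMul, mul_assoc]
    _ = _ := by
        rw [hl.anti' b c h]
        simp only [frameMul, mul_assoc, mul_neg, neg_mul]

theorem frameMul_self (hl : IsFrame l) (a : Fin 8) : frameMul l a a = 1 := hl.sq a

theorem frameMul_mul_self (hl : IsFrame l) (a b d : Fin 8) :
    frameMul l a b * frameMul l b d = frameMul l a d := by
  have h : l b * (l b).transpose = 1 := mul_eq_one_comm.mp (hl.sq b)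
  calc frameMul l a b * frameMul l b d =
      (l a).transpose * (l b * (l b).transpose) * l d := by
        simp only [frameMul, mul_assoc]
    _ = _ := by rw [h, mul_one, frameMul]

theorem frameMul_commute (hl : IsFrame l) {a b c d : Fin 8} (hac : a ≠ c) (had : a ≠ d)
    (hbc : b ≠ c) (hbd : b ≠ d) :
    frameMul l a b * frameMul l c d = frameMul l c d * frameMul l a b := by
  rw [hl.frameMul_mul a d hbc, hl.frameMul_swap hac, hl.frameMul_swap hbd, neg_mul_neg,
    hl.frameMul_mul c b had, neg_neg]

/-- Exchange of two neighbouring indices, from the invariance under `ℓ_bᵀ ℓ_c`. -/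
theorem exchange (P : InvPoly) (hl : IsFrame l) {a b c d e f g h : Fin 8} (hab : a ≠ b)
    (hac : a ≠ c) (hbc : b ≠ c) (hbd : b ≠ d) (hcd : c ≠ d) (hbe : b ≠ e) (hbf : b ≠ f)
    (hbg : b ≠ g) (hbh : b ≠ h) (hce : c ≠ e) (hcf : c ≠ f) (hcg : c ≠ g) (hch : c ≠ h) :
    P (frameMul l a c) (frameMul l b d) (frameMul l e f) (frameMul l g h) =
      -P (frameMul l a b) (frameMul l c d) (frameMul l e f) (frameMul l g h) := by
  -- The commutator with ℓ_bᵀ ℓ_c rotates the indices b and c into each other and annihilates the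
  -- bilinears that contain neither.
  have h1 := P.lie (frameMul l b c) (frameMul l a b) (frameMul l b d) (frameMul l e f)
    (frameMul l g h) (hl.transpose_frameMul hbc)
  have e1 : frameMul l b c * frameMul l a b - frameMul l a b * frameMul l b c =
      (-2 : ℂ) • frameMul l a c := by
    rw [hl.frameMul_mul b b hac.symm, hl.frameMul_swap hab.symm, hl.frameMul_swap hbc.symm,
      neg_mul_neg, hl.frameMul_mul_self]
    module
  have e2 : frameMul l b c * frameMul l b d - frameMul l b d * frameMul l b c =
      (-2 : ℂ) • frameMul l c d := by
    rw [hl.frameMul_mul b d hbc.symm, hl.frameMul_mul b c hbd.symm, hl.frameMul_self, one_mul,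
      one_mul, hl.frameMul_swap hcd.symm]
    module
  rw [e1, e2, hl.frameMul_commute hbe hbf hce hcf, hl.frameMul_commute hbg hbh hcg hch, sub_self,
    sub_self, P.smul0, P.smul1, P.swap12 _ _ 0, P.swap01 _ 0, P.zero0, P.swap23 _ _ _ 0,
    P.swap12 _ _ 0, P.swap01 _ 0, P.zero0] at h1
  linear_combination -h1 / 2

end IsFrame


namespace IsFrame

variable {l : Fin 8 → Mat8}

/-- The invariant polynomial of the bilinears of a frame is alternating. -/
theorem alternating (P : InvPoly) (hl : IsFrame l) (ρ : Equiv.Perm (Fin 8)) :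
    ∀ σ : Equiv.Perm (Fin 8),
      P (frameMul l (σ (ρ 0)) (σ (ρ 1))) (frameMul l (σ (ρ 2)) (σ (ρ 3)))
        (frameMul l (σ (ρ 4)) (σ (ρ 5))) (frameMul l (σ (ρ 6)) (σ (ρ 7))) =
      ((Equiv.Perm.sign ρ : ℤ) : ℂ) *
      P (frameMul l (σ 0) (σ 1)) (frameMul l (σ 2) (σ 3))
        (frameMul l (σ 4) (σ 5)) (frameMul l (σ 6) (σ 7)) := by
  -- Neighbouring transpositions generate the group. Inside a pair the sign is the antisymmetry of
  -- `frameMul`, across two pairs it is `exchange`.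
  have hρ : ρ ∈ Submonoid.closure (Set.range fun i : Fin 7 =>
      Equiv.swap i.castSucc i.succ) := by
    rw [Equiv.Perm.mclosure_swap_castSucc_succ]; trivial
  induction hρ using Submonoid.closure_induction with
  | one => simp
  | mul ρ τ _ _ h1 h2 =>
    intro σ
    have h3 := h2 (σ * ρ)
    simp only [Equiv.Perm.mul_apply] at h3 ⊢
    rw [h3, h1 σ, Equiv.Perm.sign_mul]
    push_cast
    ring
  | mem x hx =>
    obtain ⟨i, rfl⟩ := hx
    intro σ
    have hne : ∀ {a b : Fin 8}, a ≠ b → σ a ≠ σ b := fun h => σ.injective.ne h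
    have hs : Equiv.Perm.sign (Equiv.swap i.castSucc i.succ) = -1 :=
      Equiv.Perm.sign_swap (Fin.castSucc_lt_succ).ne
    rw [hs]
    have ex : ∀ {a b c d e f g h : Fin 8}, a ≠ b → a ≠ c → b ≠ c → b ≠ d → c ≠ d → b ≠ e → b ≠ f →
        b ≠ g → b ≠ h → c ≠ e → c ≠ f → c ≠ g → c ≠ h →
        P (frameMul l (σ a) (σ c)) (frameMul l (σ b) (σ d)) (frameMul l (σ e) (σ f))
          (frameMul l (σ g) (σ h)) = -P (frameMul l (σ a) (σ b)) (frameMul l (σ c) (σ d))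
          (frameMul l (σ e) (σ f)) (frameMul l (σ g) (σ h)) :=
      fun h1 h2 h3 h4 h5 h6 h7 h8 h9 h10 h11 h12 h13 =>
        hl.exchange P (hne h1) (hne h2) (hne h3) (hne h4) (hne h5) (hne h6) (hne h7) (hne h8)
          (hne h9) (hne h10) (hne h11) (hne h12) (hne h13)
    have v : ∀ i j k : Fin 8, Equiv.swap i j k = if k = i then j else if k = j then i else k :=
      fun i j k => Equiv.swap_apply_def i j k
    simp only [v]
    fin_cases i
    · change P (frameMul l (σ 1) (σ 0)) (frameMul l (σ 2) (σ 3)) (frameMul l (σ 4) (σ 5))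
        (frameMul l (σ 6) (σ 7)) = _
      rw [hl.frameMul_swap (hne (by decide)), P.neg0]
      simp
    · change P (frameMul l (σ 0) (σ 2)) (frameMul l (σ 1) (σ 3)) (frameMul l (σ 4) (σ 5))
        (frameMul l (σ 6) (σ 7)) = _
      rw [ex (by decide) (by decide) (by decide) (by decide) (by decide) (by decide) (by decide)
        (by decide) (by decide) (by decide) (by decide) (by decide) (by decide)]
      simp
    · change P (frameMul l (σ 0) (σ 1)) (frameMul l (σ 3) (σ 2)) (frameMul l (σ 4) (σ 5))
        (frameMul l (σ 6) (σ 7)) = _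
      rw [hl.frameMul_swap (a := σ 3) (hne (by decide)), P.neg1]
      simp
    · change P (frameMul l (σ 0) (σ 1)) (frameMul l (σ 2) (σ 4)) (frameMul l (σ 3) (σ 5))
        (frameMul l (σ 6) (σ 7)) = _
      rw [P.swap01, P.swap12, ex (by decide) (by decide) (by decide) (by decide) (by decide)
        (by decide) (by decide) (by decide) (by decide) (by decide) (by decide) (by decide)
        (by decide), P.swap12, P.swap01]
      simp
    · change P (frameMul l (σ 0) (σ 1)) (frameMul l (σ 2) (σ 3)) (frameMul l (σ 5) (σ 4))
        (frameMul l (σ 6) (σ 7)) = _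
      rw [hl.frameMul_swap (a := σ 5) (hne (by decide)), P.swap12, P.neg1, P.swap12]
      simp
    · change P (frameMul l (σ 0) (σ 1)) (frameMul l (σ 2) (σ 3)) (frameMul l (σ 4) (σ 6))
        (frameMul l (σ 5) (σ 7)) = _
      rw [P.swap12, P.swap01, P.swap23, P.swap12, ex (by decide) (by decide) (by decide) (by decide)
        (by decide) (by decide) (by decide) (by decide) (by decide) (by decide) (by decide)
        (by decide) (by decide), P.swap12, P.swap23, P.swap01, P.swap12]
      simp
    · change P (frameMul l (σ 0) (σ 1)) (frameMul l (σ 2) (σ 3)) (frameMul l (σ 4) (σ 5))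
        (frameMul l (σ 7) (σ 6)) = _
      rw [hl.frameMul_swap (a := σ 7) (hne (by decide)), P.swap23, P.swap12, P.neg1, P.swap12,
        P.swap23]
      simp

/-- By `alternating` all 8! = 40320 signed terms are equal. -/
theorem altSum_eq (P : InvPoly) (hl : IsFrame l) :
    altSum (fun m => P (frameMul l (m 0) (m 1)) (frameMul l (m 2) (m 3))
      (frameMul l (m 4) (m 5)) (frameMul l (m 6) (m 7))) =
    40320 * P (frameMul l 0 1) (frameMul l 2 3) (frameMul l 4 5) (frameMul l 6 7) := by
  have h : ∀ σ : Equiv.Perm (Fin 8), ((Equiv.Perm.sign σ : ℤ) : ℂ) *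
      P (frameMul l (σ 0) (σ 1)) (frameMul l (σ 2) (σ 3)) (frameMul l (σ 4) (σ 5))
        (frameMul l (σ 6) (σ 7)) =
      P (frameMul l 0 1) (frameMul l 2 3) (frameMul l 4 5) (frameMul l 6 7) := fun σ => by
    have := hl.alternating P σ 1
    simp only [Equiv.Perm.one_apply] at this
    rw [this, ← mul_assoc, ← Int.cast_mul, ← Units.val_mul, Int.units_mul_self]
    simp
  rw [altSum, Finset.sum_congr rfl fun σ _ => h σ, Finset.sum_const, Finset.card_univ,
    Fintype.card_perm, Fintype.card_fin, nsmul_eq_mul]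
  norm_num [Nat.factorial]

end IsFrame

/-! ### The form of the linear map on the sphere -/

theorem gdot_add (Γ : Fin 7 → Mat8) (α β : Fin 7 → ℝ) :
    gdot Γ (fun m => α m + β m) = gdot Γ α + gdot Γ β := by
  simp only [gdot, ← Finset.sum_add_distrib, ofReal_add, mul_add, add_smul]

theorem gell_add (Γ : Fin 7 → Mat8) (x y : E8) : gell Γ (x + y) = gell Γ x + gell Γ y := by
  simp only [gell, PiLp.add_apply, gdot_add, ofReal_add, add_smul]
  abel

theorem gell_smul (Γ : Fin 7 → Mat8) (c : ℝ) (x : E8) :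
    gell Γ (c • x) = (c : ℂ) • gell Γ x := by
  simp only [gell, PiLp.smul_apply, smul_eq_mul, gdot_smul, ofReal_mul, smul_add, mul_smul]

theorem gell_eq_sum (Γ : Fin 7 → Mat8) (x : E8) :
    gell Γ x = ∑ k, (x k : ℂ) • gell Γ (EuclideanSpace.single k 1) := by
  have h : ∀ s : Finset (Fin 8), gell Γ (∑ k ∈ s, x k • EuclideanSpace.single k (1 : ℝ)) =
      ∑ k ∈ s, (x k : ℂ) • gell Γ (EuclideanSpace.single k 1) := fun s => by
    induction s using Finset.induction_on with
    | empty => simpa using gell_smul Γ 0 0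
    | insert a s ha ih => rw [Finset.sum_insert ha, Finset.sum_insert ha, gell_add, gell_smul, ih]
  rw [← h]
  congr 1
  ext i
  simp [Pi.single_apply]

namespace IsGammaSystem

variable {Γ : Fin 7 → Mat8}

theorem gell_transpose (hΓ : IsGammaSystem Γ) (x : E8) :
    (gell Γ x).transpose = (x 7 : ℂ) • (1 : Mat8) - gdot Γ fun m => x m.castSucc := by
  rw [gell, Matrix.transpose_add, hΓ.gdot_transpose, Matrix.transpose_smul, Matrix.transpose_one,
    sub_eq_add_neg]

theorem gell_mul_transpose (hΓ : IsGammaSystem Γ) (x : E8) :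
    gell Γ x * (gell Γ x).transpose = ((‖x‖ ^ 2 : ℝ) : ℂ) • (1 : Mat8) := by
  have h := hΓ.gdot_sq fun m => x m.castSucc
  rw [EuclideanSpace.real_norm_sq_eq, Fin.sum_univ_castSucc, ofReal_add, add_smul,
    hΓ.gell_transpose, gell]
  simp only [add_mul, mul_sub, smul_mul_assoc, mul_smul_comm, one_mul, mul_one, h]
  rw [smul_add, smul_smul, neg_smul, ← sq, ← ofReal_pow]
  change _ = _ + ((x 7 ^ 2 : ℝ) : ℂ) • (1 : Mat8)
  abel

theorem gell_mul_transpose_add (hΓ : IsGammaSystem Γ) (x y : E8) :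
    gell Γ x * (gell Γ y).transpose + gell Γ y * (gell Γ x).transpose =
      ((2 * inner ℝ x y : ℝ) : ℂ) • (1 : Mat8) := by
  have h := hΓ.gell_mul_transpose (x + y)
  rw [gell_add, Matrix.transpose_add, norm_add_sq_real, ofReal_add, ofReal_add, add_smul, add_smul,
    ← hΓ.gell_mul_transpose, ← hΓ.gell_mul_transpose, mul_add, add_mul, add_mul] at h
  have h' : gell Γ x * (gell Γ y).transpose + gell Γ y * (gell Γ x).transpose =
      (gell Γ x * (gell Γ x).transpose + gell Γ y * (gell Γ x).transpose +
      (gell Γ x * (gell Γ y).transpose + gell Γ y * (gell Γ y).transpose)) -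
      gell Γ x * (gell Γ x).transpose - gell Γ y * (gell Γ y).transpose := by abel
  rw [h', h]
  abel

theorem gell_transpose_mul_add (hΓ : IsGammaSystem Γ) (x y : E8) :
    (gell Γ x).transpose * gell Γ y + (gell Γ y).transpose * gell Γ x =
      ((2 * inner ℝ x y : ℝ) : ℂ) • (1 : Mat8) := by
  rw [← hΓ.gell_mul_transpose_add, hΓ.gell_transpose, hΓ.gell_transpose, gell, gell]
  simp only [add_mul, mul_add, sub_mul, mul_sub, smul_mul_assoc, mul_smul_comm, one_mul, mul_one]
  module

theorem isFrame (hΓ : IsGammaSystem Γ) : IsFrame fun a => gell Γ (EuclideanSpace.single a 1) where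
  sq a := mul_eq_one_comm.mp <| by
    rw [hΓ.gell_mul_transpose]
    simp
  anti a b h := eq_neg_of_add_eq_zero_left <| by
    rw [hΓ.gell_transpose_mul_add]
    simp [EuclideanSpace.inner_single_left, h]
  anti' a b h := eq_neg_of_add_eq_zero_left <| by
    rw [hΓ.gell_mul_transpose_add]
    simp [EuclideanSpace.inner_single_left, h]

/-- g₈ is the linear map ℓ composed with x/‖x‖, so its derivative at a unit vector is ℓ_M minus the
radial part x_M ℓ(x); there ℓ(x) is orthogonal. -/
theorem mc_g8 (hΓ : IsGammaSystem Γ) {x : E8} (hx : ‖x‖ = 1) (M : Fin 8) :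
    mc (g8 Γ) M x = (gell Γ x).transpose * gell Γ (EuclideanSpace.single M 1) -
      (x M : ℂ) • (1 : Mat8) := by
  have hx0 : x ≠ 0 := norm_ne_zero_iff.mp (by rw [hx]; exact one_ne_zero)
  have hg : g8 Γ x = gell Γ x := by rw [g8_eq hΓ hx0, hx, inv_one, one_smul]
  have hso := hΓ.g8_isSphereMap.isSO hx0
  have hpd : pd M (g8 Γ) x = gell Γ (EuclideanSpace.single M 1) - (x M : ℂ) • gell Γ x := by
    ext a b
    have h1 : (fun y => g8 Γ y a b) =ᶠ[𝓝 x] fun y => ((‖y‖⁻¹ : ℝ) : ℂ) * gell Γ y a b :=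
      (IsSphereMapToSO8.eventually_ne hx0).mono fun y hy => by
        simp only [g8_eq hΓ hy, gell_smul, Matrix.smul_apply, smul_eq_mul]
    have hn : HasFDerivAt (fun y : E8 => ‖y‖⁻¹) (-(innerSL ℝ x)) x := by
      have h2 : HasFDerivAt (fun y : E8 => ‖y‖) (innerSL ℝ x) x := by
        have h3 := ((hasStrictFDerivAt_norm_sq x).hasFDerivAt).sqrt (by simp [hx])
        simp only [Real.sqrt_sq (norm_nonneg _)] at h3
        refine h3.congr_fderiv ?_
        ext v
        simp [hx]
      refine (HasDerivAt.comp_hasFDerivAt x (hasDerivAt_inv (by rw [hx]; exact one_ne_zero))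
        h2).congr_fderiv ?_
      ext v
      simp [hx]
    obtain ⟨L, hL⟩ : ∃ L : E8 →L[ℝ] ℂ, ∀ y, L y = gell Γ y a b :=
      ⟨LinearMap.toContinuousLinearMap
        { toFun := fun y : E8 => gell Γ y a b
          map_add' := fun y z => by rw [gell_add, Matrix.add_apply]
          map_smul' := fun c y => by
            rw [gell_smul, Matrix.smul_apply, RingHom.id_apply, Complex.real_smul, smul_eq_mul] },
        fun _ => rfl⟩
    have hL' : HasFDerivAt (fun y => gell Γ y a b) L x := by
      have := L.hasFDerivAt (x := x)
      rwa [show ⇑L = fun y => gell Γ y a b from funext hL] at this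
    have h4 := ((Complex.ofRealCLM.hasFDerivAt.comp x hn).mul hL').congr_of_eventuallyEq h1
    rw [pd, Matrix.of_apply, h4.fderiv]
    simp [hx, hL, EuclideanSpace.inner_single_right]
    ring
  rw [mc, hso.inv_eq, hpd, hg, mul_sub, mul_smul_comm]
  rw [hg] at hso
  rw [hso.transpose_mul]

end IsGammaSystem


/-! ### The charge of the linear map -/

/-- The normal covector t wedged with itself vanishes. Thus every term of the integrand that
contains a further factor t can be dropped. -/
theorem altSum_coord_eq_zero (i : Fin 7) (t : Fin 8 → ℂ) {w : (Fin 8 → Fin 8) → ℂ}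
    (hw : ∀ m, w (m ∘ Equiv.swap 0 i.succ) = w m) :
    altSum (fun m => t (m 0) * (t (m i.succ) * w m)) = 0 := by
  refine altSum_eq_zero (Equiv.swap 0 i.succ) (Equiv.Perm.sign_swap (Fin.succ_ne_zero i).symm)
    fun m => ?_
  rw [hw]
  simp only [Function.comp_apply, Equiv.swap_apply_left, Equiv.swap_apply_right]
  ring

namespace InvPoly

/-- The alternating sum of `t P (A, B, C, D)`. -/
noncomputable def coordSum (P : InvPoly) (t : Fin 8 → ℂ) (A : Fin 8 → Mat8)
    (B C D : Fin 8 → Fin 8 → Mat8) : ℂ :=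
  altSum fun m => t (m 0) * P (A (m 1)) (B (m 2) (m 3)) (C (m 4) (m 5)) (D (m 6) (m 7))

variable (P : InvPoly) (t : Fin 8 → ℂ) (A : Fin 8 → Mat8) (B C D : Fin 8 → Fin 8 → Mat8)

theorem coordSum_swap12 : P.coordSum t A B C D = P.coordSum t A C B D := by
  have := altSum_comp (Equiv.swap 2 4 * Equiv.swap 3 5) fun m =>
    t (m 0) * P (A (m 1)) (C (m 2) (m 3)) (B (m 4) (m 5)) (D (m 6) (m 7))
  rw [show Equiv.Perm.sign (Equiv.swap (2 : Fin 8) 4 * Equiv.swap 3 5) = 1 by decide] at this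
  simp only [Units.val_one, Int.cast_one, one_mul] at this
  rw [coordSum, coordSum, ← this]
  refine altSum_congr fun σ => ?_
  rw [P.swap12]
  rfl

theorem coordSum_swap23 : P.coordSum t A B C D = P.coordSum t A B D C := by
  have := altSum_comp (Equiv.swap 4 6 * Equiv.swap 5 7) fun m =>
    t (m 0) * P (A (m 1)) (B (m 2) (m 3)) (D (m 4) (m 5)) (C (m 6) (m 7))
  rw [show Equiv.Perm.sign (Equiv.swap (4 : Fin 8) 6 * Equiv.swap 5 7) = 1 by decide] at this
  simp only [Units.val_one, Int.cast_one, one_mul] at this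
  rw [coordSum, coordSum, ← this]
  refine altSum_congr fun σ => ?_
  rw [P.swap23]
  rfl

theorem coordSum_sub_coord (R : Mat8) :
    P.coordSum t (fun a => A a - t a • R) B C D = P.coordSum t A B C D := by
  have h := altSum_coord_eq_zero 0 t
    (w := fun m => P R (B (m 2) (m 3)) (C (m 4) (m 5)) (D (m 6) (m 7))) fun m => rfl
  have h2 := altSum_sub (fun m => t (m 0) * P (A (m 1)) (B (m 2) (m 3)) (C (m 4) (m 5))
    (D (m 6) (m 7))) fun m => t (m 0) * (t (m (Fin.succ 0)) *
      P R (B (m 2) (m 3)) (C (m 4) (m 5)) (D (m 6) (m 7)))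
  rw [h, sub_zero] at h2
  rw [coordSum, coordSum, ← h2]
  refine altSum_congr fun σ => ?_
  rw [P.sub0, P.smul0, mul_sub]
  rfl

theorem coordSum_add_coord (R S : Fin 8 → Mat8) :
    P.coordSum t A (fun a b => B a b + t a • R b - t b • S a) C D = P.coordSum t A B C D := by
  have h1 := altSum_coord_eq_zero 1 t
    (w := fun m => P (A (m 1)) (R (m 3)) (C (m 4) (m 5)) (D (m 6) (m 7))) fun m => rfl
  have h2 := altSum_coord_eq_zero 2 t
    (w := fun m => P (A (m 1)) (S (m 2)) (C (m 4) (m 5)) (D (m 6) (m 7))) fun m => rfl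
  have h3 : P.coordSum t A B C D = P.coordSum t A B C D +
      altSum (fun m => t (m 0) * (t (m (Fin.succ 1)) *
        P (A (m 1)) (R (m 3)) (C (m 4) (m 5)) (D (m 6) (m 7)))) -
      altSum (fun m => t (m 0) * (t (m (Fin.succ 2)) *
        P (A (m 1)) (S (m 2)) (C (m 4) (m 5)) (D (m 6) (m 7)))) := by
    rw [h1, h2, add_zero, sub_zero]
  rw [h3, coordSum, coordSum, ← altSum_add, ← altSum_sub]
  refine altSum_congr fun σ => ?_
  rw [P.sub1, P.add1, P.smul1, P.smul1, mul_sub, mul_add]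
  rfl

theorem coordSum_neg : P.coordSum t A (fun a b => -B a b) C D = -P.coordSum t A B C D := by
  rw [coordSum, coordSum, ← altSum_neg]
  refine altSum_congr fun σ => ?_
  rw [P.neg1, mul_neg]

/-- Modulo terms with a further factor t, θ_a becomes `K a` and θ_a θ_b becomes -`Y a b`; the three
products give the overall sign. -/
theorem coordSum_sub_one {K : Fin 8 → Mat8} {Y : Fin 8 → Fin 8 → Mat8}
    (hK : ∀ a b, K a * K b = (2 * t a) • K b - Y a b) :
    altSum (fun m => t (m 0) * P (K (m 1) - t (m 1) • (1 : Mat8))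
      ((K (m 2) - t (m 2) • (1 : Mat8)) * (K (m 3) - t (m 3) • (1 : Mat8)))
      ((K (m 4) - t (m 4) • (1 : Mat8)) * (K (m 5) - t (m 5) • (1 : Mat8)))
      ((K (m 6) - t (m 6) • (1 : Mat8)) * (K (m 7) - t (m 7) • (1 : Mat8)))) =
      -P.coordSum t K Y Y Y := by
  have h : ∀ a b, (K a - t a • (1 : Mat8)) * (K b - t b • (1 : Mat8)) =
      -Y a b + t a • (K b + t b • (1 : Mat8)) - t b • K a := fun a b => by
    simp only [sub_mul, mul_sub, hK, smul_mul_assoc, mul_smul_comm, one_mul, mul_one]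
    module
  simp only [h]
  refine (P.coordSum_sub_coord t K (fun a b => -Y a b + t a • (K b + t b • (1 : Mat8)) - t b • K a)
    (fun a b => -Y a b + t a • (K b + t b • (1 : Mat8)) - t b • K a)
    (fun a b => -Y a b + t a • (K b + t b • (1 : Mat8)) - t b • K a) 1).trans ?_
  rw [coordSum_add_coord, coordSum_swap12, coordSum_add_coord, coordSum_swap23, coordSum_swap12,
    coordSum_add_coord, coordSum_neg, coordSum_swap12, coordSum_neg, coordSum_swap23,
    coordSum_swap12, coordSum_neg, neg_neg]

end InvPoly

/-- After `coordSum_sub_one` the only dependence on the point z, besides the normal coordinate, is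
the linear factor ℓ(z)ᵀ. The second moments π⁴/24 contract the two coordinates, and the resulting
alternating sum consists of 8! equal terms: 8!/24 = 1680. -/
theorem mapCharge_g8 (P : InvPoly) {Γ : Fin 7 → Mat8} (hΓ : IsGammaSystem Γ) {l : Fin 8 → Mat8}
    (hl : ∀ a, l a = gell Γ (EuclideanSpace.single a 1)) :
    mapCharge P (g8 Γ) = -(1680 * (Real.pi : ℂ) ^ 4) *
      P (frameMul l 0 1) (frameMul l 2 3) (frameMul l 4 5) (frameMul l 6 7) := by
  have hfr : IsFrame l := by rw [funext hl]; exact hΓ.isFrame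
  set c : Fin 8 → Equiv.Perm (Fin 8) → ℂ := fun k σ => ((Equiv.Perm.sign σ : ℤ) : ℂ) *
    P (frameMul l k (σ 1)) (frameMul l (σ 2) (σ 3)) (frameMul l (σ 4) (σ 5))
      (frameMul l (σ 6) (σ 7)) with hc
  have h1 : ∀ z : Metric.sphere (0 : E8) 1, altSum (fun m => (((z : E8) (m 0) : ℝ) : ℂ) *
      mapForm P (g8 Γ) (fun i => m i.succ) z) =
      ∑ k, ∑ σ : Equiv.Perm (Fin 8), (((z : E8) (σ 0) * (z : E8) k : ℝ) : ℂ) * -c k σ := by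
    intro z
    have hz : ‖(z : E8)‖ = 1 := norm_eq_of_mem_sphere z
    -- Move the first ℓ(z)ᵀ past ℓ_a by the Clifford relation; then ℓ(z) ℓ(z)ᵀ = 1 removes the point
    -- from the second term.
    have hK : ∀ a b, ((gell Γ z).transpose * l a) * ((gell Γ z).transpose * l b) =
        (2 * (((z : E8) a : ℝ) : ℂ)) • ((gell Γ z).transpose * l b) - frameMul l a b := by
      intro a b
      have h2 : (gell Γ z).transpose * l a = (2 * (((z : E8) a : ℝ) : ℂ)) • (1 : Mat8) -
          (l a).transpose * gell Γ z := by
        rw [eq_sub_iff_add_eq, hl, hΓ.gell_transpose_mul_add]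
        simp [EuclideanSpace.inner_single_right]
      have h3 : gell Γ z * (gell Γ z).transpose = 1 := by
        rw [hΓ.gell_mul_transpose, hz]; simp
      rw [h2, sub_mul, smul_mul_assoc, one_mul]
      congr 1
      rw [mul_assoc, ← mul_assoc (gell Γ z), h3, one_mul, frameMul]
    have h4 := P.coordSum_sub_one (fun a => (((z : E8) a : ℝ) : ℂ)) hK
    have h5 : ∀ a, mc (g8 Γ) a (z : E8) = (gell Γ z).transpose * l a -
        (((z : E8) a : ℝ) : ℂ) • (1 : Mat8) := fun a => by rw [hΓ.mc_g8 hz, hl]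
    simp only [mapForm, h5]
    refine h4.trans ?_
    have h6 : ∀ a, (gell Γ z).transpose * l a = ∑ k, (((z : E8) k : ℝ) : ℂ) • frameMul l k a := by
      intro a
      rw [gell_eq_sum, Matrix.transpose_sum, Finset.sum_mul]
      simp only [Matrix.transpose_smul, smul_mul_assoc, frameMul, hl]
    rw [InvPoly.coordSum, altSum]
    simp only [h6, P.map_sum0, P.smul0]
    rw [← Finset.sum_neg_distrib, Finset.sum_comm]
    refine Finset.sum_congr rfl fun σ _ => ?_
    rw [Finset.mul_sum, Finset.mul_sum, ← Finset.sum_neg_distrib]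
    refine Finset.sum_congr rfl fun k _ => ?_
    rw [hc, ofReal_mul]
    ring
  have hint : ∀ (a b : Fin 8) (c : ℂ), Integrable (fun z : Metric.sphere (0 : E8) 1 =>
      (((z : E8) a * (z : E8) b : ℝ) : ℂ) * c) (volume : Measure E8).toSphere := fun a b c =>
    Continuous.integrable_of_hasCompactSupport (by fun_prop) (HasCompactSupport.of_compactSpace _)
  rw [mapCharge, sphereIntegral_eq]
  simp only [h1]
  rw [integral_finsetSum _ fun k _ => integrable_finsetSum _ fun σ _ => hint _ _ _]
  simp only [integral_finsetSum _ fun σ _ => hint _ _ _, integral_mul_const,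
    sphere_integral_coord_mul]
  rw [Finset.sum_comm]
  simp only [ite_mul, zero_mul, Finset.sum_ite_eq, Finset.mem_univ, if_true]
  have h2 := hfr.altSum_eq P
  rw [altSum] at h2
  rw [← Finset.mul_sum, Finset.sum_neg_distrib]
  simp only [hc]
  rw [h2]
  ring


/-! ### Evaluation for the standard matrices -/

/-- The sign of the order of two indices. -/
def ordSign (a b : Fin 8) : ℤ := if a < b then 1 else if b < a then -1 else 0

/-- The totally antisymmetric symbol. -/
def levi (j : Fin 8 → Fin 8) : ℤ := ∏ i, ∏ k ∈ Finset.Iio i, ordSign (j k) (j i)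

/-- The product of integers, evaluated only if the first one is not `0`. -/
def lazyMul (p q : ℤ) : ℤ := if p = 0 then 0 else p * q

theorem lazyMul_eq (p q : ℤ) : lazyMul p q = p * q := by
  rw [lazyMul]; split_ifs with h <;> simp [h]

/-- The antisymmetric symbol of eight indices given in pairs. -/
def leviLazy (a b c d e f g h : Fin 8) : ℤ :=
  -- Comparisons inside a pair come last: they never vanish for matrices without diagonal entries,
  -- so testing them early would not stop the evaluation.
  lazyMul (ordSign a c) <| lazyMul (ordSign b c) <| lazyMul (ordSign a e) <|
  lazyMul (ordSign b e) <| lazyMul (ordSign c e) <| lazyMul (ordSign d e) <|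
  lazyMul (ordSign a g) <| lazyMul (ordSign b g) <| lazyMul (ordSign c g) <|
  lazyMul (ordSign d g) <| lazyMul (ordSign e g) <| lazyMul (ordSign f g) <|
  lazyMul (ordSign a d) <| lazyMul (ordSign b d) <| lazyMul (ordSign a f) <|
  lazyMul (ordSign b f) <| lazyMul (ordSign c f) <| lazyMul (ordSign d f) <|
  lazyMul (ordSign a h) <| lazyMul (ordSign b h) <| lazyMul (ordSign c h) <|
  lazyMul (ordSign d h) <| lazyMul (ordSign e h) <| lazyMul (ordSign f h) <|
  lazyMul (ordSign a b) <| lazyMul (ordSign c d) <| lazyMul (ordSign e f) <| ordSign g h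

theorem levi_eq_leviLazy (a b c d e f g h : Fin 8) :
    levi ![a, b, c, d, e, f, g, h] = leviLazy a b c d e f g h := by
  have h1 : ∀ j : Fin 8 → Fin 8, levi j = ∏ i, ∏ k, if k < i then ordSign (j k) (j i) else 1 :=
    fun j => Finset.prod_congr rfl fun i _ => by
      rw [← Finset.prod_filter]
      congr 1
      ext k
      simp
  rw [h1]
  simp only [leviLazy, lazyMul_eq, Fin.prod_univ_eight, Fin.reduceLT, if_true, if_false,
    Matrix.cons_val]
  ring

theorem levi_perm (σ : Equiv.Perm (Fin 8)) : levi σ = Equiv.Perm.sign σ := by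
  rw [Equiv.Perm.sign_eq_prod_prod_Iio, levi, Units.coe_prod]
  refine Finset.prod_congr rfl fun i _ => ?_
  rw [Units.coe_prod]
  refine Finset.prod_congr rfl fun k hk => ?_
  have hne : σ k ≠ σ i := σ.injective.ne (Finset.mem_Iio.mp hk).ne
  rw [ordSign]
  rcases lt_or_gt_of_ne hne with h | h
  · rw [if_pos h, if_pos h]; rfl
  · rw [if_neg h.le.not_gt, if_pos h, if_neg h.le.not_gt]; rfl

theorem levi_eq_zero {j : Fin 8 → Fin 8} (h : ¬ Function.Injective j) : levi j = 0 := by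
  rw [Function.Injective] at h
  push Not at h
  obtain ⟨a, b, hab, hne⟩ := h
  wlog hlt : a < b generalizing a b
  · exact this b a hab.symm hne.symm (lt_of_le_of_ne (not_lt.mp hlt) hne.symm)
  refine Finset.prod_eq_zero (Finset.mem_univ b) (Finset.prod_eq_zero (Finset.mem_Iio.mpr hlt) ?_)
  rw [hab, ordSign, if_neg (lt_irrefl _), if_neg (lt_irrefl _)]

/-- A sum over independent indices instead of permutations: for signed permutation matrices each row
index then fixes its column index, and only 8⁴ terms remain. -/
theorem altSum_eq_sum_levi (w : (Fin 8 → Fin 8) → ℂ) :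
    altSum w = ∑ j, (levi j : ℂ) * w j := by
  refine Finset.sum_of_injOn (fun σ : Equiv.Perm (Fin 8) => (σ : Fin 8 → Fin 8))
    (fun a _ b _ h => Equiv.coe_fn_injective h) (by simp) ?_ ?_
  · intro j _ hj
    have hni : ¬ Function.Injective j := by
      intro hinj
      exact hj ⟨Equiv.ofBijective j (Finite.injective_iff_bijective.mp hinj), by simp, by ext; simp⟩
    rw [levi_eq_zero hni, Int.cast_zero, zero_mul]
  · intro σ _
    rw [levi_perm]

theorem sum_fin8_fun (f : (Fin 8 → Fin 8) → ℂ) : ∑ j, f j =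
    ∑ a, ∑ b, ∑ c, ∑ d, ∑ e, ∑ g, ∑ h, ∑ k, f ![a, b, c, d, e, g, h, k] := by
  have : ∀ (n : ℕ) (f : (Fin (n + 1) → Fin 8) → ℂ),
      ∑ j, f j = ∑ a, ∑ j : Fin n → Fin 8, f (Matrix.vecCons a j) := fun n f => by
    rw [← Equiv.sum_comp (Fin.consEquiv fun _ => Fin 8), Fintype.sum_prod_type]
    rfl
  simp only [this, Finset.univ_unique, Finset.sum_singleton]
  rfl

/-- The polarized Pfaffian of four signed permutation matrices. -/
def monoPf (x y z w : Fin 8 → Fin 8 × ℤ) : ℤ :=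
  ∑ a, ∑ c, ∑ e, ∑ h, levi ![a, (x a).1, c, (y c).1, e, (z e).1, h, (w h).1] *
    ((x a).2 * (y c).2 * (z e).2 * (w h).2)

theorem pfPoly_mono (x y z w : Fin 8 → Fin 8 × ℤ) :
    pfPoly (cx (zr (monoMat x))) (cx (zr (monoMat y))) (cx (zr (monoMat z)))
      (cx (zr (monoMat w))) = (monoPf x y z w : ℂ) := by
  have h : ∀ (x : Fin 8 → Fin 8 × ℤ) a b, cx (zr (monoMat x)) a b =
      if (x a).1 = b then ((x a).2 : ℂ) else 0 := fun x a b => by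
    have : cx (zr (monoMat x)) a b = (((monoMat x a b : ℤ) : ℝ) : ℂ) := rfl
    rw [this, monoMat]
    split_ifs <;> simp
  have hs : ∀ (x : Fin 8 → Fin 8 × ℤ) (a : Fin 8) (F : Fin 8 → ℂ),
      (∀ b, (x a).1 ≠ b → F b = 0) → ∑ b, F b = F (x a).1 := fun x a F hF =>
    Finset.sum_eq_single _ (fun b _ hb => hF b (Ne.symm hb)) (by simp)
  rw [pfPoly, altSum_eq_sum_levi, sum_fin8_fun, monoPf]
  push_cast
  refine Finset.sum_congr rfl fun a _ => (hs x a _ fun b hb => ?_).trans ?_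
  · simp [h, hb]
  refine Finset.sum_congr rfl fun c _ => (hs y c _ fun b hb => ?_).trans ?_
  · simp [h, hb]
  refine Finset.sum_congr rfl fun e _ => (hs z e _ fun b hb => ?_).trans ?_
  · simp [h, hb]
  refine Finset.sum_congr rfl fun g _ => (hs w g _ fun b hb => ?_).trans ?_
  · simp [h, hb]
  simp [h]

theorem monoPf_lTab : monoPf (monoMul (lTab 0) (lTab 1)) (monoMul (lTab 2) (lTab 3))
    (monoMul (lTab 4) (lTab 5)) (lTab 6) = 128 := by
  simp only [monoPf, levi_eq_leviLazy, ← lazyMul_eq]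
  decide +kernel

theorem gell_single_castSucc (m : Fin 7) :
    gell gammaStd (EuclideanSpace.single m.castSucc 1) = cx (zr (lStd m)) := by
  have h : m.castSucc ≠ (7 : Fin 8) := (Fin.castSucc_lt_last m).ne
  rw [gell, gdot_gammaStd, Finset.sum_eq_single m]
  · simp [h.symm]
  · intro n _ hn
    have : n.castSucc ≠ m.castSucc := fun h' => hn (Fin.castSucc_injective _ h')
    simp [this]
  · simp

theorem gell_single_last : gell gammaStd (EuclideanSpace.single 7 1) = 1 := by
  have h : ∀ m : Fin 7, m.castSucc ≠ (7 : Fin 8) := fun m => (Fin.castSucc_lt_last m).ne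
  rw [gell, gdot_gammaStd]
  simp [h]

theorem frameMul_gammaStd (m n : Fin 7) :
    frameMul (fun a => gell gammaStd (EuclideanSpace.single a 1)) m.castSucc n.castSucc =
      -cx (zr (lStd m * lStd n)) := by
  rw [frameMul, gell_single_castSucc, gell_single_castSucc, ← cx_transpose,
    isRealClifford_lStd.antisymm m, map_neg, neg_mul, map_mul, map_mul]

theorem frameMul_gammaStd_last :
    frameMul (fun a => gell gammaStd (EuclideanSpace.single a 1)) 6 7 = -cx (zr (lStd 6)) := by
  have h := gell_single_castSucc 6
  rw [frameMul]
  change (gell gammaStd (EuclideanSpace.single (Fin.castSucc (6 : Fin 7)) 1)).transpose * _ = _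
  rw [h, gell_single_last, mul_one, ← cx_transpose, isRealClifford_lStd.antisymm 6, map_neg]

/-- Since ℓ₈ = 1, the four bilinears are -L₀L₁, -L₂L₃, -L₄L₅ and -L₆; their signs cancel, the
Pfaffian is 128, and 1680 · 128 = 215040 = 3 · 2¹¹ · 35. -/
theorem mapCharge_pfInvPoly_g8_gammaStd :
    mapCharge pfInvPoly (g8 gammaStd) = -(215040 * (Real.pi : ℂ) ^ 4) := by
  rw [mapCharge_g8 pfInvPoly isGammaSystem_gammaStd fun a => rfl, frameMul_gammaStd_last]
  have h01 := frameMul_gammaStd 0 1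
  have h23 := frameMul_gammaStd 2 3
  have h45 := frameMul_gammaStd 4 5
  change -(1680 * (Real.pi : ℂ) ^ 4) * pfInvPoly
    (frameMul (fun a => gell gammaStd (EuclideanSpace.single a 1)) (Fin.castSucc (0 : Fin 7))
      (Fin.castSucc (1 : Fin 7)))
    (frameMul (fun a => gell gammaStd (EuclideanSpace.single a 1)) (Fin.castSucc (2 : Fin 7))
      (Fin.castSucc (3 : Fin 7)))
    (frameMul (fun a => gell gammaStd (EuclideanSpace.single a 1)) (Fin.castSucc (4 : Fin 7))
      (Fin.castSucc (5 : Fin 7))) _ = _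
  rw [h01, h23, h45, InvPoly.neg0, InvPoly.neg1, InvPoly.swap12, InvPoly.neg1, InvPoly.swap23,
    InvPoly.swap12, InvPoly.neg1, InvPoly.swap12, InvPoly.swap23, InvPoly.swap12]
  have h : pfInvPoly (cx (zr (lStd 0 * lStd 1))) (cx (zr (lStd 2 * lStd 3)))
      (cx (zr (lStd 4 * lStd 5))) (cx (zr (lStd 6))) = 128 := by
    simp only [lStd, monoMat_mul]
    refine (pfPoly_mono _ _ _ _).trans ?_
    rw [monoPf_lTab]
    norm_num
  rw [h]
  ring

/-- Bilinears with disjoint indices commute, so all six orderings of the trace equal the trace of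
L₀⋯L₆ = 1, which is 8; and 1680 · 8 = 13440 = 2⁷ · 3 · 35. -/
theorem mapCharge_tracePoly_g8_gammaStd :
    mapCharge tracePoly (g8 gammaStd) = -(13440 * (Real.pi : ℂ) ^ 4) := by
  rw [mapCharge_g8 tracePoly isGammaSystem_gammaStd fun a => rfl]
  have hl := isGammaSystem_gammaStd.isFrame
  set l := fun a => gell gammaStd (EuclideanSpace.single a 1)
  have c1 : frameMul l 4 5 * frameMul l 2 3 = frameMul l 2 3 * frameMul l 4 5 :=
    hl.frameMul_commute (by decide) (by decide) (by decide) (by decide)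
  have c2 : frameMul l 6 7 * frameMul l 4 5 = frameMul l 4 5 * frameMul l 6 7 :=
    hl.frameMul_commute (by decide) (by decide) (by decide) (by decide)
  have c3 : frameMul l 6 7 * frameMul l 2 3 = frameMul l 2 3 * frameMul l 6 7 :=
    hl.frameMul_commute (by decide) (by decide) (by decide) (by decide)
  have d1 : ∀ V, frameMul l 4 5 * (frameMul l 2 3 * V) = frameMul l 2 3 * (frameMul l 4 5 * V) :=
    fun V => by rw [← mul_assoc, c1, mul_assoc]
  have d3 : ∀ V, frameMul l 6 7 * (frameMul l 2 3 * V) = frameMul l 2 3 * (frameMul l 6 7 * V) :=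
    fun V => by rw [← mul_assoc, c3, mul_assoc]
  have h : frameMul l 0 1 * (frameMul l 2 3 * (frameMul l 4 5 * frameMul l 6 7)) = 1 := by
    have h01 : frameMul l 0 1 = -cx (zr (lStd 0 * lStd 1)) := frameMul_gammaStd 0 1
    have h23 : frameMul l 2 3 = -cx (zr (lStd 2 * lStd 3)) := frameMul_gammaStd 2 3
    have h45 : frameMul l 4 5 = -cx (zr (lStd 4 * lStd 5)) := frameMul_gammaStd 4 5
    have h67 : frameMul l 6 7 = -cx (zr (lStd 6)) := frameMul_gammaStd_last
    have hp := lStd_product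
    simp only [mul_assoc] at hp
    rw [h01, h23, h45, h67]
    simp only [neg_mul, mul_neg, neg_neg]
    rw [← map_mul, ← map_mul, ← map_mul, ← map_mul,
      ← map_mul, ← map_mul, mul_assoc, mul_assoc, mul_assoc, hp, map_one, map_one]
  have ht : tracePoly (frameMul l 0 1) (frameMul l 2 3) (frameMul l 4 5) (frameMul l 6 7) = 8 := by
    simp only [tracePoly, mul_assoc, c1, c2, c3, d1, d3, h, Matrix.trace_one, Fintype.card_fin]
    norm_num
  rw [ht]
  ring


/-! ### The charges of the composite maps -/

theorem chargeQ_of_mapCharge {g : E8 → Mat8} {k : ℂ}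
    (h : mapCharge tracePoly g = k * mapCharge tracePoly (g8 gammaStd)) : chargeQ g = k := by
  have hπ : (Real.pi : ℂ) ≠ 0 := ofReal_ne_zero.mpr Real.pi_ne_zero
  rw [chargeQ_eq, h, mapCharge_tracePoly_g8_gammaStd]
  field_simp
  ring

theorem chargeQt_of_mapCharge {g : E8 → Mat8} (hg : IsSphereMapToSO8 g) {k : ℂ}
    (h : mapCharge pfInvPoly g = k * mapCharge pfInvPoly (g8 gammaStd)) : chargeQt g = k := by
  have hπ : (Real.pi : ℂ) ≠ 0 := ofReal_ne_zero.mpr Real.pi_ne_zero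
  rw [chargeQt_eq hg, h, mapCharge_pfInvPoly_g8_gammaStd]
  field_simp
  ring

theorem mapCharge_g8_of_conj (P : InvPoly) {Γ : Fin 7 → Mat8} {O : Mat8}
    (hO : O * O.transpose = 1) (h : ∀ k, Γ k = O * gammaStd k * O.transpose) :
    mapCharge P (g8 Γ) = P.χ O * mapCharge P (g8 gammaStd) := by
  have : g8 Γ = fun x => O * g8 gammaStd x * O.transpose := funext fun x => exp8_conj hO h _
  rw [this, mapCharge_conj P isGammaSystem_gammaStd.g8_isSphereMap hO]

theorem g7_eq_of_conj {Γ : Fin 7 → Mat8} {O : Mat8}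
    (hO : O * O.transpose = 1) (h : ∀ k, Γ k = O * gammaStd k * O.transpose) :
    g7 Γ = fun x => O * g7 gammaStd x * O.transpose := funext fun _ => exp7_conj hO h _

theorem mapCharge_g7_of_conj (P : InvPoly) {Γ : Fin 7 → Mat8} {O : Mat8}
    (hO : O * O.transpose = 1) (h : ∀ k, Γ k = O * gammaStd k * O.transpose) :
    mapCharge P (g7 Γ) = P.χ O * ((2 * P.χ refl8 - 1) * mapCharge P (g8 gammaStd)) := by
  rw [g7_eq_of_conj hO h, mapCharge_conj P g7_gammaStd_isSphereMap hO, mapCharge_g7_gammaStd]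

theorem IsGammaSystem.g7_ballToSphere {Γ : Fin 7 → Mat8} (hΓ : IsGammaSystem Γ) (α : E7) :
    g7 Γ (ballToSphere α) = exp7 Γ α := by
  obtain ⟨R, hR, h⟩ := hΓ.exists_rotation
  have hO : cx R * (cx R).transpose = 1 := by
    rw [← cx_transpose, ← map_mul, (Matrix.mem_orthogonalGroup_iff _ _).mp hR, map_one]
  rw [g7_eq_of_conj hO h, exp7_conj hO h]
  change cx R * g7 gammaStd (ballToSphere α) * (cx R).transpose = _
  rw [g7_gammaStd, exp7_gammaStd,
    g8_ballToSphere isGammaSystem_gammaStd]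

theorem IsGammaSystem.g7_isSphereMap {Γ : Fin 7 → Mat8} (hΓ : IsGammaSystem Γ) :
    IsSphereMapToSO8 (g7 Γ) := by
  obtain ⟨R, hR, h⟩ := hΓ.exists_rotation
  have hO : cx R * (cx R).transpose = 1 := by
    rw [← cx_transpose, ← map_mul, (Matrix.mem_orthogonalGroup_iff _ _).mp hR, map_one]
  rw [g7_eq_of_conj hO h]
  exact g7_gammaStd_isSphereMap.conj hO fun a b => Complex.ofReal_im _

/-- The orientation of a system of gamma matrices, relative to the standard one. -/
theorem IsGammaSystem.exists_orientation {Γ : Fin 7 → Mat8} (hΓ : IsGammaSystem Γ) :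
    ∃ s : ℤ, (s = 1 ∨ s = -1) ∧
      (∀ R ∈ Matrix.orthogonalGroup (Fin 8) ℝ,
        (∀ k, Γ k = R.map (fun t : ℝ => (t : ℂ)) * gammaStd k *
          (R.map (fun t : ℝ => (t : ℂ))).transpose) → (s : ℝ) = R.det) ∧
      mapCharge tracePoly (g8 Γ) = mapCharge tracePoly (g8 gammaStd) ∧
      mapCharge tracePoly (g7 Γ) = mapCharge tracePoly (g8 gammaStd) ∧
      mapCharge pfInvPoly (g8 Γ) = s * mapCharge pfInvPoly (g8 gammaStd) ∧
      mapCharge pfInvPoly (g7 Γ) = -3 * s * mapCharge pfInvPoly (g8 gammaStd) := by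
  obtain ⟨R, hR, h⟩ := hΓ.exists_rotation
  have horth : ∀ R ∈ Matrix.orthogonalGroup (Fin 8) ℝ, cx R * (cx R).transpose = 1 :=
    fun R hR => by
      rw [← cx_transpose, ← map_mul, (Matrix.mem_orthogonalGroup_iff _ _).mp hR, map_one]
  have hdet : R.det = 1 ∨ R.det = -1 := by
    have := congrArg Matrix.det ((Matrix.mem_orthogonalGroup_iff _ _).mp hR)
    rw [Matrix.det_mul, Matrix.det_transpose, Matrix.det_one] at this
    exact mul_self_eq_one_iff.mp this
  obtain ⟨s, hs, hsR⟩ : ∃ s : ℤ, (s = 1 ∨ s = -1) ∧ (s : ℝ) = R.det := by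
    rcases hdet with h | h
    · exact ⟨1, Or.inl rfl, by rw [h]; simp⟩
    · exact ⟨-1, Or.inr rfl, by rw [h]; simp⟩
  have hχ : pfInvPoly.χ (cx R) = (s : ℂ) := by
    have h1 : pfInvPoly.χ (cx R) = (cx R).det := rfl
    rw [h1, cx_det, ← hsR]
    simp
  have h8 := mapCharge_g8_of_conj pfInvPoly (horth R hR) h
  rw [hχ] at h8
  refine ⟨s, hs, fun R' hR' h' => ?_, ?_, ?_, h8, ?_⟩
  -- The Pfaffian charge of g₈ depends on Γ alone and is det R times a non-zero constant, so every R
  -- that relates Γ to the standard matrices has the same determinant.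
  · have h8' := mapCharge_g8_of_conj pfInvPoly (horth R' hR') h'
    have hc : mapCharge pfInvPoly (g8 gammaStd) ≠ 0 := by
      rw [mapCharge_pfInvPoly_g8_gammaStd]
      exact neg_ne_zero.mpr (mul_ne_zero (by norm_num)
        (pow_ne_zero _ (ofReal_ne_zero.mpr Real.pi_ne_zero)))
    have h1 : (s : ℂ) = (R'.det : ℂ) := by
      rw [← cx_det]
      exact mul_right_cancel₀ hc (h8.symm.trans h8')
    exact_mod_cast h1
  · exact (mapCharge_g8_of_conj tracePoly (horth R hR) h).trans (one_mul _)
  · refine (mapCharge_g7_of_conj tracePoly (horth R hR) h).trans ?_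
    change 1 * ((2 * 1 - 1) * _) = _
    ring
  · refine (mapCharge_g7_of_conj pfInvPoly (horth R hR) h).trans ?_
    have h1 : pfInvPoly.χ refl8 = -1 := refl8_det
    rw [hχ, h1]
    ring

/-! ### The main theorem. -/

theorem mainTheorem4 :
    IsGammaSystem gammaStd ∧
    ∀ Γ : Fin 7 → Mat8, IsGammaSystem Γ →
      -- `g₈` and `g₇` are the maps on the sphere given by the two exponentials
      (∀ α : E7, ‖α‖ ≤ Real.pi →
        g8 Γ (ballToSphere α) = exp8 Γ α ∧ g7 Γ (ballToSphere α) = exp7 Γ α) ∧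
      -- `s` is the orientation of the spinor basis relative to that of the standard matrices
      ∃ s : ℤ, (s = 1 ∨ s = -1) ∧ (Γ = gammaStd → s = 1) ∧
        (∀ R ∈ Matrix.orthogonalGroup (Fin 8) ℝ,
          (∀ k, Γ k = R.map (fun t : ℝ => (t : ℂ)) * gammaStd k *
            (R.map (fun t : ℝ => (t : ℂ))).transpose) → (s : ℝ) = R.det) ∧
        -- the general formulas, in both orders, for maps and for gauge fields
        (∀ (n m : ℤ) (g : E8 → Mat8), g = comp87 Γ n m ∨ g = comp78 Γ n m →
          IsSphereMapToSO8 g ∧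
          chargeQ g = ((n + m : ℤ) : ℂ) ∧
          chargeQt g = ((s * (n - 3 * m) : ℤ) : ℂ) ∧
          (∃ A, IsAssociatedField A g) ∧
          (∀ A, IsAssociatedField A g →
            fieldQ A = ((n + m : ℤ) : ℂ) ∧
            fieldQt A = ((s * (n - 3 * m) : ℤ) : ℂ))) ∧
        -- the table
        (chargeQ (g8 Γ) = 1 ∧ chargeQt (g8 Γ) = s * 1) ∧
        (chargeQ (g7 Γ) = 1 ∧ chargeQt (g7 Γ) = s * (-3)) ∧
        (chargeQ (fun x => g7 Γ x * g8 Γ x) = 2 ∧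
          chargeQt (fun x => g7 Γ x * g8 Γ x) = s * (-2)) ∧
        (chargeQ (fun x => g7 Γ x * (g8 Γ x)⁻¹) = 0 ∧
          chargeQt (fun x => g7 Γ x * (g8 Γ x)⁻¹) = s * (-4)) ∧
        -- the two charges of the gauge fields are linearly independent
        (∀ a b : ℂ, (∀ (n m : ℤ) (A : Fin 8 → E8 → Mat8),
            IsAssociatedField A (comp87 Γ n m) → a * fieldQ A + b * fieldQt A = 0) →
          a = 0 ∧ b = 0) := by
  refine ⟨isGammaSystem_gammaStd, fun Γ hΓ => ⟨fun α _ =>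
    ⟨g8_ballToSphere hΓ α, hΓ.g7_ballToSphere α⟩, ?_⟩⟩
  have m8 := hΓ.g8_isSphereMap
  have m7 := hΓ.g7_isSphereMap
  obtain ⟨s, hs, hR, t8, t7, p8, p7⟩ := hΓ.exists_orientation
  have hmain : ∀ (n m : ℤ) (g : E8 → Mat8), g = comp87 Γ n m ∨ g = comp78 Γ n m →
      IsSphereMapToSO8 g ∧ chargeQ g = ((n + m : ℤ) : ℂ) ∧
      chargeQt g = ((s * (n - 3 * m) : ℤ) : ℂ) ∧ (∃ A, IsAssociatedField A g) ∧
      (∀ A, IsAssociatedField A g → fieldQ A = ((n + m : ℤ) : ℂ) ∧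
        fieldQt A = ((s * (n - 3 * m) : ℤ) : ℂ)) := by
    intro n m g hg
    have hsm : IsSphereMapToSO8 g := by
      rcases hg with rfl | rfl
      · exact (m8.zpow n).mul (m7.zpow m)
      · exact (m7.zpow m).mul (m8.zpow n)
    -- A homomorphism into a commutative group does not see the order of the factors.
    have hch : ∀ P : InvPoly, mapCharge P g =
        n * mapCharge P (g8 Γ) + m * mapCharge P (g7 Γ) := fun P => by
      rcases hg with rfl | rfl
      · refine (mapCharge_mul P (m8.zpow n) (m7.zpow m)).trans ?_
        rw [mapCharge_zpow P m8, mapCharge_zpow P m7]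
      · refine (mapCharge_mul P (m7.zpow m) (m8.zpow n)).trans ?_
        rw [mapCharge_zpow P m8, mapCharge_zpow P m7, add_comm]
    have hq : chargeQ g = ((n + m : ℤ) : ℂ) := chargeQ_of_mapCharge <| by
      rw [hch, t8, t7]
      push_cast
      ring
    have hqt : chargeQt g = ((s * (n - 3 * m) : ℤ) : ℂ) := chargeQt_of_mapCharge hsm <| by
      rw [hch, p8, p7]
      push_cast
      ring
    refine ⟨hsm, hq, hqt, ⟨_, isAssociatedField_cutField isCut_inner hsm⟩, fun A hA => ?_⟩
    obtain ⟨h1, h2⟩ := hA.charges hsm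
    exact ⟨h1.trans hq, h2.trans hqt⟩
  refine ⟨s, hs, ?_, hR, hmain, ⟨?_, ?_⟩, ⟨?_, ?_⟩, ⟨?_, ?_⟩, ⟨?_, ?_⟩, fun a b hab => ?_⟩
  · rintro rfl
    have := hR 1 (one_mem _) fun k => by
      rw [← cx_apply, map_one, Matrix.transpose_one, one_mul, mul_one]
    rw [Matrix.det_one] at this
    exact_mod_cast this
  · exact chargeQ_of_mapCharge (by rw [t8, one_mul])
  · exact chargeQt_of_mapCharge m8 (by rw [p8, mul_one])
  · exact chargeQ_of_mapCharge (by rw [t7, one_mul])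
  · exact chargeQt_of_mapCharge m7 (by rw [p7]; ring)
  · exact chargeQ_of_mapCharge (by rw [mapCharge_mul _ m7 m8, t7, t8]; ring)
  · exact chargeQt_of_mapCharge (m7.mul m8) (by rw [mapCharge_mul _ m7 m8, p7, p8]; ring)
  · exact chargeQ_of_mapCharge (by rw [mapCharge_mul _ m7 m8.inv, mapCharge_inv _ m8, t7, t8]; ring)
  · exact chargeQt_of_mapCharge (m7.mul m8.inv)
      (by rw [mapCharge_mul _ m7 m8.inv, mapCharge_inv _ m8, p7, p8]; ring)
  -- Fields associated with g₈ and g₇ have charges (1, s) and (1, -3s), and the determinant -4s of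
  -- these two vectors is not zero.
  · obtain ⟨-, -, -, ⟨A, hA⟩, hA'⟩ := hmain 1 0 _ (Or.inl rfl)
    obtain ⟨-, -, -, ⟨B, hB⟩, hB'⟩ := hmain 0 1 _ (Or.inl rfl)
    have e1 := hab 1 0 A hA
    have e2 := hab 0 1 B hB
    rw [(hA' A hA).1, (hA' A hA).2] at e1
    rw [(hB' B hB).1, (hB' B hB).2] at e2
    push_cast at e1 e2
    have hs0 : (s : ℂ) ≠ 0 := by rcases hs with rfl | rfl <;> simp
    have hb : b = 0 := by
      have : b * (s : ℂ) = 0 := by linear_combination (e1 - e2) / 4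
      exact (mul_eq_zero.mp this).resolve_right hs0
    subst hb
    exact ⟨by linear_combination e1, rfl⟩
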